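/- Let $n,m,p,q$ be positive integers with $p>q$ and $p(m-1)=q(n-1)$. For $x\in\mathbb R^n$, $y\in\mathbb R^m$, $z\in\mathbb R$ (with Euclidean norms) let $$f(x,y,z)=|x|^{2p}-|y|^{2q}z^{2(p-q)},\qquad V=\{[x,y,z] : f(x,y,z)=0\}\subset\mathbb{RP}^{n+m},$$ let $\operatorname{sing}V$ be the set of points of $V$ at which all first partial derivatives of $f$ vanish, and let $M=V\setminus\operatorname{sing}V$, a submanifold of dimension $n+m-1$. Let $g$ be any smooth Riemannian metric on $\mathbb{RP}^{n+m}$, and equip $M$ with the induced metric. Let $(\cdot,\cdot)$ be the $L^2$ inner product of forms on $M$, let $d$ be the exterior derivative on the space $\Omega_0(M)$ of smooth compactly supported forms, $d^t$ its formal adjoint, $d_{\max}=(d^t)^*$ and $d^t_{\max}=d^*$ (Hilbert space adjoints). One says that the $L^2$-Stokes theorem holds for $k$-forms if $$(d_{\max}\omega,\eta)=(\omega,d^t_{\max}\eta)$$ for all $\omega\in\operatorname{dom}(d_{\max})$ of degree $k$ and all $\eta\in\operatorname{dom}(d^t_{\max})$ of degree $k+1$. Then $P=[0,0,1]$ is an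 isolated point of $\operatorname{sing}V$, and the $L^2$-Stokes theorem fails on $M$ for $k$-forms both for $k=n-1$ and for $k=m-1$. The failure occurs near $P$: for each of these $k$ and every neighbourhood $U$ of $P$ in $\mathbb{RP}^{n+m}$, the identity above fails already for some such $\omega$ and $\eta$ that vanish outside $U$. -/

import Mathlib

open scoped ContDiff Topology LinearAlgebra.Projectivization
open MeasureTheory

noncomputable section

namespace L2Stokes

/-! ### Real projective space

Throughout `E` is a finite-dimensional real vector space and `ℙ ℝ E` is the projective space of its
lines.  With `π : E ∖ {0} → ℙ ℝ E` the projection, a tangent vector of `ℙ ℝ E` at `[v]` is given by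
`w ∈ E` modulo `ℝ v`, and the pairs `(v, w)` and `(t v, t w)` describe the same tangent vector.
Since `π` is a surjective submersion with fibres the orbits of scaling, a covariant tensor field on
`ℙ ℝ E` is the same thing as a tensor field on `E ∖ {0}` which is killed by the radial vector and
is invariant under scaling (namely its pull-back under `π`), and one is smooth iff the other is. -/

section Projective

variable {E : Type*} [NormedAddCommGroup E] [NormedSpace ℝ E]

/-- The quotient topology on projective space. -/
instance : TopologicalSpace (ℙ ℝ E) :=
  inferInstanceAs (TopologicalSpace (Quotient (projectivizationSetoid ℝ E)))

/-- The Borel sigma-algebra on projective space. -/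
instance : MeasurableSpace (ℙ ℝ E) := borel _

variable (E) in
/-- A smooth Riemannian metric on the projective space `ℙ ℝ E`, given by its pull-back to
`E ∖ {0}`. (Values at `v = 0` are irrelevant.) -/
structure ProjMetric where
  toFun : E → E →L[ℝ] E →L[ℝ] ℝ
  symm : ∀ v w w', v ≠ 0 → toFun v w w' = toFun v w' w
  scale : ∀ (t : ℝ) v w w', t ≠ 0 → v ≠ 0 → toFun (t • v) (t • w) (t • w') = toFun v w w'
  radial : ∀ v w, v ≠ 0 → toFun v v w = 0
  pos : ∀ v w, v ≠ 0 → w ∉ Submodule.span ℝ {v} → 0 < toFun v w w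
  smooth : ContDiffOn ℝ ∞ toFun {0}ᶜ

variable (E) in
/-- A (not necessarily continuous) field of alternating `k`-forms on the tangent spaces of
`ℙ ℝ E`, given by its pull-back to `E ∖ {0}`.  A `k`-form on a submanifold `M` of `ℙ ℝ E` is
represented by such a field; only the restrictions to the tangent spaces of `M` at the points of
`M` are ever used, and every `k`-form on `M` has such a representative. -/
structure ProjForm (k : ℕ) where
  toFun : E → E [⋀^Fin k]→L[ℝ] ℝ
  scale : ∀ (t : ℝ) v (w : Fin k → E), t ≠ 0 → v ≠ 0 →
    toFun (t • v) (fun i => t • w i) = toFun v w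
  radial : ∀ v (w : Fin k → E), v ≠ 0 → (∃ i, w i = v) → toFun v w = 0

/-- A smooth local parametrization of a `d`-dimensional submanifold `M` of `ℙ ℝ E` (the inverse of
a chart of `M`), together with a smooth lift `toFun` to homogeneous coordinates: `u ↦ [toFun u]` is
an immersion on the open set `source` of `ℝ^d` and a homeomorphism onto an open subset of `M`. -/
structure LocalParam (M : Set (ℙ ℝ E)) (d : ℕ) where
  source : Set (EuclideanSpace ℝ (Fin d))
  toFun : EuclideanSpace ℝ (Fin d) → E
  isOpen_source : IsOpen source
  smooth : ContDiffOn ℝ ∞ toFun source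
  ne_zero : ∀ u ∈ source, toFun u ≠ 0
  immersion : ∀ u ∈ source, ∀ a, fderiv ℝ toFun u a ∈ Submodule.span ℝ {toFun u} → a = 0
  mem : ∀ u (hu : u ∈ source), Projectivization.mk ℝ (toFun u) (ne_zero u hu) ∈ M
  isOpenEmbedding : Topology.IsOpenEmbedding
    (fun u : source => (⟨Projectivization.mk ℝ (toFun u) (ne_zero u u.2), mem u u.2⟩ : M))

end Projective

/-! ### Riemannian linear algebra in coordinates -/

/-- The inner product of two alternating `k`-forms on `ℝ^d`, where `ℝ^d` carries the scalar product
with Gram matrix `G`.  For `G = 1` the forms `e^{i₁} ∧ ⋯ ∧ e^{i_k}`, `i₁ < ⋯ < i_k`, are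
orthonormal. -/
def formInner {d k : ℕ} (G : Matrix (Fin d) (Fin d) ℝ)
    (α β : EuclideanSpace ℝ (Fin d) [⋀^Fin k]→L[ℝ] ℝ) : ℝ :=
  ((k.factorial : ℝ))⁻¹ * ∑ I : Fin k → Fin d, ∑ J : Fin k → Fin d,
    (∏ a, G⁻¹ (I a) (J a)) *
      (α (fun a => EuclideanSpace.single (I a) (1 : ℝ)) *
        β (fun a => EuclideanSpace.single (J a) (1 : ℝ)))

section Forms

variable {E : Type*} [NormedAddCommGroup E] [NormedSpace ℝ E] {M : Set (ℙ ℝ E)} {d k : ℕ}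

namespace LocalParam

/-- The map `u ↦ [ψ u]` into `M`. -/
def toM (ψ : LocalParam M d) (u : ψ.source) : M :=
  ⟨Projectivization.mk ℝ (ψ.toFun u) (ψ.ne_zero u u.2), ψ.mem u u.2⟩

/-- The pull-back of a form on `M` to the parameter domain. -/
def pull (ψ : LocalParam M d) (θ : ProjForm E k) (u : EuclideanSpace ℝ (Fin d)) :
    EuclideanSpace ℝ (Fin d) [⋀^Fin k]→L[ℝ] ℝ :=
  (θ.toFun (ψ.toFun u)).compContinuousLinearMap (fderiv ℝ ψ.toFun u)

/-- The coefficients `g_{ij}` of the metric induced on `M`, in the given coordinates. -/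
def gram (ψ : LocalParam M d) (g : ProjMetric E) (u : EuclideanSpace ℝ (Fin d)) :
    Matrix (Fin d) (Fin d) ℝ :=
  Matrix.of fun i j => g.toFun (ψ.toFun u)
    (fderiv ℝ ψ.toFun u (EuclideanSpace.single i (1 : ℝ)))
    (fderiv ℝ ψ.toFun u (EuclideanSpace.single j (1 : ℝ)))

/-- The Riemannian volume measure of the part of `M` covered by `ψ`, namely the image of
`√(det g_{ij}) du`. -/
def vol (ψ : LocalParam M d) (g : ProjMetric E) : Measure M :=
  (((volume : Measure (EuclideanSpace ℝ (Fin d))).comap (Subtype.val : ψ.source → _)).withDensity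
    fun u : ψ.source => ENNReal.ofReal (Real.sqrt (ψ.gram g u).det)).map ψ.toM

end LocalParam

variable (M d) in
/-- The Riemannian volume measure of `M`: the least measure on `M` which dominates the volume
measures of all coordinate patches (equivalently, the only one restricting to each of them). -/
def volM (g : ProjMetric E) : Measure M := ⨆ ψ : LocalParam M d, ψ.vol g

open Classical in
variable (d) in
/-- The pointwise inner product of two `k`-forms on `M`, computed in some coordinates around the
point; the result does not depend on the coordinates. -/
def pointInner (g : ProjMetric E) (θ η : ProjForm E k) (P : M) : ℝ :=
  if h : ∃ c : (Σ ψ : LocalParam M d, ψ.source), c.1.toM c.2 = P then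
    formInner (h.choose.1.gram g h.choose.2) (h.choose.1.pull θ h.choose.2)
      (h.choose.1.pull η h.choose.2)
  else 0

variable (M d) in
/-- The `L²` inner product `(θ, η) = ∫_M ⟨θ, η⟩ dvol` of forms on `M`. -/
def l2Inner (g : ProjMetric E) (θ η : ProjForm E k) : ℝ :=
  ∫ P : M, pointInner d g θ η P ∂(volM M d g)

variable (M d) in
/-- `θ` is a measurable, square integrable form on `M`. -/
def IsL2 (g : ProjMetric E) (θ : ProjForm E k) : Prop :=
  (∀ ψ : LocalParam M d, AEStronglyMeasurable (ψ.pull θ) (volume.restrict ψ.source)) ∧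
    ∫⁻ P : M, ENNReal.ofReal (pointInner d g θ θ P) ∂(volM M d g) < ⊤

variable (M d) in
/-- The restriction of `θ` to `M` vanishes at all points outside `U`. -/
def SupportedIn (U : Set (ℙ ℝ E)) (θ : ProjForm E k) : Prop :=
  ∀ (ψ : LocalParam M d) (u : ψ.source), (ψ.toM u : ℙ ℝ E) ∉ U → ψ.pull θ u = 0

variable (M d) in
/-- `θ ∈ Ω₀(M)`: the restriction of `θ` to `M` is a smooth form with compact support in `M`. -/
def IsTestForm (θ : ProjForm E k) : Prop :=
  (∀ ψ : LocalParam M d, ContDiffOn ℝ ∞ (ψ.pull θ) ψ.source) ∧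
    ∃ K : Set (ℙ ℝ E), IsCompact K ∧ K ⊆ M ∧ SupportedIn M d K θ

variable (M d) in
/-- `σ = d θ` on `M`, for `θ` smooth. -/
def IsExtDeriv (θ : ProjForm E k) (σ : ProjForm E (k + 1)) : Prop :=
  ∀ (ψ : LocalParam M d), ∀ u ∈ ψ.source, ψ.pull σ u = extDeriv (ψ.pull θ) u

variable (M d) in
/-- `(dφ, η) = (φ, ζ)` for all `φ ∈ Ω₀^k(M)`. -/
def AdjointEq (g : ProjMetric E) (η : ProjForm E (k + 1)) (ζ : ProjForm E k) : Prop :=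
  ∀ (φ : ProjForm E k) (dφ : ProjForm E (k + 1)), IsTestForm M d φ → IsExtDeriv M d φ dφ →
    l2Inner M d g dφ η = l2Inner M d g φ ζ

variable (M d) in
/-- `η` and `ζ` are in `Ω₀(M)` and `ζ = dᵗ η`, where `dᵗ` is the formal adjoint of `d`. -/
def IsCodiff (g : ProjMetric E) (η : ProjForm E (k + 1)) (ζ : ProjForm E k) : Prop :=
  IsTestForm M d η ∧ IsTestForm M d ζ ∧ AdjointEq M d g η ζ

variable (M d) in
/-- `θ ∈ dom(d_max)` and `d_max θ = σ`, where `d_max = (dᵗ)^*` is the Hilbert space adjoint of the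
formal adjoint `dᵗ : Ω₀^{k+1}(M) → Ω₀^k(M)`. -/
def IsDMax (g : ProjMetric E) (θ : ProjForm E k) (σ : ProjForm E (k + 1)) : Prop :=
  IsL2 M d g θ ∧ IsL2 M d g σ ∧
    ∀ (η : ProjForm E (k + 1)) (ζ : ProjForm E k), IsCodiff M d g η ζ →
      l2Inner M d g σ η = l2Inner M d g θ ζ

variable (M d) in
/-- `η ∈ dom(dᵗ_max)` and `dᵗ_max η = ζ`, where `dᵗ_max = d^*` is the Hilbert space adjoint of
`d : Ω₀^k(M) → Ω₀^{k+1}(M)` (the formal adjoint of `dᵗ` being `d`). -/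
def IsDtMax (g : ProjMetric E) (η : ProjForm E (k + 1)) (ζ : ProjForm E k) : Prop :=
  IsL2 M d g η ∧ IsL2 M d g ζ ∧ AdjointEq M d g η ζ

variable (M d) in
/-- The `L²`-Stokes theorem holds for `k`-forms on the `d`-dimensional submanifold `M` with the
metric induced by `g`: `(d_max θ, η) = (θ, dᵗ_max η)` for all `θ ∈ dom(d_max)` of degree `k` and all
`η ∈ dom(dᵗ_max)` of degree `k + 1`. -/
def L2StokesHolds (g : ProjMetric E) (k : ℕ) : Prop :=
  ∀ (θ : ProjForm E k) (σ : ProjForm E (k + 1)) (η : ProjForm E (k + 1)) (ζ : ProjForm E k),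
    IsDMax M d g θ σ → IsDtMax M d g η ζ → l2Inner M d g σ η = l2Inner M d g θ ζ

variable (M d) in
/-- The `L²`-Stokes theorem holds for `k`-forms on `M` supported in `U`: the same identity, but only
for `θ` and `η` that vanish outside `U`. -/
def L2StokesHoldsIn (U : Set (ℙ ℝ E)) (g : ProjMetric E) (k : ℕ) : Prop :=
  ∀ (θ : ProjForm E k) (σ : ProjForm E (k + 1)) (η : ProjForm E (k + 1)) (ζ : ProjForm E k),
    SupportedIn M d U θ → SupportedIn M d U η →
    IsDMax M d g θ σ → IsDtMax M d g η ζ → l2Inner M d g σ η = l2Inner M d g θ ζ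

end Forms

/-! ### Projective hypersurfaces -/

section Hypersurface

variable {E : Type*} [NormedAddCommGroup E] [NormedSpace ℝ E]

/-- The projective zero locus of a homogeneous polynomial function `f`. -/
def zeroLocus (f : E → ℝ) : Set (ℙ ℝ E) :=
  {P | ∀ (v : E) (hv : v ≠ 0), Projectivization.mk ℝ v hv = P → f v = 0}

/-- The singular points of the hypersurface `f = 0`: those where all first partial derivatives of
`f` vanish. -/
def singLocus (f : E → ℝ) : Set (ℙ ℝ E) :=
  {P | P ∈ zeroLocus f ∧
    ∀ (v : E) (hv : v ≠ 0), Projectivization.mk ℝ v hv = P → fderiv ℝ f v = 0}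

/-- The regular part of the hypersurface `f = 0`. -/
def regularPart (f : E → ℝ) : Set (ℙ ℝ E) := zeroLocus f \ singLocus f

end Hypersurface

/-! ### The variety -/

/-- Homogeneous coordinates `(x, y, z)` on `ℝP^{n+m}`, with `x ∈ ℝⁿ`, `y ∈ ℝᵐ`, `z ∈ ℝ`; the norms of
`x` and `y` are Euclidean. -/
abbrev HomCoord (n m : ℕ) : Type :=
  EuclideanSpace ℝ (Fin n) × EuclideanSpace ℝ (Fin m) × ℝ

/-- The homogeneous polynomial `|x|^{2p} - |y|^{2q} z^{2(p-q)}`. -/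
def defPoly (n m p q : ℕ) (v : HomCoord n m) : ℝ :=
  ‖v.1‖ ^ (2 * p) - ‖v.2.1‖ ^ (2 * q) * v.2.2 ^ (2 * (p - q))

/-- The point `[0, 0, 1]`. -/
def basePoint (n m : ℕ) : ℙ ℝ (HomCoord n m) :=
  Projectivization.mk ℝ ((0, 0, 1) : HomCoord n m)
    (fun h => one_ne_zero (α := ℝ) (congrArg (fun v : HomCoord n m => v.2.2) h))

end L2Stokes

end

noncomputable section

namespace L2Stokes

open scoped Matrix

/-! ### Alternating forms in coordinates -/

section Coordinates

variable {d k : ℕ}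

/-! On `V`, all first derivatives vanish exactly where `x = 0`, and if `z = 0` the equation forces
`x = 0`. So the whole of `M` lies in the affine chart `z = 1`, where it is the horn `|y| = |x|^δ`,
`x ≠ 0`, with `δ = p/q`. Put `k = n - 1` and `l = m - 1`. The horn is parametrized by `(x, t) ↦ (x,
|x|^δ σ(t))`, with `σ` parametrizing the unit sphere of the `y`-space. At distance `r = |x|` the two
link spheres have dimensions `k` and `l` and radii `r` and `r^δ`. The hypothesis on the dimensions
says `δ l = k`, so their volumes shrink at the same rate and the density with respect to `dx dt` is
comparable to `rad(x) |x|^k`, where `rad = 1 + δ |x|^(δ-1)` is the distortion in the radial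
direction.

The counterexample pairs two forms. The form `θ` is `|x|^(-(k+1)) ι_x(dx₀ ∧ ⋯ ∧ dx_k)`, the
pull-back of the volume form of the unit sphere in the `x`-space, cut off away from the tip; it is
closed near the tip. The form `η` is, up to sign, the Hodge star of `w dt₁ ∧ ⋯ ∧ dt_l`, with a
weight `w` that is a cutoff in `x` times a bump in `t`. It is realized as the metric dual of `(w /
density) ∂/∂x₀ ∧ ⋯ ∧ ∂/∂x_k`, so that `(β, η) = ∫ w β(∂/∂x₀, …, ∂/∂x_k) dx dt` and the metric
disappears from the pairing. Its weak codifferential `ζ` involves only the `x`-derivatives of `w`,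
which vanish near the tip.

Both square norms, times the density, are `O(rad(x) |x|^(-k))`. In polar coordinates this is `rad
dr`, integrable at `0` for every `δ > 0` (`integrableOn_rad`, `isL2_X_form`, `isL2_coForm`).
Compactly supported forms on `M` vanish near the tip, so testing against them produces no boundary
term, and `θ`, `η` belong to the maximal domains (`isDMax_X_form`, `adjointEq_coForm`). For `θ`
against `η` the boundary term survives: `dθ = 0` wherever `w` is nonzero, so `(dθ, η) = 0`, whereas
`(θ, ζ) = -∫ |x|^(-(k+1)) (x · ∇w)` is positive because the cutoff decreases radially
(`integral_boundaryTerm_pos`). Shrinking the cutoffs puts the supports into any neighbourhood of the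
tip.

The argument uses only `δ > 0` and `δ l = k`. Interchanging `x` and `y` replaces `δ` by `q/p` and
gives the degree `m - 1` (`hornX`, `hornY`). Much of the work consists in showing that the measure
and the pointwise inner product, defined through all charts at once, can be computed in one chart,
and that an arbitrary metric `g` is comparable near the tip to the affine Euclidean one. -/

/-- The action of a matrix on the `k`-th tensor power of `ℝ^d`, in coordinates. -/
def tensorAct (A : Matrix (Fin d) (Fin d) ℝ) (f : (Fin k → Fin d) → ℝ) (I : Fin k → Fin d) : ℝ :=
  ∑ J : Fin k → Fin d, (∏ a, A (I a) (J a)) * f J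

theorem sum_prod_apply {ι κ : Type*} [Fintype ι] [DecidableEq ι] [Fintype κ]
    (f : ι → κ → ℝ) : ∑ I : ι → κ, ∏ a, f a (I a) = ∏ a, ∑ i, f a i := by
  rw [Finset.prod_univ_sum, Fintype.piFinset_univ]

theorem tensorAct_mul (A B : Matrix (Fin d) (Fin d) ℝ) (f : (Fin k → Fin d) → ℝ) :
    tensorAct (A * B) f = tensorAct A (tensorAct B f) := by
  funext I
  simp only [tensorAct, Finset.mul_sum]
  rw [Finset.sum_comm]
  refine Finset.sum_congr rfl fun J _ => ?_
  simp only [← mul_assoc, ← Finset.sum_mul, ← Finset.prod_mul_distrib, Matrix.mul_apply]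
  rw [sum_prod_apply (fun a i => A (I a) i * B i (J a))]

theorem tensorAct_one (f : (Fin k → Fin d) → ℝ) :
    tensorAct (1 : Matrix (Fin d) (Fin d) ℝ) f = f := by
  funext I
  rw [tensorAct, Finset.sum_eq_single I]
  · simp
  · intro J _ hJ
    obtain ⟨a, ha⟩ : ∃ a, J a ≠ I a := by
      by_contra! h
      exact hJ (funext h)
    have h0 : (1 : Matrix (Fin d) (Fin d) ℝ) (I a) (J a) = 0 := Matrix.one_apply_ne ha.symm
    rw [Finset.prod_eq_zero (Finset.mem_univ a) h0, zero_mul]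
  · simp

theorem sum_tensorAct_mul (A : Matrix (Fin d) (Fin d) ℝ) (f h : (Fin k → Fin d) → ℝ) :
    ∑ I, tensorAct A f I * h I = ∑ I, f I * tensorAct Aᵀ h I := by
  simp only [tensorAct, Finset.mul_sum, Finset.sum_mul]
  rw [Finset.sum_comm]
  refine Finset.sum_congr rfl fun I _ => Finset.sum_congr rfl fun J _ => ?_
  simp only [Matrix.transpose_apply]
  ring

/-- The components of an alternating form. -/
def comps (α : EuclideanSpace ℝ (Fin d) [⋀^Fin k]→L[ℝ] ℝ) (I : Fin k → Fin d) : ℝ :=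
  α (fun a => EuclideanSpace.single (I a) (1 : ℝ))

/-- Writes the inner product as a contraction with the tensor power of `G⁻¹`, so that invariance and
duality become functoriality and transposition of `tensorAct`. -/
theorem formInner_eq (G : Matrix (Fin d) (Fin d) ℝ)
    (α β : EuclideanSpace ℝ (Fin d) [⋀^Fin k]→L[ℝ] ℝ) :
    formInner G α β = ((k.factorial : ℝ))⁻¹ * ∑ I, comps α I * tensorAct G⁻¹ (comps β) I := by
  simp only [formInner, comps, tensorAct, Finset.mul_sum]
  refine Finset.sum_congr rfl fun I _ => Finset.sum_congr rfl fun J _ => ?_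
  ring

theorem eq_sum_single (w : EuclideanSpace ℝ (Fin d)) :
    w = ∑ i, w i • EuclideanSpace.single i (1 : ℝ) := by
  ext j
  simp [Finset.sum_apply, Pi.single_apply]

theorem alternating_apply_eq_sum (α : EuclideanSpace ℝ (Fin d) [⋀^Fin k]→L[ℝ] ℝ)
    (w : Fin k → EuclideanSpace ℝ (Fin d)) :
    α w = ∑ I : Fin k → Fin d, (∏ a, w a (I a)) * comps α I := by
  have h : w = fun a => ∑ i, w a i • EuclideanSpace.single i (1 : ℝ) :=
    funext fun a => eq_sum_single (w a)
  conv_lhs => rw [h]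
  rw [ContinuousAlternatingMap.map_sum]
  refine Finset.sum_congr rfl fun I _ => ?_
  exact α.toMultilinearMap.map_smul_univ (fun a => w a (I a))
    (fun a => EuclideanSpace.single (I a) (1 : ℝ))

/-- The matrix of a linear endomorphism of `ℝ^d`. -/
def matOf (A : EuclideanSpace ℝ (Fin d) →L[ℝ] EuclideanSpace ℝ (Fin d)) :
    Matrix (Fin d) (Fin d) ℝ :=
  Matrix.of fun i j => A (EuclideanSpace.single j 1) i

theorem comps_comp (α : EuclideanSpace ℝ (Fin d) [⋀^Fin k]→L[ℝ] ℝ)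
    (A : EuclideanSpace ℝ (Fin d) →L[ℝ] EuclideanSpace ℝ (Fin d)) :
    comps (α.compContinuousLinearMap A) = tensorAct (matOf A)ᵀ (comps α) := by
  funext I
  rw [comps, ContinuousAlternatingMap.compContinuousLinearMap_apply, alternating_apply_eq_sum]
  rfl

theorem det_matOf (A : EuclideanSpace ℝ (Fin d) →L[ℝ] EuclideanSpace ℝ (Fin d)) :
    (matOf A).det = A.det := by
  have h : matOf A = LinearMap.toMatrix (EuclideanSpace.basisFun (Fin d) ℝ).toBasis
      (EuclideanSpace.basisFun (Fin d) ℝ).toBasis A.toLinearMap := by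
    ext i j
    simp [matOf, LinearMap.toMatrix_apply]
  rw [h, LinearMap.det_toMatrix]

/-- The inner product of forms does not depend on the linear coordinates. -/
theorem formInner_comp (G : Matrix (Fin d) (Fin d) ℝ)
    (A : EuclideanSpace ℝ (Fin d) →L[ℝ] EuclideanSpace ℝ (Fin d)) (hA : A.det ≠ 0)
    (α β : EuclideanSpace ℝ (Fin d) [⋀^Fin k]→L[ℝ] ℝ) :
    formInner ((matOf A)ᵀ * G * matOf A) (α.compContinuousLinearMap A)
      (β.compContinuousLinearMap A) = formInner G α β := by
  have hu : IsUnit (matOf A).det := by rw [det_matOf]; exact hA.isUnit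
  have hu' : IsUnit ((matOf A)ᵀ).det := by rwa [Matrix.det_transpose]
  rw [formInner_eq, formInner_eq, comps_comp, comps_comp, sum_tensorAct_mul, Matrix.transpose_transpose]
  simp only [← tensorAct_mul, Matrix.mul_inv_rev]
  rw [show matOf A * ((matOf A)⁻¹ * (G⁻¹ * (matOf A)ᵀ⁻¹) * (matOf A)ᵀ) =
    (matOf A * (matOf A)⁻¹) * G⁻¹ * ((matOf A)ᵀ⁻¹ * (matOf A)ᵀ) by simp only [Matrix.mul_assoc],
    Matrix.mul_nonsing_inv _ hu, Matrix.nonsing_inv_mul _ hu', Matrix.one_mul, Matrix.mul_one]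

/-! ### Metric duals of multivectors, and orthonormal frames. -/

/-- The determinant as a continuous alternating form on `ℝ^k`. -/
def detForm (k : ℕ) : EuclideanSpace ℝ (Fin k) [⋀^Fin k]→L[ℝ] ℝ where
  toAlternatingMap := Matrix.detRowAlternating.compLinearMap
    (WithLp.linearEquiv 2 ℝ (Fin k → ℝ)).toLinearMap
  cont := by
    change Continuous fun v : Fin k → EuclideanSpace ℝ (Fin k) =>
      Matrix.det (Matrix.of fun i j => v i j)
    exact Continuous.matrix_det (by fun_prop)

theorem detForm_apply (v : Fin k → EuclideanSpace ℝ (Fin k)) :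
    detForm k v = Matrix.det (Matrix.of fun i j => v i j) := rfl

/-- The linear map `w ↦ (⟨v₁, w⟩, …, ⟨v_j, w⟩)`, the scalar products being those with Gram
matrix `G`. -/
def pairingMap (G : Matrix (Fin d) (Fin d) ℝ) (v : Fin k → EuclideanSpace ℝ (Fin d)) :
    EuclideanSpace ℝ (Fin d) →L[ℝ] EuclideanSpace ℝ (Fin k) :=
  ∑ j : Fin d, ∑ a : Fin k, ((G *ᵥ v a) j) •
    (EuclideanSpace.proj j : EuclideanSpace ℝ (Fin d) →L[ℝ] ℝ).smulRight
      (EuclideanSpace.single a (1 : ℝ))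

theorem pairingMap_apply (G : Matrix (Fin d) (Fin d) ℝ) (v : Fin k → EuclideanSpace ℝ (Fin d))
    (w : EuclideanSpace ℝ (Fin d)) (a : Fin k) :
    pairingMap G v w a = w.ofLp ⬝ᵥ (G *ᵥ v a) := by
  simp only [pairingMap, sum_apply, smul_apply,
    ContinuousLinearMap.smulRight_apply, WithLp.ofLp_sum, Finset.sum_apply, WithLp.ofLp_smul, Pi.smul_apply,
    PiLp.single_apply, smul_eq_mul, dotProduct, PiLp.proj_apply]
  refine Finset.sum_congr rfl fun j _ => ?_
  simp [mul_comm]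

/-- The `k`-form metrically dual to `v₁ ∧ ⋯ ∧ v_k`. -/
def lowerForm (G : Matrix (Fin d) (Fin d) ℝ) (v : Fin k → EuclideanSpace ℝ (Fin d)) :
    EuclideanSpace ℝ (Fin d) [⋀^Fin k]→L[ℝ] ℝ :=
  (detForm k).compContinuousLinearMap (pairingMap G v)

theorem lowerForm_apply (G : Matrix (Fin d) (Fin d) ℝ) (v w : Fin k → EuclideanSpace ℝ (Fin d)) :
    lowerForm G v w = Matrix.det (Matrix.of fun a b => (w a).ofLp ⬝ᵥ (G *ᵥ v b)) := by
  rw [lowerForm, ContinuousAlternatingMap.compContinuousLinearMap_apply, detForm_apply]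
  congr 1
  ext a b
  exact pairingMap_apply _ _ _ _

theorem comps_lowerForm (G : Matrix (Fin d) (Fin d) ℝ) (v : Fin k → EuclideanSpace ℝ (Fin d)) :
    comps (lowerForm G v) = tensorAct G (fun J => ∑ σ : Equiv.Perm (Fin k),
      (Equiv.Perm.sign σ : ℝ) * ∏ a, v (σ a) (J a)) := by
  funext J
  rw [comps, lowerForm_apply, ← Matrix.det_transpose, Matrix.det_apply']
  simp only [tensorAct, Finset.mul_sum]
  rw [Finset.sum_comm]
  refine Finset.sum_congr rfl fun σ _ => ?_
  simp only [mul_left_comm _ (Equiv.Perm.sign σ : ℝ), ← Finset.mul_sum, ← Finset.prod_mul_distrib]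
  congr 1
  rw [sum_prod_apply (fun a i => G (J a) i * v (σ a) i)]
  refine Finset.prod_congr rfl fun a _ => ?_
  simp [Matrix.transpose_apply, Matrix.mulVec, dotProduct]

/-- Lowering indices with `G` cancels the `G⁻¹` of the inner product. What remains is `β` evaluated
on the antisymmetrization of `v`; its `k!` terms all equal `β v`, which the normalization `1/k!`
compensates. This identity removes the metric from all pairings with the dual form. -/
theorem formInner_lowerForm (G : Matrix (Fin d) (Fin d) ℝ) (hG : G.det ≠ 0)
    (β : EuclideanSpace ℝ (Fin d) [⋀^Fin k]→L[ℝ] ℝ) (v : Fin k → EuclideanSpace ℝ (Fin d)) :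
    formInner G β (lowerForm G v) = β v := by
  rw [formInner_eq, comps_lowerForm, ← tensorAct_mul, Matrix.nonsing_inv_mul _ hG.isUnit,
    tensorAct_one]
  have h : ∀ σ : Equiv.Perm (Fin k), (Equiv.Perm.sign σ : ℝ) *
      ∑ I, (∏ a, v (σ a) (I a)) * comps β I = β v := by
    intro σ
    have h0 : ∑ I, (∏ a, v (σ a) (I a)) * comps β I = β (v ∘ σ) :=
      (alternating_apply_eq_sum β (v ∘ σ)).symm
    rw [h0]
    have := β.toAlternatingMap.map_perm v σ
    change β (v ∘ σ) = _ at this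
    rw [this, Units.smul_def, zsmul_eq_mul, ← mul_assoc, ← Int.cast_mul,
      ← Units.val_mul, Int.units_mul_self]
    simp
  have h2 : ∑ I, comps β I * (∑ σ : Equiv.Perm (Fin k),
      (Equiv.Perm.sign σ : ℝ) * ∏ a, v (σ a) (I a)) = k.factorial * β v := by
    simp only [Finset.mul_sum]
    rw [Finset.sum_comm]
    rw [Finset.sum_congr rfl (g := fun _ => β v)]
    · simp [Fintype.card_perm]
    · intro σ _
      rw [← h σ, Finset.mul_sum]
      refine Finset.sum_congr rfl fun I _ => ?_
      ring
  rw [h2, inv_mul_cancel_left₀ (by positivity)]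

theorem formInner_smul_right (G : Matrix (Fin d) (Fin d) ℝ) (c : ℝ)
    (α β : EuclideanSpace ℝ (Fin d) [⋀^Fin k]→L[ℝ] ℝ) :
    formInner G α (c • β) = c * formInner G α β := by
  simp only [formInner, Finset.mul_sum, ContinuousAlternatingMap.smul_apply, smul_eq_mul]
  refine Finset.sum_congr rfl fun I _ => Finset.sum_congr rfl fun J _ => ?_
  ring

theorem formInner_sum_right {ι : Type*} (s : Finset ι) (G : Matrix (Fin d) (Fin d) ℝ)
    (α : EuclideanSpace ℝ (Fin d) [⋀^Fin k]→L[ℝ] ℝ)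
    (β : ι → EuclideanSpace ℝ (Fin d) [⋀^Fin k]→L[ℝ] ℝ) :
    formInner G α (∑ i ∈ s, β i) = ∑ i ∈ s, formInner G α (β i) := by
  classical
  induction s using Finset.induction_on with
  | empty => simp [formInner]
  | insert i s hi ih =>
    rw [Finset.sum_insert hi, Finset.sum_insert hi, ← ih]
    simp only [formInner, ← mul_add, ← Finset.sum_add_distrib, ContinuousAlternatingMap.add_apply]

@[simp]
theorem formInner_zero_right (G : Matrix (Fin d) (Fin d) ℝ)
    (α : EuclideanSpace ℝ (Fin d) [⋀^Fin k]→L[ℝ] ℝ) : formInner G α 0 = 0 := by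
  simp [formInner]

@[simp]
theorem formInner_zero_left (G : Matrix (Fin d) (Fin d) ℝ)
    (α : EuclideanSpace ℝ (Fin d) [⋀^Fin k]→L[ℝ] ℝ) : formInner G 0 α = 0 := by
  simp [formInner]

theorem exists_orthonormal_frame (G : Matrix (Fin d) (Fin d) ℝ) (hG : G.PosDef) :
    ∃ S : Matrix (Fin d) (Fin d) ℝ, G⁻¹ = S * Sᵀ ∧ Sᵀ * G * S = 1 := by
  set U : Matrix (Fin d) (Fin d) ℝ := (hG.1.eigenvectorUnitary : Matrix (Fin d) (Fin d) ℝ)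
  have hU : Uᵀ * U = 1 := by
    have := (Matrix.mem_unitaryGroup_iff').1 hG.1.eigenvectorUnitary.2
    simpa [Matrix.star_eq_conjTranspose, Matrix.conjTranspose_eq_transpose_of_trivial] using this
  have hD : Uᵀ * G * U = Matrix.diagonal hG.1.eigenvalues := by
    have := Matrix.IsHermitian.conjStarAlgAut_star_eigenvectorUnitary hG.1
    rw [Unitary.conjStarAlgAut_star_apply] at this
    simpa [Matrix.star_eq_conjTranspose, Matrix.conjTranspose_eq_transpose_of_trivial, U,
      Function.comp_def] using this
  -- Rescaling the orthonormal eigenvectors by the inverse square roots of the eigenvalues makes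
  -- them orthonormal for `G`.
  set D : Matrix (Fin d) (Fin d) ℝ := Matrix.diagonal fun i => (√(hG.1.eigenvalues i))⁻¹
  have hS : (U * D)ᵀ * G * (U * D) = 1 := by
    rw [Matrix.transpose_mul, show Dᵀ * Uᵀ * G * (U * D) = Dᵀ * (Uᵀ * G * U) * D by
      simp only [Matrix.mul_assoc], hD, Matrix.diagonal_transpose, Matrix.diagonal_mul_diagonal,
      Matrix.diagonal_mul_diagonal, ← Matrix.diagonal_one]
    congr 1
    funext i
    have hp := hG.eigenvalues_pos i
    have h2 : √(hG.1.eigenvalues i) ≠ 0 := (Real.sqrt_pos.2 hp).ne'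
    have h3 := Real.mul_self_sqrt hp.le
    field_simp
    nlinarith
  refine ⟨U * D, ?_, hS⟩
  have h1 : ((U * D)ᵀ * G) * (U * D) = 1 := hS
  have h2 : (U * D) * ((U * D)ᵀ * G) = 1 := mul_eq_one_comm.1 h1
  rw [← Matrix.mul_assoc] at h2
  exact Matrix.inv_eq_left_inv h2

/-- The square norm of a form is nonnegative, and is controlled by the values of the form on unit
vectors. -/
theorem formInner_self_bounds (G : Matrix (Fin d) (Fin d) ℝ) (hG : G.PosDef)
    (α : EuclideanSpace ℝ (Fin d) [⋀^Fin k]→L[ℝ] ℝ) :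
    0 ≤ formInner G α α ∧ ∀ C : ℝ, (∀ w : Fin k → EuclideanSpace ℝ (Fin d),
      (∀ a, (w a).ofLp ⬝ᵥ (G *ᵥ w a) = 1) → |α w| ≤ C) →
      formInner G α α ≤ d ^ k * C ^ 2 := by
  obtain ⟨S, h1, h2⟩ := exists_orthonormal_frame G hG
  -- In an orthonormal frame the square norm is `1/k!` times the sum of the squares of all
  -- components, which gives both the sign and the bound.
  have key : formInner G α α = ((k.factorial : ℝ))⁻¹ * ∑ I, (tensorAct Sᵀ (comps α) I) ^ 2 := by
    rw [formInner_eq, h1, tensorAct_mul]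
    congr 1
    have := sum_tensorAct_mul Sᵀ (comps α) (tensorAct Sᵀ (comps α))
    rw [Matrix.transpose_transpose] at this
    rw [← this]
    simp only [sq]
  refine ⟨by rw [key]; positivity, fun C hC => ?_⟩
  have hb : ∀ I, (tensorAct Sᵀ (comps α) I) ^ 2 ≤ C ^ 2 := by
    intro I
    have h3 := hC (fun a => WithLp.toLp 2 fun i => S i (I a)) (fun a => by
      have := congrFun (congrFun h2 (I a)) (I a)
      rw [Matrix.one_apply_eq, Matrix.mul_assoc, Matrix.mul_apply] at this
      rw [← this]
      rfl)
    rw [alternating_apply_eq_sum] at h3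
    exact sq_le_sq' (abs_le.1 h3).1 (abs_le.1 h3).2
  rw [key]
  have hf : ((k.factorial : ℝ))⁻¹ ≤ 1 := by
    apply inv_le_one_of_one_le₀
    exact_mod_cast Nat.one_le_iff_ne_zero.2 (Nat.factorial_ne_zero k)
  calc _ ≤ 1 * ∑ I : Fin k → Fin d, (tensorAct Sᵀ (comps α) I) ^ 2 := by
        apply mul_le_mul_of_nonneg_right hf
        positivity
    _ ≤ ∑ I : Fin k → Fin d, C ^ 2 := by
        rw [one_mul]
        exact Finset.sum_le_sum fun I _ => hb I
    _ = d ^ k * C ^ 2 := by simp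

/-- Bounds for a Gram determinant. -/
theorem det_bounds {H : Matrix (Fin d) (Fin d) ℝ} (hH : H.IsHermitian) {c C : ℝ} (hc : 0 ≤ c)
    (B : EuclideanSpace ℝ (Fin d) →L[ℝ] EuclideanSpace ℝ (Fin d)) (hB : B.det ≠ 0)
    (h1 : ∀ w : EuclideanSpace ℝ (Fin d), c * ‖B w‖ ^ 2 ≤ w.ofLp ⬝ᵥ (H *ᵥ w))
    (h2 : ∀ w : EuclideanSpace ℝ (Fin d), w.ofLp ⬝ᵥ (H *ᵥ w) ≤ C * ‖B w‖ ^ 2) :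
    c ^ d * B.det ^ 2 ≤ H.det ∧ H.det ≤ C ^ d * B.det ^ 2 := by
  set b := matOf B
  have hb : b.det = B.det := det_matOf B
  have hu : IsUnit b.det := by rw [hb]; exact hB.isUnit
  have hbv : ∀ w : EuclideanSpace ℝ (Fin d), (B w).ofLp = b *ᵥ w := by
    intro w
    conv_lhs => rw [eq_sum_single w]
    funext i
    simp [b, matOf, Matrix.mulVec, dotProduct, mul_comm]
  -- The Gram matrix in the coordinates `B w`: the hypotheses place all its eigenvalues between `c`
  -- and `C`, and its determinant is their product.
  set K := (b⁻¹)ᵀ * H * b⁻¹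
  have hK : K.IsHermitian := by
    have := Matrix.isHermitian_conjTranspose_mul_mul (b⁻¹) hH
    simpa [K, Matrix.conjTranspose_eq_transpose_of_trivial] using this
  have hdet : H.det = K.det * B.det ^ 2 := by
    simp only [K, Matrix.det_mul, Matrix.det_transpose, Matrix.det_nonsing_inv,
      Ring.inverse_eq_inv', hb]
    field_simp
  have hev : ∀ i, c ≤ hK.eigenvalues i ∧ hK.eigenvalues i ≤ C := by
    intro i
    have hi := hK.eigenvalues_eq i
    set v := hK.eigenvectorBasis i
    set w : EuclideanSpace ℝ (Fin d) := WithLp.toLp 2 (b⁻¹ *ᵥ v)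
    have hw : B w = v := by
      ext j
      rw [hbv]
      simp [w, Matrix.mulVec_mulVec, Matrix.mul_nonsing_inv _ hu]
    have hn : ‖B w‖ = 1 := by rw [hw]; exact hK.eigenvectorBasis.norm_eq_one i
    have hq : hK.eigenvalues i = w.ofLp ⬝ᵥ (H *ᵥ w) := by
      rw [hi]
      simp only [RCLike.re_to_real, star_trivial, K, w]
      rw [← Matrix.mulVec_mulVec, ← Matrix.mulVec_mulVec, Matrix.dotProduct_mulVec,
        Matrix.vecMul_transpose]
    have g1 := h1 w
    have g2 := h2 w
    rw [hn, ← hq] at g1 g2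
    constructor <;> linarith
  have hKd : K.det = ∏ i, hK.eigenvalues i := by simpa using hK.det_eq_prod_eigenvalues
  rw [hdet, hKd]
  constructor
  · refine mul_le_mul_of_nonneg_right ?_ (sq_nonneg _)
    calc c ^ d = ∏ _i : Fin d, c := by simp
      _ ≤ _ := Finset.prod_le_prod (fun _ _ => hc) fun i _ => (hev i).1
  · refine mul_le_mul_of_nonneg_right ?_ (sq_nonneg _)
    calc _ ≤ ∏ _i : Fin d, C :=
          Finset.prod_le_prod (fun i _ => hc.trans (hev i).1) fun i _ => (hev i).2
      _ = _ := by simp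

end Coordinates

/-! ### Coordinate changes -/

instance {E : Type*} [NormedAddCommGroup E] [NormedSpace ℝ E] : BorelSpace (ℙ ℝ E) := ⟨rfl⟩

/-! ### Differentiability of transition maps between lifts. -/

section Transition

variable {E : Type*} [NormedAddCommGroup E] [NormedSpace ℝ E] {d : ℕ}

/-- The product rule for `φ = ℓ(φ) • (φ / ℓ(φ))`. It isolates the radial part of the derivative,
which is invisible in projective space. -/
theorem fderiv_eq_normalized {φ : EuclideanSpace ℝ (Fin d) → E} {u : EuclideanSpace ℝ (Fin d)}
    (hφ : DifferentiableAt ℝ φ u) (ℓ : E →L[ℝ] ℝ) (hℓ : ℓ (φ u) ≠ 0)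
    (a : EuclideanSpace ℝ (Fin d)) :
    fderiv ℝ φ u a = ℓ (φ u) • fderiv ℝ (fun u => (ℓ (φ u))⁻¹ • φ u) u a +
      ℓ (fderiv ℝ φ u a) • (ℓ (φ u))⁻¹ • φ u := by
  have hd : DifferentiableAt ℝ (fun u => ℓ (φ u)) u := ℓ.differentiableAt.comp u hφ
  have hΨ : DifferentiableAt ℝ (fun u => (ℓ (φ u))⁻¹ • φ u) u := (hd.inv hℓ).smul hφ
  have he : φ =ᶠ[𝓝 u] fun u => ℓ (φ u) • (ℓ (φ u))⁻¹ • φ u := by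
    filter_upwards [hd.continuousAt.eventually_ne hℓ] with w hw
    rw [smul_inv_smul₀ hw]
  have h1 : fderiv ℝ (fun u => ℓ (φ u)) u a = ℓ (fderiv ℝ φ u a) := by
    have h := (ℓ.hasFDerivAt.comp u hφ.hasFDerivAt).fderiv
    exact congrArg (fun L : EuclideanSpace ℝ (Fin d) →L[ℝ] ℝ => L a) h
  have h2 := fderiv_fun_smul hd hΨ
  conv_lhs => rw [he.fderiv_eq, h2]
  simp only [add_apply, smul_apply, ContinuousLinearMap.smulRight_apply, h1]

/-- A continuous map between parameter domains which is compatible with two immersions into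
projective space is differentiable, and its derivative is the expected one. -/
theorem hasFDerivAt_transition [FiniteDimensional ℝ E]
    {φ₁ φ₂ : EuclideanSpace ℝ (Fin d) → E}
    {T : EuclideanSpace ℝ (Fin d) → EuclideanSpace ℝ (Fin d)} {u : EuclideanSpace ℝ (Fin d)}
    (h1 : ContDiffAt ℝ ∞ φ₁ u) (h2 : ContDiffAt ℝ ∞ φ₂ (T u))
    (hne : φ₂ (T u) ≠ 0)
    (him : ∀ a, fderiv ℝ φ₁ u a ∈ Submodule.span ℝ {φ₁ u} → a = 0)
    (him2 : ∀ a, fderiv ℝ φ₂ (T u) a ∈ Submodule.span ℝ {φ₂ (T u)} → a = 0)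
    (hT : ContinuousAt T u) (hc : ∀ᶠ w in 𝓝 u, ∃ c : ℝ, c ≠ 0 ∧ φ₁ w = c • φ₂ (T w)) :
    ∃ A : EuclideanSpace ℝ (Fin d) →L[ℝ] EuclideanSpace ℝ (Fin d), HasFDerivAt T A u ∧
      A.det ≠ 0 ∧ ∃ c : ℝ, c ≠ 0 ∧ φ₁ u = c • φ₂ (T u) ∧
        ∀ a, ∃ s : ℝ, fderiv ℝ φ₁ u a = c • fderiv ℝ φ₂ (T u) (A a) + s • c • φ₂ (T u) := by
  obtain ⟨c, hc0, hcu⟩ := hc.self_of_nhds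
  obtain ⟨ℓ, hℓ⟩ : ∃ ℓ : E →L[ℝ] ℝ, ℓ (φ₂ (T u)) ≠ 0 := SeparatingDual.exists_ne_zero hne
  have hℓ1 : ℓ (φ₁ u) ≠ 0 := by
    rw [hcu, map_smul, smul_eq_mul]
    exact mul_ne_zero hc0 hℓ
  -- Dividing by `ℓ` moves both lifts into the affine hyperplane `ℓ = 1`. The unknown scalar, about
  -- which no regularity is known, disappears and `Φ₁ = Φ₂ ∘ T` near `u`.
  set Φ₁ : EuclideanSpace ℝ (Fin d) → E := fun u => (ℓ (φ₁ u))⁻¹ • φ₁ u with hΦ₁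
  set Φ₂ : EuclideanSpace ℝ (Fin d) → E := fun u => (ℓ (φ₂ u))⁻¹ • φ₂ u with hΦ₂
  have hs1 : ContDiffAt ℝ ∞ Φ₁ u := ((ℓ.contDiff.contDiffAt.comp u h1).inv hℓ1).smul h1
  have hs2 : ContDiffAt ℝ ∞ Φ₂ (T u) := ((ℓ.contDiff.contDiffAt.comp (T u) h2).inv hℓ).smul h2
  have hΦ : Φ₁ =ᶠ[𝓝 u] Φ₂ ∘ T := by
    filter_upwards [hc] with w hw
    obtain ⟨c', hc', hw⟩ := hw
    simp only [hΦ₁, hΦ₂, Function.comp, hw, map_smul, smul_eq_mul, mul_inv, smul_smul]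
    congr 1
    field_simp
  have hker : ∀ a, fderiv ℝ Φ₂ (T u) a = 0 → a = 0 := by
    intro a ha
    apply him2
    rw [fderiv_eq_normalized (h2.differentiableAt (by simp)) ℓ hℓ, ha, smul_zero, zero_add, smul_smul]
    exact Submodule.smul_mem _ _ (Submodule.mem_span_singleton_self _)
  -- A linear left inverse of the injective derivative of `Φ₂` makes `Λ ∘ Φ₂` a local
  -- diffeomorphism, so that `T = (Λ ∘ Φ₂)⁻¹ ∘ Λ ∘ Φ₁`. Continuity of `T` ensures that the correct
  -- local inverse is used.
  obtain ⟨Λ, hΛ⟩ := LinearMap.exists_leftInverse_of_injective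
    (fderiv ℝ Φ₂ (T u)).toLinearMap (LinearMap.ker_eq_bot'.2 hker)
  set Λ' : E →L[ℝ] EuclideanSpace ℝ (Fin d) := LinearMap.toContinuousLinearMap Λ
  have hΛ' : Λ' ∘L fderiv ℝ Φ₂ (T u) =
      ((ContinuousLinearEquiv.refl ℝ (EuclideanSpace ℝ (Fin d)) :
        EuclideanSpace ℝ (Fin d) ≃L[ℝ] EuclideanSpace ℝ (Fin d)) : _ →L[ℝ] _) := by
    ext1 a
    exact LinearMap.congr_fun hΛ a
  have hF : HasStrictFDerivAt (fun w => Λ' (Φ₂ w))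
      ((ContinuousLinearEquiv.refl ℝ (EuclideanSpace ℝ (Fin d)) :
        EuclideanSpace ℝ (Fin d) ≃L[ℝ] EuclideanSpace ℝ (Fin d)) : _ →L[ℝ] _) (T u) := by
    rw [← hΛ']
    exact Λ'.hasStrictFDerivAt.comp (T u) (hs2.hasStrictFDerivAt (by simp))
  have hinv := hF.eventually_left_inverse
  have hli := hF.to_localInverse.hasFDerivAt
  set R := hF.localInverse
  have hTe : T =ᶠ[𝓝 u] fun w => R (Λ' (Φ₁ w)) := by
    filter_upwards [hT.eventually hinv, hΦ] with w hw hw2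
    rw [hw2]
    exact hw.symm
  have hΦu : Φ₁ u = Φ₂ (T u) := hΦ.self_of_nhds
  have hd1 : HasFDerivAt Φ₁ (fderiv ℝ Φ₁ u) u := (hs1.differentiableAt (by simp)).hasFDerivAt
  have hd2 : HasFDerivAt Φ₂ (fderiv ℝ Φ₂ (T u)) (T u) := (hs2.differentiableAt (by simp)).hasFDerivAt
  have hTd : DifferentiableAt ℝ T u := by
    refine DifferentiableAt.congr_of_eventuallyEq ?_ hTe
    have h4 : DifferentiableAt ℝ R (Λ' (Φ₁ u)) := by
      rw [hΦu]
      exact hli.differentiableAt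
    exact h4.comp u (Λ'.differentiableAt.comp u hd1.differentiableAt)
  set A := fderiv ℝ T u
  have hA : HasFDerivAt T A u := hTd.hasFDerivAt
  have hAΦ : fderiv ℝ Φ₁ u = (fderiv ℝ Φ₂ (T u)) ∘L A :=
    (HasFDerivAt.congr_of_eventuallyEq (hd2.comp u hA) hΦ).fderiv
  have hform : ∀ a, ∃ s : ℝ,
      fderiv ℝ φ₁ u a = c • fderiv ℝ φ₂ (T u) (A a) + s • c • φ₂ (T u) := by
    intro a
    have e1 := fderiv_eq_normalized (h1.differentiableAt (by simp)) ℓ hℓ1 a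
    have e2 := fderiv_eq_normalized (h2.differentiableAt (by simp)) ℓ hℓ (A a)
    have e3 : fderiv ℝ Φ₁ u a = fderiv ℝ Φ₂ (T u) (A a) := by rw [hAΦ]; rfl
    refine ⟨ℓ (fderiv ℝ φ₁ u a) * (ℓ (φ₁ u))⁻¹ -
      ℓ (fderiv ℝ φ₂ (T u) (A a)) * (ℓ (φ₂ (T u)))⁻¹, ?_⟩
    have e4 : ℓ (φ₁ u) = c * ℓ (φ₂ (T u)) := by rw [hcu, map_smul, smul_eq_mul]
    change _ = ℓ (φ₁ u) • fderiv ℝ Φ₁ u a + _ at e1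
    change _ = ℓ (φ₂ (T u)) • fderiv ℝ Φ₂ (T u) (A a) + _ at e2
    rw [e3] at e1
    generalize ℓ (fderiv ℝ φ₁ u a) = x at *
    generalize ℓ (fderiv ℝ φ₂ (T u) (A a)) = y at *
    rw [e1, e2, e4, hcu]
    generalize (ℓ (φ₂ (T u)))⁻¹ = i₂
    generalize (c * ℓ (φ₂ (T u)))⁻¹ = i₁
    module
  refine ⟨A, hA, ?_, c, hc0, hcu, hform⟩
  -- A vector in the kernel of `A` would be sent by the derivative of `φ₁` into the line of `φ₁ u`,
  -- against the immersion property.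
  intro hdet
  have hlt := LinearMap.bot_lt_ker_of_det_eq_zero (f := A.toLinearMap) hdet
  obtain ⟨a, ha, ha0⟩ := Submodule.exists_mem_ne_zero_of_ne_bot hlt.ne'
  apply ha0
  apply him
  obtain ⟨s, hs⟩ := hform a
  rw [hs, show A a = 0 from ha, map_zero, smul_zero, zero_add, ← hcu]
  exact Submodule.smul_mem _ _ (Submodule.mem_span_singleton_self _)

end Transition

/-! ### Metric, forms and volume in coordinate patches. -/

section Charts

variable {E : Type*} [NormedAddCommGroup E] [NormedSpace ℝ E] {M : Set (ℙ ℝ E)} {d k : ℕ}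

/-- The radial vector kills the form, so the slots can be altered one at a time. With the analogous
fact for metrics, this makes the choice of a lift irrelevant. -/
theorem ProjForm.apply_add_smul (θ : ProjForm E k) {v : E} (hv : v ≠ 0) (w : Fin k → E)
    (s : Fin k → ℝ) : θ.toFun v (fun i => w i + s i • v) = θ.toFun v w := by
  classical
  suffices h : ∀ t : Finset (Fin k),
      θ.toFun v (fun i => if i ∈ t then w i + s i • v else w i) = θ.toFun v w by
    simpa using h Finset.univ
  intro t
  induction t using Finset.induction_on with
  | empty => simp
  | insert i t hi ih =>
    rw [← ih]
    set w' : Fin k → E := fun j => if j ∈ t then w j + s j • v else w j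
    have e1 : (fun j => if j ∈ insert i t then w j + s j • v else w j) =
        Function.update w' i (w i + s i • v) := by
      funext j
      by_cases hj : j = i
      · subst hj
        simp
      · simp [w', hj]
    have e2 : w' = Function.update w' i (w i) := by
      funext j
      by_cases hj : j = i
      · subst hj
        simp [w', hi]
      · simp [hj]
    have h0 : θ.toFun v (Function.update w' i v) = 0 := θ.radial v _ hv ⟨i, by simp⟩
    rw [e1, ContinuousAlternatingMap.map_update_add, ContinuousAlternatingMap.map_update_smul, ← e2,
      h0, smul_zero, add_zero]

theorem ProjMetric.apply_add_smul (g : ProjMetric E) {v : E} (hv : v ≠ 0) (w w' : E) (s s' : ℝ) :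
    g.toFun v (w + s • v) (w' + s' • v) = g.toFun v w w' := by
  have h1 : ∀ x, g.toFun v x v = 0 := fun x => by rw [g.symm v x v hv, g.radial v x hv]
  simp [h1, g.radial v _ hv]

namespace LocalParam

/-- The coordinates of a point of `M`, for the chart inverse to `ψ` (and `0` off its domain). -/
def coord (ψ : LocalParam M d) (P : M) : EuclideanSpace ℝ (Fin d) :=
  open Classical in if h : ∃ u, ψ.toM u = P then (h.choose : EuclideanSpace ℝ (Fin d)) else 0

theorem toM_injective (ψ : LocalParam M d) : Function.Injective ψ.toM :=
  ψ.isOpenEmbedding.injective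

theorem toM_isOpenEmbedding (ψ : LocalParam M d) : Topology.IsOpenEmbedding ψ.toM :=
  ψ.isOpenEmbedding

theorem coord_toM (ψ : LocalParam M d) (u : ψ.source) : ψ.coord (ψ.toM u) = u := by
  have h : ∃ u', ψ.toM u' = ψ.toM u := ⟨u, rfl⟩
  rw [coord, dif_pos h]
  exact congrArg Subtype.val (ψ.toM_injective h.choose_spec)

theorem continuousAt_coord (ψ : LocalParam M d) (u : ψ.source) :
    ContinuousAt ψ.coord (ψ.toM u) := by
  rw [← ψ.toM_isOpenEmbedding.continuousAt_iff]
  have : ψ.coord ∘ ψ.toM = Subtype.val := funext ψ.coord_toM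
  rw [this]
  exact continuous_subtype_val.continuousAt

/-- The coordinate change from `ψ` to `ψ'`. -/
def trans (ψ ψ' : LocalParam M d) (u : EuclideanSpace ℝ (Fin d)) : EuclideanSpace ℝ (Fin d) :=
  open Classical in if h : u ∈ ψ.source then ψ'.coord (ψ.toM ⟨u, h⟩) else 0

theorem trans_eq (ψ ψ' : LocalParam M d) {u : ψ.source} {u' : ψ'.source}
    (h : ψ'.toM u' = ψ.toM u) : ψ.trans ψ' u = u' := by
  rw [trans, dif_pos u.2, ← h, coord_toM]

theorem continuousAt_trans (ψ ψ' : LocalParam M d) {u : ψ.source} {u' : ψ'.source}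
    (h : ψ'.toM u' = ψ.toM u) : ContinuousAt (ψ.trans ψ') (u : EuclideanSpace ℝ (Fin d)) := by
  rw [← ψ.isOpen_source.isOpenEmbedding_subtypeVal.continuousAt_iff]
  have : ψ.trans ψ' ∘ Subtype.val = ψ'.coord ∘ ψ.toM := by
    funext w
    simp [trans, Function.comp]
  rw [this]
  refine ContinuousAt.comp ?_ ψ.toM_isOpenEmbedding.continuous.continuousAt
  rw [← h]
  exact ψ'.continuousAt_coord u'

theorem contDiffAt (ψ : LocalParam M d) {u : EuclideanSpace ℝ (Fin d)} (hu : u ∈ ψ.source) :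
    ContDiffAt ℝ ∞ ψ.toFun u :=
  ψ.smooth.contDiffAt (ψ.isOpen_source.mem_nhds hu)

theorem continuousOn_fderiv (ψ : LocalParam M d) : ContinuousOn (fderiv ℝ ψ.toFun) ψ.source :=
  ψ.smooth.continuousOn_fderiv_of_isOpen ψ.isOpen_source (by simp)

/-- Behaviour of metrics and forms under a coordinate change. -/
theorem exists_transition [FiniteDimensional ℝ E] (ψ ψ' : LocalParam M d) (g : ProjMetric E)
    {u : ψ.source} {u' : ψ'.source} (h : ψ'.toM u' = ψ.toM u) :
    ∃ A : EuclideanSpace ℝ (Fin d) →L[ℝ] EuclideanSpace ℝ (Fin d),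
      HasFDerivAt (ψ.trans ψ') A u ∧ A.det ≠ 0 ∧
      ψ.gram g u = (matOf A)ᵀ * ψ'.gram g u' * matOf A ∧
      ∀ (k : ℕ) (θ : ProjForm E k), ψ.pull θ u = (ψ'.pull θ u').compContinuousLinearMap A := by
  have hTu : ψ.trans ψ' u = u' := trans_eq ψ ψ' h
  have hT := continuousAt_trans ψ ψ' h
  have hc : ∀ᶠ w in 𝓝 (u : EuclideanSpace ℝ (Fin d)), ∃ c : ℝ, c ≠ 0 ∧
      ψ.toFun w = c • ψ'.toFun (ψ.trans ψ' w) := by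
    -- The overlap of two patches is open in the parameter domain, so the lifts are proportional on
    -- a whole neighbourhood of `u`.
    have hop : IsOpen (Subtype.val '' (ψ.toM ⁻¹' Set.range ψ'.toM)) :=
      ψ.isOpen_source.isOpenMap_subtype_val _
        (ψ'.toM_isOpenEmbedding.isOpen_range.preimage ψ.toM_isOpenEmbedding.continuous)
    filter_upwards [hop.mem_nhds ⟨u, ⟨u', h⟩, rfl⟩] with w hw
    obtain ⟨w, ⟨w', hw'⟩, rfl⟩ := hw
    rw [trans_eq ψ ψ' hw']
    have := congrArg Subtype.val hw'
    simp only [toM] at this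
    rw [Projectivization.mk_eq_mk_iff'] at this
    obtain ⟨a, ha⟩ := this
    have ha0 : a ≠ 0 := by
      rintro rfl
      rw [zero_smul] at ha
      exact ψ'.ne_zero _ w'.2 ha.symm
    exact ⟨a⁻¹, inv_ne_zero ha0, by rw [← ha, inv_smul_smul₀ ha0]⟩
  obtain ⟨A, hA, hdet, c, hc0, hcu, hform⟩ := hasFDerivAt_transition (T := ψ.trans ψ')
    (ψ.contDiffAt u.2) (by rw [hTu]; exact ψ'.contDiffAt u'.2)
    (by rw [hTu]; exact ψ'.ne_zero _ u'.2) (ψ.immersion u u.2)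
    (by rw [hTu]; exact ψ'.immersion u' u'.2) hT hc
  rw [hTu] at hcu hform
  choose s hs using hform
  have hv : ψ'.toFun u' ≠ 0 := ψ'.ne_zero _ u'.2
  have hcv : c • ψ'.toFun u' ≠ 0 := smul_ne_zero hc0 hv
  refine ⟨A, hA, hdet, ?_, ?_⟩
  · have hB : ∀ a b, g.toFun (ψ.toFun u) (fderiv ℝ ψ.toFun u a) (fderiv ℝ ψ.toFun u b) =
        g.toFun (ψ'.toFun u') (fderiv ℝ ψ'.toFun u' (A a)) (fderiv ℝ ψ'.toFun u' (A b)) := by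
      intro a b
      rw [hs a, hs b, hcu, g.apply_add_smul hcv, g.scale c _ _ _ hc0 hv]
    have hAe : ∀ i, A (EuclideanSpace.single i 1) = ∑ j, (matOf A j i) •
        (EuclideanSpace.single j (1 : ℝ)) := fun i => eq_sum_single _
    ext i j
    rw [gram, Matrix.of_apply, hB, hAe i, hAe j]
    simp only [map_sum, map_smul, sum_apply, smul_apply, smul_eq_mul, Matrix.mul_apply,
      Matrix.transpose_apply, gram, Matrix.of_apply, Finset.sum_mul, Finset.mul_sum]
    refine Finset.sum_congr rfl fun a _ => Finset.sum_congr rfl fun b _ => ?_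
    ring
  · intro k θ
    ext w
    simp only [pull, ContinuousAlternatingMap.compContinuousLinearMap_apply, Function.comp_def]
    rw [funext fun i => hs (w i), hcu, θ.apply_add_smul hcv, θ.scale c _ _ hc0 hv]

theorem gram_quad (ψ : LocalParam M d) (g : ProjMetric E) (u w w' : EuclideanSpace ℝ (Fin d)) :
    w.ofLp ⬝ᵥ (ψ.gram g u *ᵥ w'.ofLp) =
      g.toFun (ψ.toFun u) (fderiv ℝ ψ.toFun u w) (fderiv ℝ ψ.toFun u w') := by
  conv_rhs => rw [eq_sum_single w, eq_sum_single w']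
  simp only [map_sum, map_smul, sum_apply, smul_apply, smul_eq_mul, dotProduct, Matrix.mulVec, gram,
    Matrix.of_apply, Finset.mul_sum]
  rw [Finset.sum_comm]
  refine Finset.sum_congr rfl fun a _ => Finset.sum_congr rfl fun b _ => ?_
  ring

theorem gram_posDef (ψ : LocalParam M d) (g : ProjMetric E) {u : EuclideanSpace ℝ (Fin d)}
    (hu : u ∈ ψ.source) : (ψ.gram g u).PosDef := by
  refine Matrix.PosDef.of_dotProduct_mulVec_pos ?_ ?_
  · ext i j
    simp only [Matrix.conjTranspose_apply, gram, Matrix.of_apply, star_trivial]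
    exact g.symm _ _ _ (ψ.ne_zero u hu)
  · intro x hx
    rw [star_trivial]
    have := gram_quad ψ g u (WithLp.toLp 2 x) (WithLp.toLp 2 x)
    simp only at this
    rw [this]
    refine g.pos _ _ (ψ.ne_zero u hu) fun hmem => hx ?_
    have := ψ.immersion u hu _ hmem
    simpa using congrArg WithLp.ofLp this

theorem gram_det_pos (ψ : LocalParam M d) (g : ProjMetric E) {u : EuclideanSpace ℝ (Fin d)}
    (hu : u ∈ ψ.source) : 0 < (ψ.gram g u).det := (ψ.gram_posDef g hu).det_pos

theorem continuousOn_gram (ψ : LocalParam M d) (g : ProjMetric E) :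
    ContinuousOn (ψ.gram g) ψ.source := by
  refine continuousOn_pi.2 fun i => continuousOn_pi.2 fun j => ?_
  have h1 : ContinuousOn (fun u => g.toFun (ψ.toFun u)) ψ.source :=
    g.smooth.continuousOn.comp ψ.smooth.continuousOn fun u hu => ψ.ne_zero u hu
  exact (h1.clm_apply (ψ.continuousOn_fderiv.clm_apply continuousOn_const)).clm_apply
    (ψ.continuousOn_fderiv.clm_apply continuousOn_const)

/-- The volume density of the induced metric. -/
def density (ψ : LocalParam M d) (g : ProjMetric E) (u : EuclideanSpace ℝ (Fin d)) : ℝ :=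
  √(ψ.gram g u).det

theorem density_pos (ψ : LocalParam M d) (g : ProjMetric E) {u : EuclideanSpace ℝ (Fin d)}
    (hu : u ∈ ψ.source) : 0 < ψ.density g u := Real.sqrt_pos.2 (ψ.gram_det_pos g hu)

theorem continuousOn_density (ψ : LocalParam M d) (g : ProjMetric E) :
    ContinuousOn (ψ.density g) ψ.source := by
  have : Continuous fun A : Matrix (Fin d) (Fin d) ℝ => √A.det :=
    Real.continuous_sqrt.comp (Continuous.matrix_det continuous_id)
  exact this.comp_continuousOn (ψ.continuousOn_gram g)

theorem measurable_density (ψ : LocalParam M d) (g : ProjMetric E) :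
    Measurable fun u : ψ.source => ψ.density g u :=
  (continuousOn_iff_continuous_domRestrict.1 (ψ.continuousOn_density g)).measurable

theorem toM_measurableEmbedding (ψ : LocalParam M d) : MeasurableEmbedding ψ.toM :=
  ψ.toM_isOpenEmbedding.measurableEmbedding

/-- No measurability of `F` is assumed, since the pointwise inner product is defined through a
choice of charts; measurability and finiteness of the density suffice. -/
theorem lintegral_vol (ψ : LocalParam M d) (g : ProjMetric E) (F : M → ENNReal)
    (F' : EuclideanSpace ℝ (Fin d) → ENNReal) (h : ∀ u : ψ.source, F (ψ.toM u) = F' u) :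
    ∫⁻ P, F P ∂(ψ.vol g) = ∫⁻ u in ψ.source, ENNReal.ofReal (ψ.density g u) * F' u := by
  have hm := (ψ.measurable_density g).ennreal_ofReal
  simp only [density] at hm
  rw [vol, ψ.toM_measurableEmbedding.lintegral_map,
    lintegral_withDensity_eq_lintegral_mul_non_measurable _ hm (by simp)]
  simp only [h, Pi.mul_apply]
  exact lintegral_subtype_comap ψ.isOpen_source.measurableSet
    (fun u => ENNReal.ofReal (ψ.density g u) * F' u)

theorem integral_vol (ψ : LocalParam M d) (g : ProjMetric E) (F : M → ℝ)
    (F' : EuclideanSpace ℝ (Fin d) → ℝ) (h : ∀ u : ψ.source, F (ψ.toM u) = F' u) :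
    ∫ P, F P ∂(ψ.vol g) = ∫ u in ψ.source, ψ.density g u * F' u := by
  have hm := (ψ.measurable_density g).ennreal_ofReal
  simp only [density] at hm
  rw [vol, ψ.toM_measurableEmbedding.integral_map,
    integral_withDensity_eq_integral_toReal_smul hm (by simp)]
  simp only [h, smul_eq_mul]
  rw [← integral_subtype_comap ψ.isOpen_source.measurableSet (fun u => ψ.density g u * F' u)]
  refine integral_congr_ae (Filter.Eventually.of_forall fun u => ?_)
  simp only
  rw [ENNReal.toReal_ofReal (Real.sqrt_nonneg _)]
  rfl

theorem vol_apply (ψ : LocalParam M d) (g : ProjMetric E) {A : Set M} (hA : MeasurableSet A) :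
    ψ.vol g A = ∫⁻ u in Subtype.val '' (ψ.toM ⁻¹' A), ENNReal.ofReal (ψ.density g u) := by
  have hS : MeasurableSet (Subtype.val '' (ψ.toM ⁻¹' A)) :=
    ψ.isOpen_source.measurableSet.subtype_image (ψ.toM_measurableEmbedding.measurable hA)
  rw [← lintegral_indicator_one hA, ψ.lintegral_vol g _
    ((Subtype.val '' (ψ.toM ⁻¹' A)).indicator 1) ?_]
  · have : (fun u => ENNReal.ofReal (ψ.density g u) * (Subtype.val '' (ψ.toM ⁻¹' A)).indicator 1 u) =
        (Subtype.val '' (ψ.toM ⁻¹' A)).indicator fun u => ENNReal.ofReal (ψ.density g u) := by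
      funext u
      by_cases hu : u ∈ Subtype.val '' (ψ.toM ⁻¹' A)
      · rw [Set.indicator_of_mem hu, Set.indicator_of_mem hu, Pi.one_apply, mul_one]
      · rw [Set.indicator_of_notMem hu, Set.indicator_of_notMem hu, mul_zero]
    rw [this, setLIntegral_indicator hS, Set.inter_eq_left.2]
    exact Subtype.coe_image_subset _ _
  · intro u
    by_cases hu : ψ.toM u ∈ A
    · rw [Set.indicator_of_mem hu, Set.indicator_of_mem]
      · rfl
      · exact ⟨u, hu, rfl⟩
    · rw [Set.indicator_of_notMem hu, Set.indicator_of_notMem]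
      rintro ⟨u', hu', h⟩
      rw [Subtype.ext h] at hu'
      exact hu hu'

/-- Change of variables. -/
theorem vol_le_vol [FiniteDimensional ℝ E] (ψ ψ' : LocalParam M d) (g : ProjMetric E) {A : Set M}
    (hA : MeasurableSet A) (hsub : A ⊆ Set.range ψ'.toM) : ψ.vol g A ≤ ψ'.vol g A := by
  rw [ψ.vol_apply g hA, ψ'.vol_apply g hA]
  set S := Subtype.val '' (ψ.toM ⁻¹' A)
  have hS : MeasurableSet S :=
    ψ.isOpen_source.measurableSet.subtype_image (ψ.toM_measurableEmbedding.measurable hA)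
  have hex : ∀ u : S, ∃ (v : ψ.source) (u' : ψ'.source), (v : EuclideanSpace ℝ (Fin d)) = u ∧
      ψ'.toM u' = ψ.toM v ∧ ψ.toM v ∈ A := by
    rintro ⟨_, v, hv, rfl⟩
    obtain ⟨u', hu'⟩ := hsub hv
    exact ⟨v, u', rfl, hu', hv⟩
  have hder : ∀ u ∈ S, HasFDerivWithinAt (ψ.trans ψ') (fderiv ℝ (ψ.trans ψ') u) S u := by
    intro u hu
    obtain ⟨v, u', rfl, h, -⟩ := hex ⟨u, hu⟩
    obtain ⟨A, hA, -⟩ := exists_transition ψ ψ' g h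
    exact hA.differentiableAt.hasFDerivAt.hasFDerivWithinAt
  have hinj : Set.InjOn (ψ.trans ψ') S := by
    intro u hu w hw huw
    obtain ⟨v, u', hv, h, -⟩ := hex ⟨u, hu⟩
    obtain ⟨x, w', hx, h', -⟩ := hex ⟨w, hw⟩
    subst hv
    subst hx
    rw [trans_eq ψ ψ' h, trans_eq ψ ψ' h'] at huw
    have := Subtype.ext huw
    subst this
    rw [h] at h'
    exact congrArg Subtype.val (ψ.toM_injective h')
  have himg : ψ.trans ψ' '' S ⊆ Subtype.val '' (ψ'.toM ⁻¹' A) := by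
    rintro _ ⟨u, hu, rfl⟩
    obtain ⟨v, u', hv, h, hvA⟩ := hex ⟨u, hu⟩
    subst hv
    rw [trans_eq ψ ψ' h]
    exact ⟨u', by rw [Set.mem_preimage, h]; exact hvA, rfl⟩
  refine le_trans (le_of_eq ?_) (lintegral_mono_set himg)
  rw [lintegral_image_eq_lintegral_abs_det_fderiv_mul volume hS hder hinj]
  refine setLIntegral_congr_fun hS fun u hu => ?_
  obtain ⟨v, u', rfl, h, -⟩ := hex ⟨u, hu⟩
  obtain ⟨A, hA, -, hG, -⟩ := exists_transition ψ ψ' g h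
  rw [← ENNReal.ofReal_mul (abs_nonneg _), trans_eq ψ ψ' h, hA.fderiv, density, density, hG,
    Matrix.det_mul, Matrix.det_mul, Matrix.det_transpose, det_matOf]
  congr 1
  rw [show A.det * (ψ'.gram g u').det * A.det = A.det ^ 2 * (ψ'.gram g u').det by ring,
    Real.sqrt_mul (sq_nonneg _), Real.sqrt_sq_eq_abs]

/-- The supremum over all charts adds nothing inside a given patch, because on overlaps the patch
measures agree by the change of variables `vol_le_vol`. -/
theorem volM_restrict [FiniteDimensional ℝ E] (ψ : LocalParam M d) (g : ProjMetric E) :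
    (volM M d g).restrict (Set.range ψ.toM) = ψ.vol g := by
  have hR : MeasurableSet (Set.range ψ.toM) := ψ.toM_measurableEmbedding.measurableSet_range
  have hself : (ψ.vol g).restrict (Set.range ψ.toM) = ψ.vol g := by
    ext A hA
    rw [Measure.restrict_apply hA, ψ.vol_apply g (hA.inter hR), ψ.vol_apply g hA]
    congr 3
    ext u
    simp
  apply le_antisymm
  -- Any patch measure splits into its part inside the given patch, bounded by change of variables,
  -- and its part outside; the right-hand side therefore bounds the supremum.
  · have : volM M d g ≤ ψ.vol g + (volM M d g).restrict (Set.range ψ.toM)ᶜ := by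
      refine iSup_le fun ψ' => Measure.le_iff.2 fun A hA => ?_
      rw [← measure_inter_add_sdiff A hR, Measure.add_apply, Measure.restrict_apply hA]
      refine add_le_add ?_ ?_
      · exact (ψ'.vol_le_vol ψ g (hA.inter hR) Set.inter_subset_right).trans
          (measure_mono Set.inter_subset_left)
      · exact (le_iSup (fun ψ : LocalParam M d => ψ.vol g) ψ') _
    calc (volM M d g).restrict (Set.range ψ.toM) ≤
        (ψ.vol g + (volM M d g).restrict (Set.range ψ.toM)ᶜ).restrict (Set.range ψ.toM) :=
          Measure.restrict_mono le_rfl this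
      _ = ψ.vol g := by
        rw [Measure.restrict_add, hself, Measure.restrict_restrict hR, Set.inter_compl_self,
          Measure.restrict_empty, add_zero]
  · conv_lhs => rw [← hself]
    exact Measure.restrict_mono le_rfl (le_iSup (fun ψ : LocalParam M d => ψ.vol g) ψ)

end LocalParam

/-- The chart selected in the definition differs from `ψ` by a transition map, and the inner product
of forms is invariant under its derivative. -/
theorem pointInner_toM [FiniteDimensional ℝ E] (ψ : LocalParam M d) (g : ProjMetric E)
    (θ η : ProjForm E k) (u : ψ.source) :
    pointInner d g θ η (ψ.toM u) = formInner (ψ.gram g u) (ψ.pull θ u) (ψ.pull η u) := by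
  have h : ∃ c : (Σ ψ : LocalParam M d, ψ.source), c.1.toM c.2 = ψ.toM u := ⟨⟨ψ, u⟩, rfl⟩
  rw [pointInner, dif_pos h]
  obtain ⟨A, -, hdet, hG, hp⟩ := LocalParam.exists_transition ψ h.choose.1 g h.choose_spec
  rw [hG, hp k θ, hp k η, formInner_comp _ _ hdet]

/-- The hypothesis ranges over all charts around `P`, so the one selected in the definition need not
be identified. -/
theorem pointInner_eq_zero (g : ProjMetric E) (θ η : ProjForm E k) {P : M}
    (h : ∀ (ψ : LocalParam M d) (u : ψ.source), ψ.toM u = P → ψ.pull θ u = 0 ∨ ψ.pull η u = 0) :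
    pointInner d g θ η P = 0 := by
  rw [pointInner]
  split_ifs with hc
  · rcases h _ _ hc.choose_spec with h | h <;> simp [h]
  · rfl

theorem pointInner_congr (g : ProjMetric E) {θ θ' η : ProjForm E k} {P : M}
    (h : ∀ (ψ : LocalParam M d) (u : ψ.source), ψ.toM u = P →
      ψ.pull θ u = ψ.pull θ' u ∨ ψ.pull η u = 0) :
    pointInner d g θ η P = pointInner d g θ' η P := by
  rw [pointInner, pointInner]
  split_ifs with hc
  · rcases h _ _ hc.choose_spec with h | h <;> simp [h]
  · rfl

theorem l2Inner_eq_integral [FiniteDimensional ℝ E] (ψ : LocalParam M d) (g : ProjMetric E)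
    (θ η : ProjForm E k) (h : ∀ P ∉ Set.range ψ.toM, pointInner d g θ η P = 0) :
    l2Inner M d g θ η = ∫ u in ψ.source,
      ψ.density g u * formInner (ψ.gram g u) (ψ.pull θ u) (ψ.pull η u) := by
  rw [l2Inner, ← setIntegral_eq_integral_of_forall_compl_eq_zero h, ψ.volM_restrict]
  exact ψ.integral_vol g _ _ (pointInner_toM ψ g θ η)

theorem setLIntegral_range [FiniteDimensional ℝ E] (ψ : LocalParam M d) (g : ProjMetric E)
    (θ : ProjForm E k) :
    ∫⁻ P in Set.range ψ.toM, ENNReal.ofReal (pointInner d g θ θ P) ∂(volM M d g) =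
      ∫⁻ u in ψ.source, ENNReal.ofReal (ψ.density g u *
        formInner (ψ.gram g u) (ψ.pull θ u) (ψ.pull θ u)) := by
  rw [ψ.volM_restrict, ψ.lintegral_vol g _
    (fun u => ENNReal.ofReal (formInner (ψ.gram g u) (ψ.pull θ u) (ψ.pull θ u)))
    fun u => by rw [pointInner_toM]]
  simp only [ENNReal.ofReal_mul (Real.sqrt_nonneg _), LocalParam.density]

end Charts

/-! ### Pulling back forms -/

section Smoothness

variable {V W : Type*} [NormedAddCommGroup V] [NormedSpace ℝ V]
  [NormedAddCommGroup W] [NormedSpace ℝ W] {d k : ℕ}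

/-- A form-valued function on `ℝ^d` is smooth if its values on all tuples of vectors are. -/
theorem contDiffOn_of_apply {f : W → EuclideanSpace ℝ (Fin d) [⋀^Fin k]→L[ℝ] ℝ} {s : Set W}
    {r : WithTop ℕ∞} (h : ∀ w, ContDiffOn ℝ r (fun x => f x w) s) : ContDiffOn ℝ r f s := by
  let ev : (EuclideanSpace ℝ (Fin d) [⋀^Fin k]→L[ℝ] ℝ) →ₗ[ℝ] ((Fin k → Fin d) → ℝ) :=
    { toFun := comps
      map_add' := fun _ _ => rfl
      map_smul' := fun _ _ => rfl }
  have hker : LinearMap.ker ev = ⊥ := by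
    refine LinearMap.ker_eq_bot'.2 fun α hα => ?_
    ext w
    rw [alternating_apply_eq_sum]
    have : comps α = 0 := hα
    simp [this]
  obtain ⟨L, hL⟩ := LinearMap.exists_leftInverse_of_injective ev hker
  have h1 : ContDiffOn ℝ r (fun x => ev (f x)) s := contDiffOn_pi.2 fun I => h _
  have h2 : f = fun x => (LinearMap.toContinuousLinearMap L) (ev (f x)) := by
    funext x
    exact (LinearMap.congr_fun hL (f x)).symm
  rw [h2]
  exact (LinearMap.toContinuousLinearMap L).contDiff.comp_contDiffOn h1

theorem contDiffOn_compContinuousLinearMap {f : W → V [⋀^Fin k]→L[ℝ] ℝ}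
    {L : W → EuclideanSpace ℝ (Fin d) →L[ℝ] V} {s : Set W} {r : WithTop ℕ∞}
    (hf : ContDiffOn ℝ r f s) (hL : ContDiffOn ℝ r L s) :
    ContDiffOn ℝ r (fun x => (f x).compContinuousLinearMap (L x)) s := by
  refine contDiffOn_of_apply fun w => ?_
  have h1 : ContDiffOn ℝ r (fun x =>
      ContinuousMultilinearMap.compContinuousLinearMapContinuousMultilinear ℝ
        (fun _ : Fin k => EuclideanSpace ℝ (Fin d)) (fun _ => V) ℝ (fun _ => L x)) s :=
    (ContinuousMultilinearMap.contDiff _).comp_contDiffOn (contDiffOn_pi.2 fun _ => hL)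
  have h2 : ContDiffOn ℝ r (fun x =>
      ContinuousAlternatingMap.toContinuousMultilinearMapCLM ℝ (f x)) s :=
    (ContinuousAlternatingMap.toContinuousMultilinearMapCLM (ι := Fin k) (E := V) (F := ℝ)
      (𝕜 := ℝ) ℝ).contDiff.comp_contDiffOn hf
  exact (ContinuousMultilinearMap.apply ℝ (fun _ : Fin k => EuclideanSpace ℝ (Fin d)) ℝ w).contDiff
    |>.comp_contDiffOn (h1.clm_apply h2)

theorem continuousOn_compContinuousLinearMap {U : Type*} [NormedAddCommGroup U] [NormedSpace ℝ U]
    {X : Type*} [TopologicalSpace X] {f : X → V [⋀^Fin k]→L[ℝ] ℝ}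
    {L : X → U →L[ℝ] V} {s : Set X}
    (hf : ContinuousOn f s) (hL : ContinuousOn L s) :
    ContinuousOn (fun x => (f x).compContinuousLinearMap (L x)) s :=
  (ContinuousAlternatingMap.continuous_compContinuousLinearMapCLM.comp_continuousOn hL).clm_apply hf

end Smoothness

/-! ### Forms pulled back by homogeneous maps of degree zero. -/

/-- A smooth map defined on an open set of lines. -/
structure HomMap (E F : Type*) [NormedAddCommGroup E] [NormedSpace ℝ E]
    [NormedAddCommGroup F] [NormedSpace ℝ F] where
  toFun : E → F
  dom : Set E
  isOpen_dom : IsOpen dom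
  smooth : ContDiffOn ℝ ∞ toFun dom
  smul_mem : ∀ (t : ℝ) v, t ≠ 0 → v ∈ dom → t • v ∈ dom
  map_smul : ∀ (t : ℝ) v, t ≠ 0 → v ∈ dom → toFun (t • v) = toFun v

namespace HomMap

variable {E F : Type*} [NormedAddCommGroup E] [NormedSpace ℝ E]
  [NormedAddCommGroup F] [NormedSpace ℝ F] {k d : ℕ} {M : Set (ℙ ℝ E)}

theorem contDiffAt (R : HomMap E F) {v : E} (hv : v ∈ R.dom) : ContDiffAt ℝ ∞ R.toFun v :=
  R.smooth.contDiffAt (R.isOpen_dom.mem_nhds hv)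

theorem differentiableAt (R : HomMap E F) {v : E} (hv : v ∈ R.dom) :
    DifferentiableAt ℝ R.toFun v :=
  (R.contDiffAt hv).differentiableAt (by simp)

theorem fderiv_smul (R : HomMap E F) {v : E} (hv : v ∈ R.dom) {t : ℝ} (ht : t ≠ 0) (w : E) :
    fderiv ℝ R.toFun (t • v) (t • w) = fderiv ℝ R.toFun v w := by
  have h1 : HasFDerivAt (fun w => R.toFun (t • w))
      ((fderiv ℝ R.toFun (t • v)) ∘L (t • ContinuousLinearMap.id ℝ E)) v :=
    (R.differentiableAt (R.smul_mem t v ht hv)).hasFDerivAt.comp v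
      ((ContinuousLinearMap.id ℝ E).hasFDerivAt.const_smul t)
  have h2 : (fun w => R.toFun (t • w)) =ᶠ[𝓝 v] R.toFun := by
    filter_upwards [R.isOpen_dom.mem_nhds hv] with w hw
    exact R.map_smul t w ht hw
  have h3 := (h1.congr_of_eventuallyEq h2.symm).fderiv
  rw [h3]
  rfl

theorem fderiv_self (R : HomMap E F) {v : E} (hv : v ∈ R.dom) :
    fderiv ℝ R.toFun v v = 0 := by
  have hl : HasDerivAt (fun t : ℝ => t • v) v 1 := by
    simpa using (hasDerivAt_id (1 : ℝ)).smul_const v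
  have h1 : HasDerivAt (fun t : ℝ => R.toFun (t • v)) (fderiv ℝ R.toFun v v) 1 := by
    have h0 : HasFDerivAt R.toFun (fderiv ℝ R.toFun v) ((1 : ℝ) • v) := by
      rw [one_smul]
      exact (R.differentiableAt hv).hasFDerivAt
    exact h0.comp_hasDerivAt 1 hl
  have h2 : (fun t : ℝ => R.toFun (t • v)) =ᶠ[𝓝 1] fun _ => R.toFun v := by
    filter_upwards [eventually_ne_nhds (one_ne_zero (α := ℝ))] with t ht
    exact R.map_smul t v ht hv
  exact h1.unique ((hasDerivAt_const (1 : ℝ) (R.toFun v)).congr_of_eventuallyEq h2)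

theorem smul_mem_iff (R : HomMap E F) {v : E} {t : ℝ} (ht : t ≠ 0) : t • v ∈ R.dom ↔ v ∈ R.dom := by
  refine ⟨fun h => ?_, R.smul_mem t v ht⟩
  have := R.smul_mem t⁻¹ _ (inv_ne_zero ht) h
  rwa [inv_smul_smul₀ ht] at this

open Classical in
/-- The pull-back of a differential form on `F`, extended by zero. -/
def form (R : HomMap E F) (α : F → F [⋀^Fin k]→L[ℝ] ℝ) : ProjForm E k where
  toFun v := if v ∈ R.dom then (α (R.toFun v)).compContinuousLinearMap (fderiv ℝ R.toFun v) else 0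
  scale t v w ht _ := by
    by_cases hd : v ∈ R.dom
    · rw [if_pos hd, if_pos (R.smul_mem t v ht hd), R.map_smul t v ht hd]
      simp only [ContinuousAlternatingMap.compContinuousLinearMap_apply, Function.comp_def,
        R.fderiv_smul hd ht]
    · rw [if_neg hd, if_neg (by rwa [R.smul_mem_iff ht])]
      simp
  radial v w _ := by
    rintro ⟨i, hi⟩
    split_ifs with hd
    · rw [ContinuousAlternatingMap.compContinuousLinearMap_apply]
      refine ContinuousAlternatingMap.map_coord_zero _ i ?_
      rw [Function.comp_apply, hi, R.fderiv_self hd]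
    · simp

theorem pull_form (R : HomMap E F) (α : F → F [⋀^Fin k]→L[ℝ] ℝ) (ψ : LocalParam M d)
    {u : EuclideanSpace ℝ (Fin d)} (hu : u ∈ ψ.source) (hd : ψ.toFun u ∈ R.dom) :
    ψ.pull (R.form α) u = (α (R.toFun (ψ.toFun u))).compContinuousLinearMap
      (fderiv ℝ (fun u => R.toFun (ψ.toFun u)) u) := by
  have h := ((R.differentiableAt hd).hasFDerivAt.comp u
    ((ψ.contDiffAt hu).differentiableAt (by simp)).hasFDerivAt).fderiv
  have h' : fderiv ℝ (fun u => R.toFun (ψ.toFun u)) u =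
    (fderiv ℝ R.toFun (ψ.toFun u)) ∘L (fderiv ℝ ψ.toFun u) := h
  rw [h', LocalParam.pull, form]
  simp only [if_pos hd]
  rfl

theorem pull_form_of_notMem (R : HomMap E F) (α : F → F [⋀^Fin k]→L[ℝ] ℝ) (ψ : LocalParam M d)
    {u : EuclideanSpace ℝ (Fin d)} (hd : ψ.toFun u ∉ R.dom) :
    ψ.pull (R.form α) u = 0 := by
  rw [LocalParam.pull, form]
  simp only [if_neg hd]
  rfl

theorem isOpen_preimage (R : HomMap E F) (ψ : LocalParam M d) :
    IsOpen (ψ.source ∩ ψ.toFun ⁻¹' R.dom) :=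
  ψ.smooth.continuousOn.isOpen_inter_preimage ψ.isOpen_source R.isOpen_dom

theorem contDiffOn_comp (R : HomMap E F) (ψ : LocalParam M d) :
    ContDiffOn ℝ ∞ (fun u => R.toFun (ψ.toFun u)) (ψ.source ∩ ψ.toFun ⁻¹' R.dom) :=
  R.smooth.comp (ψ.smooth.mono Set.inter_subset_left) fun _ hu => hu.2

/-- Pull-backs of continuous forms are measurable. -/
theorem aestronglyMeasurable_form (R : HomMap E F) {α : F → F [⋀^Fin k]→L[ℝ] ℝ} {S : Set F}
    (hα : ContinuousOn α S)
    (hS : ∀ v (hv : v ≠ 0), Projectivization.mk ℝ v hv ∈ M → v ∈ R.dom → R.toFun v ∈ S)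
    (ψ : LocalParam M d) :
    AEStronglyMeasurable (ψ.pull (R.form α)) (volume.restrict ψ.source) := by
  set O := ψ.source ∩ ψ.toFun ⁻¹' R.dom
  have hO : IsOpen O := R.isOpen_preimage ψ
  have hc : ContinuousOn (ψ.pull (R.form α)) O := by
    have h1 : ContinuousOn (fun u => (α (R.toFun (ψ.toFun u))).compContinuousLinearMap
        (fderiv ℝ (fun u => R.toFun (ψ.toFun u)) u)) O :=
      continuousOn_compContinuousLinearMap
        (hα.comp (R.contDiffOn_comp ψ).continuousOn
          fun u hu => hS _ (ψ.ne_zero u hu.1) (ψ.mem u hu.1) hu.2)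
        ((R.contDiffOn_comp ψ).continuousOn_fderiv_of_isOpen hO (by simp))
    exact h1.congr fun u hu => R.pull_form α ψ hu.1 hu.2
  have hm : AEStronglyMeasurable (O.indicator (ψ.pull (R.form α))) (volume.restrict ψ.source) := by
    rw [aestronglyMeasurable_indicator_iff hO.measurableSet]
    have := (hc.aestronglyMeasurable (μ := volume) hO.measurableSet)
    exact this.mono_measure (Measure.restrict_mono le_rfl Measure.restrict_le_self)
  refine hm.congr ?_
  refine (ae_restrict_mem ψ.isOpen_source.measurableSet).mono fun u hu => ?_
  by_cases hd : ψ.toFun u ∈ R.dom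
  · exact Set.indicator_of_mem (s := O) ⟨hu, hd⟩ _
  · rw [Set.indicator_of_notMem (fun h => hd h.2), R.pull_form_of_notMem α ψ hd]

theorem contDiffOn_pull_form
    (R : HomMap E F) {α : F → F [⋀^Fin k]→L[ℝ] ℝ} {S : Set F} (hα : ContDiffOn ℝ ∞ α S)
    (hdom : ∀ v (hv : v ≠ 0), Projectivization.mk ℝ v hv ∈ M → v ∈ R.dom)
    (hS : ∀ v (hv : v ≠ 0), Projectivization.mk ℝ v hv ∈ M → R.toFun v ∈ S)
    (ψ : LocalParam M d) : ContDiffOn ℝ ∞ (ψ.pull (R.form α)) ψ.source := by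
  have hd : ∀ u ∈ ψ.source, ψ.toFun u ∈ R.dom := fun u hu =>
    hdom _ (ψ.ne_zero u hu) (ψ.mem u hu)
  have hF : ContDiffOn ℝ ∞ (fun u => R.toFun (ψ.toFun u)) ψ.source :=
    R.smooth.comp ψ.smooth hd
  have h1 : ContDiffOn ℝ ∞ (fun u => (α (R.toFun (ψ.toFun u))).compContinuousLinearMap
      (fderiv ℝ (fun u => R.toFun (ψ.toFun u)) u)) ψ.source :=
    contDiffOn_compContinuousLinearMap
      (hα.comp hF fun u hu => hS _ (ψ.ne_zero u hu) (ψ.mem u hu))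
      (hF.fderiv_of_isOpen ψ.isOpen_source (by simp))
  exact h1.congr fun u hu => R.pull_form α ψ hu (hd u hu)

/-- The exterior derivative commutes with pull-back. The extension by zero plays no role, since the
lines of `M` lie in the domain of `R`. -/
theorem isExtDeriv_form
    (R : HomMap E F) {α : F → F [⋀^Fin k]→L[ℝ] ℝ} {S : Set F} (hα : ∀ x ∈ S, DifferentiableAt ℝ α x)
    (hdom : ∀ v (hv : v ≠ 0), Projectivization.mk ℝ v hv ∈ M → v ∈ R.dom)
    (hS : ∀ v (hv : v ≠ 0), Projectivization.mk ℝ v hv ∈ M → R.toFun v ∈ S) :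
    IsExtDeriv M d (R.form α) (R.form (extDeriv α)) := by
  intro ψ u hu
  have hd : ∀ u ∈ ψ.source, ψ.toFun u ∈ R.dom := fun u hu =>
    hdom _ (ψ.ne_zero u hu) (ψ.mem u hu)
  have he : ψ.pull (R.form α) =ᶠ[𝓝 u] fun u => (α (R.toFun (ψ.toFun u))).compContinuousLinearMap
      (fderiv ℝ (fun u => R.toFun (ψ.toFun u)) u) := by
    filter_upwards [ψ.isOpen_source.mem_nhds hu] with w hw
    exact R.pull_form α ψ hw (hd w hw)
  rw [he.extDeriv_eq, R.pull_form _ ψ hu (hd u hu)]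
  exact (extDeriv_pullback (f := fun u => R.toFun (ψ.toFun u)) (r := ∞) (hα _ (hS _ (ψ.ne_zero u hu) (ψ.mem u hu)))
    ((R.contDiffAt (hd u hu)).comp u (ψ.contDiffAt hu))
    (by rw [minSmoothness_of_isRCLikeNormedField]; exact ENat.LEInfty.out)).symm

end HomMap

/-! ### The central projection of the sphere -/

section Sphere

variable {l : ℕ}

/-- The inclusion `t ↦ (0, t)`. -/
def tailIncl (l : ℕ) : EuclideanSpace ℝ (Fin l) →L[ℝ] EuclideanSpace ℝ (Fin (l + 1)) :=
  LinearMap.toContinuousLinearMap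
    { toFun := fun t => WithLp.toLp 2 (Fin.cons 0 t)
      map_add' := fun s t => by
        ext i
        refine Fin.cases ?_ (fun j => ?_) i <;> simp
      map_smul' := fun c t => by
        ext i
        refine Fin.cases ?_ (fun j => ?_) i <;> simp }

@[simp] theorem tailIncl_zero (t : EuclideanSpace ℝ (Fin l)) : tailIncl l t 0 = 0 := rfl

@[simp] theorem tailIncl_succ (t : EuclideanSpace ℝ (Fin l)) (i : Fin l) :
    tailIncl l t i.succ = t i := rfl

/-- The projection `(y₀, t) ↦ t`. -/
def tailProj (l : ℕ) : EuclideanSpace ℝ (Fin (l + 1)) →L[ℝ] EuclideanSpace ℝ (Fin l) :=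
  LinearMap.toContinuousLinearMap
    { toFun := fun y => WithLp.toLp 2 (fun i => y i.succ)
      map_add' := fun _ _ => rfl
      map_smul' := fun _ _ => rfl }

@[simp] theorem tailProj_apply (y : EuclideanSpace ℝ (Fin (l + 1))) (i : Fin l) :
    tailProj l y i = y i.succ := rfl

/-- The point `(1, t)`. -/
def affineLift (t : EuclideanSpace ℝ (Fin l)) : EuclideanSpace ℝ (Fin (l + 1)) :=
  EuclideanSpace.single 0 1 + tailIncl l t

@[simp] theorem affineLift_zero (t : EuclideanSpace ℝ (Fin l)) : affineLift t 0 = 1 := by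
  simp [affineLift]

@[simp] theorem affineLift_succ (t : EuclideanSpace ℝ (Fin l)) (i : Fin l) :
    affineLift t i.succ = t i := by
  simp [affineLift]

theorem affineLift_ne_zero (t : EuclideanSpace ℝ (Fin l)) : affineLift t ≠ 0 := by
  intro h
  have := affineLift_zero t
  rw [h] at this
  simp at this

theorem norm_affineLift_pos (t : EuclideanSpace ℝ (Fin l)) : 0 < ‖affineLift t‖ :=
  norm_pos_iff.2 (affineLift_ne_zero t)

theorem contDiff_affineLift : ContDiff ℝ ∞ (affineLift (l := l)) :=
  contDiff_const.add (tailIncl l).contDiff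

/-- The unit vector in the direction `(1, t)`. -/
def sph (t : EuclideanSpace ℝ (Fin l)) : EuclideanSpace ℝ (Fin (l + 1)) :=
  ‖affineLift t‖⁻¹ • affineLift t

theorem norm_sph (t : EuclideanSpace ℝ (Fin l)) : ‖sph t‖ = 1 := by
  rw [sph, norm_smul, norm_inv, norm_norm, inv_mul_cancel₀ (norm_affineLift_pos t).ne']

theorem contDiff_sph : ContDiff ℝ ∞ (sph (l := l)) :=
  ((contDiff_affineLift.norm ℝ affineLift_ne_zero).inv
    fun t => (norm_affineLift_pos t).ne').smul contDiff_affineLift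

theorem sph_zero_pos (t : EuclideanSpace ℝ (Fin l)) : 0 < sph t 0 := by
  simp [sph, norm_affineLift_pos t]

/-- The point `t` with `(1, t)` proportional to `y`. -/
def unsph (y : EuclideanSpace ℝ (Fin (l + 1))) : EuclideanSpace ℝ (Fin l) :=
  (y 0)⁻¹ • tailProj l y

theorem unsph_smul (y : EuclideanSpace ℝ (Fin (l + 1))) {c : ℝ} (hc : c ≠ 0) :
    unsph (c • y) = unsph y := by
  simp only [unsph, map_smul, smul_smul, PiLp.smul_apply, smul_eq_mul, mul_inv]
  congr 1
  field_simp

theorem unsph_sph (t : EuclideanSpace ℝ (Fin l)) : unsph (sph t) = t := by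
  rw [sph, unsph_smul _ (inv_ne_zero (norm_affineLift_pos t).ne')]
  ext i
  simp [unsph]

theorem affineLift_unsph {y : EuclideanSpace ℝ (Fin (l + 1))} (hy : y 0 ≠ 0) :
    affineLift (unsph y) = (y 0)⁻¹ • y := by
  ext i
  refine Fin.cases ?_ (fun j => ?_) i
  · simp [hy]
  · simp [unsph]

theorem sph_unsph {y : EuclideanSpace ℝ (Fin (l + 1))} (hy : 0 < y 0) :
    sph (unsph y) = ‖y‖⁻¹ • y := by
  rw [sph, affineLift_unsph hy.ne', norm_smul, norm_inv, Real.norm_of_nonneg hy.le, smul_smul,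
    mul_inv, inv_inv, mul_right_comm, mul_inv_cancel₀ hy.ne', one_mul]

theorem contDiffOn_unsph : ContDiffOn ℝ ∞ (unsph (l := l)) {y | y 0 ≠ 0} := by
  have h : ContDiff ℝ ∞ fun y : EuclideanSpace ℝ (Fin (l + 1)) => y 0 := by fun_prop
  exact (h.contDiffOn.inv fun y hy => hy).smul (tailProj l).contDiff.contDiffOn

end Sphere

/-- The identification `ℝ^{a+b} = ℝ^a × ℝ^b`. -/
def splitEquiv (a b : ℕ) : EuclideanSpace ℝ (Fin (a + b)) ≃L[ℝ]
    EuclideanSpace ℝ (Fin a) × EuclideanSpace ℝ (Fin b) :=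
  LinearEquiv.toContinuousLinearEquiv
    { toFun := fun u => (WithLp.toLp 2 fun i => u (Fin.castAdd b i),
        WithLp.toLp 2 fun i => u (Fin.natAdd a i))
      map_add' := fun _ _ => rfl
      map_smul' := fun _ _ => rfl
      invFun := fun w => WithLp.toLp 2 (Fin.append w.1 w.2)
      left_inv := fun u => by
        ext i
        refine Fin.addCases (fun j => ?_) (fun j => ?_) i <;> simp
      right_inv := fun w => by
        ext i <;> simp }

@[simp] theorem splitEquiv_fst {a b : ℕ} (u : EuclideanSpace ℝ (Fin (a + b))) (i : Fin a) :
    (splitEquiv a b u).1 i = u (Fin.castAdd b i) := rfl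

@[simp] theorem splitEquiv_snd {a b : ℕ} (u : EuclideanSpace ℝ (Fin (a + b))) (i : Fin b) :
    (splitEquiv a b u).2 i = u (Fin.natAdd a i) := rfl

theorem splitEquiv_single_castAdd {a b : ℕ} (i : Fin a) :
    splitEquiv a b (EuclideanSpace.single (Fin.castAdd b i) 1) = (EuclideanSpace.single i 1, 0) := by
  ext j
  · simp [Fin.ext_iff]
  · have : a + (j : ℕ) ≠ i := by omega
    simp [Fin.ext_iff, this]

/-! ### Horns -/

/-- A subset `M` of projective space which in the affine part `z ≠ 0`, in suitable affine
coordinates `(x, y)`, is the horn `|y| = |x| ^ δ`, `x ≠ 0`. -/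
structure Horn (E : Type*) [NormedAddCommGroup E] [NormedSpace ℝ E] (k l : ℕ) where
  M : Set (ℙ ℝ E)
  e : E ≃L[ℝ] EuclideanSpace ℝ (Fin (k + 1)) × EuclideanSpace ℝ (Fin (l + 1)) × ℝ
  δ : ℝ
  δ_pos : 0 < δ
  δ_mul : δ * l = k
  mem_iff : ∀ v (hv : v ≠ 0), Projectivization.mk ℝ v hv ∈ M ↔ (e v).2.2 ≠ 0 ∧ (e v).1 ≠ 0 ∧
    ‖(e v).2.2⁻¹ • (e v).2.1‖ = ‖(e v).2.2⁻¹ • (e v).1‖ ^ δ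

theorem continuous_mk {E : Type*} [NormedAddCommGroup E] [NormedSpace ℝ E] :
    Continuous fun v : {v : E // v ≠ 0} => Projectivization.mk ℝ v.1 v.2 :=
  continuous_quotient_mk'

theorem isOpen_iff_mk {E : Type*} [NormedAddCommGroup E] [NormedSpace ℝ E] {O : Set (ℙ ℝ E)} :
    IsOpen O ↔ IsOpen {v : {v : E // v ≠ 0} | Projectivization.mk ℝ v.1 v.2 ∈ O} :=
  Iff.rfl

namespace Horn

variable {E : Type*} [NormedAddCommGroup E] [NormedSpace ℝ E] {k l : ℕ} (H : Horn E k l)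

/-- The affine coordinate `x / z`. -/
def X : HomMap E (EuclideanSpace ℝ (Fin (k + 1))) where
  toFun v := (H.e v).2.2⁻¹ • (H.e v).1
  dom := {v | (H.e v).2.2 ≠ 0}
  isOpen_dom := isOpen_ne_fun (by fun_prop) continuous_const
  smooth := by
    have hz : ContDiff ℝ ∞ fun v => (H.e v).2.2 := contDiff_snd.snd.comp H.e.contDiff
    have hx : ContDiff ℝ ∞ fun v => (H.e v).1 := contDiff_fst.comp H.e.contDiff
    exact (hz.contDiffOn.inv fun v hv => hv).smul hx.contDiffOn
  smul_mem t v ht hv := by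
    simpa [ht] using hv
  map_smul t v ht hv := by
    simp only [map_smul, Prod.smul_fst, Prod.smul_snd, smul_smul, smul_eq_mul, mul_inv]
    congr 1
    field_simp

/-- The domain of the chart inverse to `H.chart`. -/
def chartDom : Set E := {v | (H.e v).2.2 ≠ 0 ∧ (H.e v).1 ≠ 0 ∧ 0 < (H.e v).2.2⁻¹ * (H.e v).2.1 0}

/-- The chart inverse to `H.chart`. -/
def R : HomMap E (EuclideanSpace ℝ (Fin (k + 1 + l))) where
  toFun v := (splitEquiv (k + 1) l).symm (H.X.toFun v, unsph (H.e v).2.1)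
  dom := H.chartDom
  isOpen_dom := by
    have hc : ContinuousOn (fun v => (H.e v).2.2⁻¹ * (H.e v).2.1 0) {v | (H.e v).2.2 ≠ 0} := by
      refine ContinuousOn.mul (ContinuousOn.inv₀ (by fun_prop) fun v hv => hv) ?_
      fun_prop
    have h1 := hc.isOpen_inter_preimage H.X.isOpen_dom (isOpen_Ioi (a := (0 : ℝ)))
    have h2 : IsOpen {v | (H.e v).1 ≠ 0} := isOpen_ne_fun (by fun_prop) continuous_const
    convert h2.inter h1 using 1
    ext v
    simp only [chartDom, Set.mem_ofPred_eq, Set.mem_inter_iff, Set.mem_preimage, Set.mem_Ioi]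
    tauto
  smooth := by
    refine (splitEquiv (k + 1) l).symm.contDiff.comp_contDiffOn (ContDiffOn.prodMk ?_ ?_)
    · exact H.X.smooth.mono fun v hv => hv.1
    · refine contDiffOn_unsph.comp (contDiff_snd.fst.comp H.e.contDiff).contDiffOn fun v hv => ?_
      exact fun h => hv.2.2.ne' (by rw [h, mul_zero])
  smul_mem t v ht hv := by
    refine ⟨by simpa [ht] using hv.1, by simpa [ht] using hv.2.1, ?_⟩
    have := hv.2.2
    simp only [map_smul, Prod.smul_snd, Prod.smul_fst, smul_eq_mul, PiLp.smul_apply]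
    convert this using 1
    field_simp
  map_smul t v ht hv := by
    rw [H.X.map_smul t v ht hv.1, map_smul, Prod.smul_snd, Prod.smul_fst, unsph_smul _ ht]

/-- The lift to homogeneous coordinates of the parametrization `H.chart`. -/
def lift (u : EuclideanSpace ℝ (Fin (k + 1 + l))) : E :=
  H.e.symm ((splitEquiv (k + 1) l u).1,
    ‖(splitEquiv (k + 1) l u).1‖ ^ H.δ • sph (splitEquiv (k + 1) l u).2, 1)

/-- The parameter domain of `H.chart`. -/
def chartSource (k l : ℕ) : Set (EuclideanSpace ℝ (Fin (k + 1 + l))) :=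
  {u | (splitEquiv (k + 1) l u).1 ≠ 0}

theorem isOpen_chartSource : IsOpen (chartSource k l) :=
  isOpen_ne_fun (by fun_prop) continuous_const

theorem e_lift (u : EuclideanSpace ℝ (Fin (k + 1 + l))) :
    H.e (H.lift u) = ((splitEquiv (k + 1) l u).1,
      ‖(splitEquiv (k + 1) l u).1‖ ^ H.δ • sph (splitEquiv (k + 1) l u).2, 1) := by
  simp [lift]

theorem lift_ne_zero (u : EuclideanSpace ℝ (Fin (k + 1 + l))) : H.lift u ≠ 0 := by
  intro h
  have := H.e_lift u
  rw [h, map_zero] at this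
  simpa using congrArg (fun w => w.2.2) this

theorem contDiffOn_lift : ContDiffOn ℝ ∞ H.lift (chartSource k l) := by
  have h1 : ContDiff ℝ ∞ fun u => (splitEquiv (k + 1) l u).1 :=
    contDiff_fst.comp (splitEquiv (k + 1) l).contDiff
  have h2 : ContDiff ℝ ∞ fun u => (splitEquiv (k + 1) l u).2 :=
    contDiff_snd.comp (splitEquiv (k + 1) l).contDiff
  refine H.e.symm.contDiff.comp_contDiffOn (h1.contDiffOn.prodMk (ContDiffOn.prodMk ?_ contDiffOn_const))
  have h3 : ContDiffOn ℝ ∞ (fun u => ‖(splitEquiv (k + 1) l u).1‖ ^ H.δ) (chartSource k l) :=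
    (h1.contDiffOn.norm ℝ fun u hu => hu).rpow_const_of_ne fun u hu => (norm_pos_iff.2 hu).ne'
  exact h3.smul (contDiff_sph.comp h2).contDiffOn

theorem lift_mem_chartDom {u : EuclideanSpace ℝ (Fin (k + 1 + l))} (hu : u ∈ chartSource k l) :
    H.lift u ∈ H.chartDom := by
  rw [chartDom, Set.mem_ofPred_eq, e_lift]
  refine ⟨one_ne_zero, hu, ?_⟩
  simp only [inv_one, one_mul, PiLp.smul_apply, smul_eq_mul]
  exact mul_pos (Real.rpow_pos_of_pos (norm_pos_iff.2 hu) _) (sph_zero_pos _)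

theorem X_lift (u : EuclideanSpace ℝ (Fin (k + 1 + l))) :
    H.X.toFun (H.lift u) = (splitEquiv (k + 1) l u).1 := by
  simp [X, e_lift]

theorem R_lift {u : EuclideanSpace ℝ (Fin (k + 1 + l))} (hu : u ∈ chartSource k l) :
    H.R.toFun (H.lift u) = u := by
  have h0 : ‖(splitEquiv (k + 1) l u).1‖ ^ H.δ ≠ 0 :=
    (Real.rpow_pos_of_pos (norm_pos_iff.2 hu) _).ne'
  have : H.R.toFun (H.lift u) = (splitEquiv (k + 1) l).symm (H.X.toFun (H.lift u),
    unsph (H.e (H.lift u)).2.1) := rfl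
  rw [this, X_lift, e_lift, unsph_smul _ h0, unsph_sph, Prod.mk.eta,
    ContinuousLinearEquiv.symm_apply_apply]

theorem lift_mem {u : EuclideanSpace ℝ (Fin (k + 1 + l))} (hu : u ∈ chartSource k l) :
    Projectivization.mk ℝ (H.lift u) (H.lift_ne_zero u) ∈ H.M := by
  rw [H.mem_iff, e_lift]
  refine ⟨one_ne_zero, hu, ?_⟩
  simp [norm_smul, norm_sph, abs_of_nonneg (Real.rpow_nonneg (norm_nonneg _) _)]

theorem R_mem_chartSource {v : E} (hv : v ∈ H.chartDom) : H.R.toFun v ∈ chartSource k l := by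
  have : H.R.toFun v = (splitEquiv (k + 1) l).symm (H.X.toFun v, unsph (H.e v).2.1) := rfl
  rw [chartSource, Set.mem_ofPred_eq, this, ContinuousLinearEquiv.apply_symm_apply]
  exact smul_ne_zero (inv_ne_zero hv.1) hv.2.1

/-- `H.lift` inverts `H.R` on `M`. -/
theorem lift_R {v : E} (hv : v ∈ H.chartDom) (hv0 : v ≠ 0)
    (hM : Projectivization.mk ℝ v hv0 ∈ H.M) : H.lift (H.R.toFun v) = (H.e v).2.2⁻¹ • v := by
  have h := ((H.mem_iff v hv0).1 hM).2.2
  have : H.R.toFun v = (splitEquiv (k + 1) l).symm (H.X.toFun v, unsph (H.e v).2.1) := rfl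
  apply H.e.injective
  rw [e_lift, this, ContinuousLinearEquiv.apply_symm_apply, map_smul]
  refine Prod.ext rfl (Prod.ext ?_ ?_)
  · simp only [Prod.smul_snd, Prod.smul_fst]
    have hX : ‖H.X.toFun v‖ ^ H.δ = ‖(H.e v).2.2⁻¹ • (H.e v).2.1‖ := h.symm
    rw [hX, ← unsph_smul _ (inv_ne_zero hv.1), sph_unsph hv.2.2, smul_inv_smul₀]
    have h3 : (H.e v).2.1 ≠ 0 := by
      intro h4
      have := hv.2.2
      rw [h4] at this
      simp at this
    exact norm_ne_zero_iff.2 (smul_ne_zero (inv_ne_zero hv.1) h3)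
  · simp only [Prod.smul_snd, smul_eq_mul]
    rw [inv_mul_cancel₀ hv.1]

/-- The lift stays in the affine hyperplane `z = 1`, so its tangent vectors have `z = 0`. -/
theorem fderiv_lift_z {u : EuclideanSpace ℝ (Fin (k + 1 + l))} (hu : u ∈ chartSource k l)
    (a : EuclideanSpace ℝ (Fin (k + 1 + l))) : (H.e (fderiv ℝ H.lift u a)).2.2 = 0 := by
  have hd : HasFDerivAt H.lift (fderiv ℝ H.lift u) u :=
    ((H.contDiffOn_lift.contDiffAt (isOpen_chartSource.mem_nhds hu)).differentiableAt
      (by simp)).hasFDerivAt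
  let L : E →L[ℝ] ℝ := ((ContinuousLinearMap.snd ℝ (EuclideanSpace ℝ (Fin (l + 1))) ℝ).comp
    (ContinuousLinearMap.snd ℝ (EuclideanSpace ℝ (Fin (k + 1))) _)).comp H.e.toContinuousLinearMap
  have h1 : HasFDerivAt (fun u => L (H.lift u)) (L ∘L fderiv ℝ H.lift u) u := L.hasFDerivAt.comp u hd
  have h2 : (fun u => L (H.lift u)) = fun _ => (1 : ℝ) := by
    funext w
    simp [L, e_lift]
  rw [h2] at h1
  have h3 := h1.unique (hasFDerivAt_const (1 : ℝ) u)
  exact congrArg (fun L : EuclideanSpace ℝ (Fin (k + 1 + l)) →L[ℝ] ℝ => L a) h3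

/-- The parametrization `(x, t) ↦ [x, |x| ^ δ σ(t), 1]` of an open subset of `M`, where `σ` is a
parametrization of a hemisphere. -/
def chart : LocalParam H.M (k + 1 + l) where
  source := chartSource k l
  toFun := H.lift
  isOpen_source := isOpen_chartSource
  smooth := H.contDiffOn_lift
  ne_zero u _ := H.lift_ne_zero u
  immersion u hu a ha := by
    obtain ⟨c, hc⟩ := Submodule.mem_span_singleton.1 ha
    -- Comparing `z`-components, a tangent vector proportional to the lift must vanish. Since `R` is
    -- a left inverse of the lift, `a` then vanishes as well.
    have hz := H.fderiv_lift_z hu a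
    rw [← hc, map_smul, e_lift] at hz
    simp only [Prod.smul_snd, smul_eq_mul, mul_one] at hz
    rw [hz, zero_smul] at hc
    have hd : HasFDerivAt H.lift (fderiv ℝ H.lift u) u :=
      ((H.contDiffOn_lift.contDiffAt (isOpen_chartSource.mem_nhds hu)).differentiableAt
        (by simp)).hasFDerivAt
    have h1 := (H.R.differentiableAt (H.lift_mem_chartDom hu)).hasFDerivAt.comp u hd
    have h2 : H.R.toFun ∘ H.lift =ᶠ[𝓝 u] id := by
      filter_upwards [isOpen_chartSource.mem_nhds hu] with w hw
      exact H.R_lift hw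
    have h3 := (h1.congr_of_eventuallyEq h2.symm).unique (hasFDerivAt_id u)
    have h4 := congrArg (fun L : EuclideanSpace ℝ (Fin (k + 1 + l)) →L[ℝ] _ => L a) h3
    simp only [ContinuousLinearMap.comp_apply, ← hc, map_zero] at h4
    exact h4.symm
  mem u hu := H.lift_mem hu
  isOpenEmbedding := by
    refine Topology.IsOpenEmbedding.of_continuous_injective_isOpenMap ?_ ?_ ?_
    · refine Continuous.subtype_mk ?_ _
      exact continuous_mk.comp (Continuous.subtype_mk
        (continuousOn_iff_continuous_domRestrict.1 H.contDiffOn_lift.continuousOn)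
        fun u => H.lift_ne_zero _)
    · intro u w h
      have h' := congrArg Subtype.val h
      simp only at h'
      rw [Projectivization.mk_eq_mk_iff'] at h'
      obtain ⟨c, hc⟩ := h'
      have hc0 : c ≠ 0 := by
        rintro rfl
        rw [zero_smul] at hc
        exact H.lift_ne_zero _ hc.symm
      apply Subtype.ext
      rw [← H.R_lift u.2, ← H.R_lift w.2, ← hc, H.R.map_smul c _ hc0 (H.lift_mem_chartDom w.2)]
    · intro W hW
      set W' : Set (EuclideanSpace ℝ (Fin (k + 1 + l))) := Subtype.val '' W
      have hW' : IsOpen W' := isOpen_chartSource.isOpenMap_subtype_val W hW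
      -- The map `R` is defined on an open set of the ambient space, not only on `M`. The preimage
      -- of `W` under it is open there, and its trace on `M` is the image of `W`.
      set O : Set (ℙ ℝ E) := {P | ∃ (v : E) (hv : v ≠ 0), Projectivization.mk ℝ v hv = P ∧
        v ∈ H.chartDom ∧ H.R.toFun v ∈ W'}
      have hmk : ∀ v (hv : v ≠ 0), Projectivization.mk ℝ v hv ∈ O ↔
          v ∈ H.chartDom ∧ H.R.toFun v ∈ W' := by
        intro v hv
        refine ⟨?_, fun h => ⟨v, hv, rfl, h⟩⟩
        rintro ⟨w, hw, h, h1, h2⟩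
        rw [Projectivization.mk_eq_mk_iff'] at h
        obtain ⟨c, rfl⟩ := h
        have hc : c ≠ 0 := fun h0 => hw (by rw [h0, zero_smul])
        have hv' : v ∈ H.chartDom := (H.R.smul_mem_iff hc).1 h1
        exact ⟨hv', by rwa [H.R.map_smul c v hc hv'] at h2⟩
      have hO : IsOpen O := by
        rw [isOpen_iff_mk]
        have h1 : IsOpen (H.R.dom ∩ H.R.toFun ⁻¹' W') :=
          H.R.smooth.continuousOn.isOpen_inter_preimage H.R.isOpen_dom hW'
        convert h1.preimage (continuous_subtype_val (p := fun v : E => v ≠ 0)) using 1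
        ext v
        exact hmk v.1 v.2
      convert hO.preimage (continuous_subtype_val (p := fun P => P ∈ H.M)) using 1
      ext P
      constructor
      · rintro ⟨u, hu, rfl⟩
        refine (hmk _ (H.lift_ne_zero u)).2 ⟨H.lift_mem_chartDom u.2, ?_⟩
        rw [H.R_lift u.2]
        exact ⟨u, hu, rfl⟩
      · rintro ⟨v, hv, hP, hd, u, hu, hR⟩
        refine ⟨u, hu, Subtype.ext ?_⟩
        have hM : Projectivization.mk ℝ v hv ∈ H.M := by rw [hP]; exact P.2
        rw [← hP]
        simp only
        rw [Projectivization.mk_eq_mk_iff']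
        exact ⟨(H.e v).2.2⁻¹, by rw [hR, H.lift_R hd hv hM]⟩

theorem chart_toFun : H.chart.toFun = H.lift := rfl

/-- The points of `M` covered by the chart. -/
theorem exists_chart_eq {v : E} (hv : v ∈ H.chartDom) (hv0 : v ≠ 0)
    (hM : Projectivization.mk ℝ v hv0 ∈ H.M) :
    ∃ u : H.chart.source, H.chart.toM u = ⟨Projectivization.mk ℝ v hv0, hM⟩ ∧
      (u : EuclideanSpace ℝ (Fin (k + 1 + l))) = H.R.toFun v := by
  refine ⟨⟨H.R.toFun v, H.R_mem_chartSource hv⟩, Subtype.ext ?_, rfl⟩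
  simp only [LocalParam.toM, chart_toFun]
  rw [Projectivization.mk_eq_mk_iff']
  exact ⟨(H.e v).2.2⁻¹, by rw [H.lift_R hv hv0 hM]⟩

/-- Change of the `y`-coordinate by an isometry. -/
def rotate (O : EuclideanSpace ℝ (Fin (l + 1)) ≃ₗᵢ[ℝ] EuclideanSpace ℝ (Fin (l + 1))) :
    Horn E k l where
  M := H.M
  e := H.e.trans ((ContinuousLinearEquiv.refl ℝ _).prodCongr
    (O.toContinuousLinearEquiv.prodCongr (ContinuousLinearEquiv.refl ℝ ℝ)))
  δ := H.δ
  δ_pos := H.δ_pos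
  δ_mul := H.δ_mul
  mem_iff v hv := by
    rw [H.mem_iff v hv]
    simp [← map_smul]

end Horn

/-! ### The geometry of a horn near its tip -/

theorem norm_splitEquiv_symm {a b : ℕ} (x : EuclideanSpace ℝ (Fin a)) (t : EuclideanSpace ℝ (Fin b)) :
    ‖(splitEquiv a b).symm (x, t)‖ ^ 2 = ‖x‖ ^ 2 + ‖t‖ ^ 2 := by
  obtain ⟨u, hu⟩ := (splitEquiv a b).surjective (x, t)
  rw [← hu, ContinuousLinearEquiv.symm_apply_apply, EuclideanSpace.norm_sq_eq,
    Fin.sum_univ_add, EuclideanSpace.norm_sq_eq, EuclideanSpace.norm_sq_eq,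
    show x = (splitEquiv a b u).1 by rw [hu], show t = (splitEquiv a b u).2 by rw [hu]]
  rfl

/-! ### The radial stretching map. -/

section Stretch

variable {n : ℕ}

/-- The linear map which multiplies `x` by `1 + β |x|²` and is the identity on its orthogonal
complement. -/
def stretch (β : ℝ) (x : EuclideanSpace ℝ (Fin n)) :
    EuclideanSpace ℝ (Fin n) →L[ℝ] EuclideanSpace ℝ (Fin n) :=
  ContinuousLinearMap.id ℝ _ + (β • innerSL ℝ x).smulRight x

theorem stretch_apply (β : ℝ) (x w : EuclideanSpace ℝ (Fin n)) :
    stretch β x w = w + (β * inner ℝ x w) • x := by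
  simp [stretch]

theorem det_stretch (β : ℝ) (x : EuclideanSpace ℝ (Fin n)) :
    LinearMap.det (stretch β x).toLinearMap = 1 + β * ‖x‖ ^ 2 := by
  have : (stretch β x).toLinearMap =
      LinearMap.transvection (β • innerSL ℝ x : EuclideanSpace ℝ (Fin n) →L[ℝ] ℝ).toLinearMap x := by
    ext w
    simp [stretch, LinearMap.transvection.apply]
  rw [this, LinearMap.transvection.det]
  simp

theorem norm_stretch_sq (β : ℝ) (x w : EuclideanSpace ℝ (Fin n)) :
    ‖stretch β x w‖ ^ 2 = ‖w‖ ^ 2 + (2 * β + β ^ 2 * ‖x‖ ^ 2) * inner ℝ x w ^ 2 := by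
  rw [stretch_apply, ← real_inner_self_eq_norm_sq, inner_add_add_self, inner_smul_left,
    inner_smul_right, inner_smul_left, real_inner_self_eq_norm_sq, inner_smul_right,
    real_inner_self_eq_norm_sq, real_inner_comm]
  simp only [RCLike.conj_to_real]
  ring

/-- The two sides differ only by the cross term `2 β ⟨x, w⟩²`. It is nonnegative, and by
Cauchy–Schwarz and the inequality between arithmetic and geometric means it is at most `|w|² + β²
|x|² ⟨x, w⟩²`. -/
theorem stretch_bounds {β : ℝ} (hβ : 0 ≤ β) (x w : EuclideanSpace ℝ (Fin n)) :
    ‖w‖ ^ 2 + β ^ 2 * ‖x‖ ^ 2 * inner ℝ x w ^ 2 ≤ ‖stretch β x w‖ ^ 2 ∧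
    ‖stretch β x w‖ ^ 2 ≤ 2 * (‖w‖ ^ 2 + β ^ 2 * ‖x‖ ^ 2 * inner ℝ x w ^ 2) := by
  rw [norm_stretch_sq]
  constructor
  · nlinarith [mul_nonneg hβ (sq_nonneg (inner ℝ x w : ℝ))]
  · have h1 : (inner ℝ x w : ℝ) ^ 2 ≤ ‖x‖ ^ 2 * ‖w‖ ^ 2 := by
      rw [← mul_pow]
      exact sq_le_sq' (by linarith [neg_le_of_abs_le (abs_real_inner_le_norm x w)])
        (real_inner_le_norm x w)
    have h2 : 2 * β * (inner ℝ x w : ℝ) ^ 2 ≤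
        ‖w‖ ^ 2 + β ^ 2 * ‖x‖ ^ 2 * inner ℝ x w ^ 2 := by
      by_cases hw : (inner ℝ x w : ℝ) = 0
      · rw [hw]
        simp only [ne_eq, OfNat.ofNat_ne_zero, not_false_eq_true, zero_pow, mul_zero, add_zero]
        positivity
      · set s : ℝ := inner ℝ x w
        have h4 : s ^ 2 ≤ ‖x‖ * ‖w‖ * |s| := by
          rw [← sq_abs, sq]
          exact mul_le_mul_of_nonneg_right (abs_real_inner_le_norm x w) (abs_nonneg _)
        have h5 := mul_le_mul_of_nonneg_left h4 hβ
        have h6 : (‖w‖ - β * ‖x‖ * |s|) ^ 2 =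
            ‖w‖ ^ 2 - 2 * (β * (‖x‖ * ‖w‖ * |s|)) + β ^ 2 * ‖x‖ ^ 2 * s ^ 2 := by
          rw [← sq_abs s]
          ring
        have h7 := sq_nonneg (‖w‖ - β * ‖x‖ * |s|)
        linarith
    linarith

end Stretch

namespace Horn

variable {E : Type*} [NormedAddCommGroup E] [NormedSpace ℝ E] {k l : ℕ} (H : Horn E k l)

/-- The radial distortion of the parametrization. -/
def rad (x : EuclideanSpace ℝ (Fin (k + 1))) : ℝ := 1 + H.δ * ‖x‖ ^ (H.δ - 1)

/-- The stretching coefficient. -/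
def beta (x : EuclideanSpace ℝ (Fin (k + 1))) : ℝ := H.δ * ‖x‖ ^ (H.δ - 3)

theorem beta_nonneg (x : EuclideanSpace ℝ (Fin (k + 1))) : 0 ≤ H.beta x :=
  mul_nonneg H.δ_pos.le (Real.rpow_nonneg (norm_nonneg _) _)

theorem one_le_rad (x : EuclideanSpace ℝ (Fin (k + 1))) : 1 ≤ H.rad x := by
  have := mul_nonneg H.δ_pos.le (Real.rpow_nonneg (norm_nonneg x) (H.δ - 1))
  rw [rad]
  linarith

/-- The exponent `δ - 3` in `beta` is chosen so that `stretch` multiplies the radial direction by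
exactly `rad`. -/
theorem rad_eq {x : EuclideanSpace ℝ (Fin (k + 1))} (hx : x ≠ 0) :
    1 + H.beta x * ‖x‖ ^ 2 = H.rad x := by
  rw [rad, beta, mul_assoc, ← Real.rpow_natCast ‖x‖ 2, ← Real.rpow_add (norm_pos_iff.2 hx)]
  congr 3
  push_cast
  ring

/-- This is where `δ l = k` enters: the `l`-dimensional link sphere of radius `|x|^δ` contributes
the same power `|x|^k` to the volume as the `k`-dimensional one of radius `|x|`. -/
theorem norm_rpow_pow {x : EuclideanSpace ℝ (Fin (k + 1))} : (‖x‖ ^ H.δ) ^ l = ‖x‖ ^ k := by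
  rw [← Real.rpow_natCast (‖x‖ ^ H.δ) l, ← Real.rpow_mul (norm_nonneg _), H.δ_mul,
    Real.rpow_natCast]

/-- A linear map which makes the coordinate metric comparable to the Euclidean metric. -/
def frame (x : EuclideanSpace ℝ (Fin (k + 1))) :
    EuclideanSpace ℝ (Fin (k + 1 + l)) →L[ℝ] EuclideanSpace ℝ (Fin (k + 1 + l)) :=
  (splitEquiv (k + 1) l).symm.toContinuousLinearMap ∘L
    ((stretch (H.beta x) x).prodMap (‖x‖ ^ H.δ • ContinuousLinearMap.id ℝ _)) ∘L
    (splitEquiv (k + 1) l).toContinuousLinearMap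

/-- The `x`-block contributes `rad` and the `t`-block `(|x|^δ)^l = |x|^k`; this product is the model
for the volume density. -/
theorem det_frame {x : EuclideanSpace ℝ (Fin (k + 1))} (hx : x ≠ 0) :
    (H.frame x).det = H.rad x * ‖x‖ ^ k := by
  have h := LinearMap.det_conj ((stretch (H.beta x) x).toLinearMap.prodMap
    (‖x‖ ^ H.δ • LinearMap.id : EuclideanSpace ℝ (Fin l) →ₗ[ℝ] EuclideanSpace ℝ (Fin l)))
    (splitEquiv (k + 1) l).symm.toLinearEquiv
  have h2 : (H.frame x).det = LinearMap.det ((stretch (H.beta x) x).toLinearMap.prodMap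
    (‖x‖ ^ H.δ • LinearMap.id : EuclideanSpace ℝ (Fin l) →ₗ[ℝ] EuclideanSpace ℝ (Fin l))) := by
    rw [← h]
    rfl
  rw [h2, LinearMap.det_prodMap, det_stretch, H.rad_eq hx, LinearMap.det_smul, LinearMap.det_id,
    mul_one, finrank_euclideanSpace, Fintype.card_fin, H.norm_rpow_pow]

theorem norm_frame_sq (x : EuclideanSpace ℝ (Fin (k + 1))) (a : EuclideanSpace ℝ (Fin (k + 1 + l))) :
    ‖H.frame x a‖ ^ 2 = ‖stretch (H.beta x) x (splitEquiv (k + 1) l a).1‖ ^ 2 +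
      (‖x‖ ^ H.δ) ^ 2 * ‖(splitEquiv (k + 1) l a).2‖ ^ 2 := by
  have : H.frame x a = (splitEquiv (k + 1) l).symm (stretch (H.beta x) x (splitEquiv (k + 1) l a).1,
    ‖x‖ ^ H.δ • (splitEquiv (k + 1) l a).2) := rfl
  rw [this, norm_splitEquiv_symm, norm_smul, Real.norm_of_nonneg (Real.rpow_nonneg (norm_nonneg _) _)]
  ring

theorem norm_le_norm_frame (x : EuclideanSpace ℝ (Fin (k + 1)))
    (a : EuclideanSpace ℝ (Fin (k + 1 + l))) :
    ‖(splitEquiv (k + 1) l a).1‖ ^ 2 ≤ ‖H.frame x a‖ ^ 2 := by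
  rw [norm_frame_sq]
  have h1 := (stretch_bounds (H.beta_nonneg x) x (splitEquiv (k + 1) l a).1).1
  have h2 : 0 ≤ H.beta x ^ 2 * ‖x‖ ^ 2 * inner ℝ x (splitEquiv (k + 1) l a).1 ^ 2 := by positivity
  have h3 : 0 ≤ (‖x‖ ^ H.δ) ^ 2 * ‖(splitEquiv (k + 1) l a).2‖ ^ 2 := by positivity
  linarith

theorem hasFDerivAt_norm_rpow {x : EuclideanSpace ℝ (Fin (k + 1))} (hx : x ≠ 0) :
    HasFDerivAt (fun x : EuclideanSpace ℝ (Fin (k + 1)) => ‖x‖ ^ H.δ)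
      ((H.beta x * ‖x‖) • innerSL ℝ x) x := by
  have hp : 0 < ‖x‖ := norm_pos_iff.2 hx
  -- The power is taken of the squared norm, with exponent `δ / 2`, because the squared norm is the
  -- differentiable function at hand.
  have h1 := (((hasFDerivAt_id x).norm_sq).rpow_const (p := H.δ / 2) (Or.inl (by
    simpa using hx)))
  have h2 : (fun x : EuclideanSpace ℝ (Fin (k + 1)) => (‖id x‖ ^ 2) ^ (H.δ / 2)) =
      fun x => ‖x‖ ^ H.δ := by
    funext y
    rw [id, ← Real.rpow_natCast ‖y‖ 2, ← Real.rpow_mul (norm_nonneg _)]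
    congr 1
    push_cast
    ring
  rw [h2] at h1
  refine h1.congr_fderiv ?_
  ext w
  simp only [beta, id, smul_apply, smul_eq_mul, ContinuousLinearMap.comp_apply, nsmul_eq_mul,
    ContinuousLinearMap.id_apply, innerSL_apply_apply]
  rw [← Real.rpow_natCast ‖x‖ 2, ← Real.rpow_mul hp.le, mul_assoc H.δ, mul_assoc H.δ]
  have h3 : ‖x‖ ^ (H.δ - 3) * ‖x‖ = ‖x‖ ^ (((2 : ℕ) : ℝ) * (H.δ / 2 - 1)) := by
    nth_rewrite 2 [← Real.rpow_one ‖x‖]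
    rw [← Real.rpow_add hp]
    congr 1
    push_cast
    ring
  rw [← h3]
  push_cast
  ring

/-- The derivative of the parametrization. -/
theorem e_fderiv_lift {u : EuclideanSpace ℝ (Fin (k + 1 + l))} (hu : u ∈ chartSource k l)
    (a : EuclideanSpace ℝ (Fin (k + 1 + l))) :
    H.e (fderiv ℝ H.lift u a) = ((splitEquiv (k + 1) l a).1,
      ‖(splitEquiv (k + 1) l u).1‖ ^ H.δ •
        fderiv ℝ sph (splitEquiv (k + 1) l u).2 (splitEquiv (k + 1) l a).2 +
      (H.beta (splitEquiv (k + 1) l u).1 * ‖(splitEquiv (k + 1) l u).1‖ *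
        inner ℝ (splitEquiv (k + 1) l u).1 (splitEquiv (k + 1) l a).1) •
          sph (splitEquiv (k + 1) l u).2, 0) := by
  set x := (splitEquiv (k + 1) l u).1
  set t := (splitEquiv (k + 1) l u).2
  let p1 : EuclideanSpace ℝ (Fin (k + 1 + l)) →L[ℝ] EuclideanSpace ℝ (Fin (k + 1)) :=
    (ContinuousLinearMap.fst ℝ _ _).comp (splitEquiv (k + 1) l).toContinuousLinearMap
  let p2 : EuclideanSpace ℝ (Fin (k + 1 + l)) →L[ℝ] EuclideanSpace ℝ (Fin l) :=
    (ContinuousLinearMap.snd ℝ _ _).comp (splitEquiv (k + 1) l).toContinuousLinearMap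
  have h1 : HasFDerivAt (fun u => ‖p1 u‖ ^ H.δ) (((H.beta x * ‖x‖) • innerSL ℝ x) ∘L p1) u :=
    HasFDerivAt.comp u (H.hasFDerivAt_norm_rpow (x := p1 u) hu) p1.hasFDerivAt
  have h2 : HasFDerivAt (fun u => sph (p2 u)) ((fderiv ℝ sph t) ∘L p2) u :=
    HasFDerivAt.comp u (((contDiff_sph (l := l)).differentiable (by simp)) (p2 u)).hasFDerivAt
      p2.hasFDerivAt
  have h3 := p1.hasFDerivAt.prodMk ((h1.smul h2).prodMk (hasFDerivAt_const (1 : ℝ) u)) (x := u)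
  have h4 := H.e.symm.toContinuousLinearMap.hasFDerivAt.comp u h3
  have h5 : fderiv ℝ H.lift u = _ := h4.fderiv
  rw [h5]
  simp only [ContinuousLinearMap.comp_apply, ContinuousLinearEquiv.coe_coe,
    ContinuousLinearEquiv.apply_symm_apply]
  rfl

/-- Differentiating `|sph|² = 1`. The radial and the spherical parts of the `y`-component of a
tangent vector are therefore orthogonal, and no mixed term appears in `norm_tangent_sq`. -/
theorem inner_sph_fderiv (t s : EuclideanSpace ℝ (Fin l)) :
    inner ℝ (sph t) (fderiv ℝ sph t s) = 0 := by
  have hd : HasFDerivAt (sph (l := l)) (fderiv ℝ sph t) t :=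
    ((contDiff_sph (l := l)).differentiable (by simp) t).hasFDerivAt
  have h1 := hd.norm_sq
  have h2 : (fun t : EuclideanSpace ℝ (Fin l) => ‖sph t‖ ^ 2) = fun _ => 1 := by
    funext t
    rw [norm_sph, one_pow]
  rw [h2] at h1
  have h3 := congrArg (fun L : EuclideanSpace ℝ (Fin l) →L[ℝ] ℝ => L s)
    (h1.unique (hasFDerivAt_const (1 : ℝ) t))
  simpa using h3

/-- The square length of a tangent vector in the affine chart. -/
theorem norm_tangent_sq {u : EuclideanSpace ℝ (Fin (k + 1 + l))} (hu : u ∈ chartSource k l)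
    (a : EuclideanSpace ℝ (Fin (k + 1 + l))) :
    ‖(H.e (fderiv ℝ H.lift u a)).1‖ ^ 2 + ‖(H.e (fderiv ℝ H.lift u a)).2.1‖ ^ 2 =
      ‖(splitEquiv (k + 1) l a).1‖ ^ 2 + H.beta (splitEquiv (k + 1) l u).1 ^ 2 *
        ‖(splitEquiv (k + 1) l u).1‖ ^ 2 *
        inner ℝ (splitEquiv (k + 1) l u).1 (splitEquiv (k + 1) l a).1 ^ 2 +
      (‖(splitEquiv (k + 1) l u).1‖ ^ H.δ) ^ 2 *
        ‖fderiv ℝ sph (splitEquiv (k + 1) l u).2 (splitEquiv (k + 1) l a).2‖ ^ 2 := by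
  rw [H.e_fderiv_lift hu]
  have hi : ∀ t s : EuclideanSpace ℝ (Fin l), inner ℝ (fderiv ℝ sph t s) (sph t) = 0 :=
    fun t s => by rw [real_inner_comm, inner_sph_fderiv]
  simp only
  rw [← real_inner_self_eq_norm_sq (_ + _), inner_add_add_self]
  simp only [inner_smul_left, inner_smul_right, RCLike.conj_to_real, inner_sph_fderiv, hi,
    real_inner_self_eq_norm_sq, norm_sph]
  ring

/-- The upper bound is compactness of the ball. The lower one comes from the smooth left inverse
`unsph`, whose derivative along the image of the ball is bounded for the same reason. -/
theorem exists_sph_bounds (l : ℕ) (T : ℝ) : ∃ c C : ℝ, 0 < c ∧ 0 < C ∧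
    ∀ t s : EuclideanSpace ℝ (Fin l), ‖t‖ ≤ T →
      c * ‖s‖ ^ 2 ≤ ‖fderiv ℝ sph t s‖ ^ 2 ∧ ‖fderiv ℝ sph t s‖ ^ 2 ≤ C * ‖s‖ ^ 2 := by
  have hK : IsCompact (Metric.closedBall (0 : EuclideanSpace ℝ (Fin l)) T) :=
    isCompact_closedBall _ _
  have hc1 : Continuous fun t : EuclideanSpace ℝ (Fin l) => fderiv ℝ sph t :=
    (contDiff_sph (l := l)).continuous_fderiv (by simp)
  have hopen : IsOpen {y : EuclideanSpace ℝ (Fin (l + 1)) | y 0 ≠ 0} :=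
    isOpen_ne_fun (by fun_prop) continuous_const
  have hc2 : Continuous fun t : EuclideanSpace ℝ (Fin l) => fderiv ℝ unsph (sph t) := by
    rw [← continuousOn_univ]
    exact ((contDiffOn_unsph (l := l)).continuousOn_fderiv_of_isOpen hopen (by simp)).comp
      contDiff_sph.continuous.continuousOn fun t _ => (sph_zero_pos t).ne'
  obtain ⟨C1, hC1⟩ := hK.exists_bound_of_continuousOn hc1.continuousOn
  obtain ⟨C2, hC2⟩ := hK.exists_bound_of_continuousOn hc2.continuousOn
  set D1 := max C1 1
  set D2 := max C2 1
  have hD1 : 0 < D1 := lt_of_lt_of_le one_pos (le_max_right _ _)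
  have hD2 : 0 < D2 := lt_of_lt_of_le one_pos (le_max_right _ _)
  refine ⟨(D2 ^ 2)⁻¹, D1 ^ 2, by positivity, by positivity, fun t s ht => ⟨?_, ?_⟩⟩
  · have hd : HasFDerivAt (sph (l := l)) (fderiv ℝ sph t) t :=
      ((contDiff_sph (l := l)).differentiable (by simp) t).hasFDerivAt
    have hu : HasFDerivAt (unsph (l := l)) (fderiv ℝ unsph (sph t)) (sph t) :=
      ((contDiffOn_unsph.contDiffAt (hopen.mem_nhds (sph_zero_pos t).ne')).differentiableAt
        (by simp)).hasFDerivAt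
    have h1 := hu.comp t hd
    have h2 : unsph ∘ sph (l := l) = id := funext unsph_sph
    rw [h2] at h1
    have h3 : fderiv ℝ unsph (sph t) (fderiv ℝ sph t s) = s :=
      congrArg (fun L : EuclideanSpace ℝ (Fin l) →L[ℝ] _ => L s) (h1.unique (hasFDerivAt_id t))
    have h4 : ‖s‖ ≤ D2 * ‖fderiv ℝ sph t s‖ := by
      conv_lhs => rw [← h3]
      refine (ContinuousLinearMap.le_opNorm _ _).trans ?_
      exact mul_le_mul_of_nonneg_right ((hC2 t (by simpa using ht)).trans (le_max_left _ _))
        (norm_nonneg _)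
    rw [inv_mul_le_iff₀ (by positivity), ← mul_pow]
    exact pow_le_pow_left₀ (norm_nonneg _) h4 2
  · rw [← mul_pow]
    refine pow_le_pow_left₀ (norm_nonneg _) ?_ 2
    refine (ContinuousLinearMap.le_opNorm _ _).trans ?_
    exact mul_le_mul_of_nonneg_right ((hC1 t (by simpa using ht)).trans (le_max_left _ _))
      (norm_nonneg _)

/-- Near the tip, a Riemannian metric is comparable to the Euclidean metric of the affine chart. -/
theorem exists_metric_bounds (g : ProjMetric E) (r : ℝ) : ∃ c C : ℝ, 0 < c ∧ 0 < C ∧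
    ∀ v w : E, (H.e v).2.2 = 1 → ‖(H.e v).1‖ ≤ r → ‖(H.e v).2.1‖ ≤ r → (H.e w).2.2 = 0 →
      c * (‖(H.e w).1‖ ^ 2 + ‖(H.e w).2.1‖ ^ 2) ≤ g.toFun v w w ∧
      g.toFun v w w ≤ C * (‖(H.e w).1‖ ^ 2 + ‖(H.e w).2.1‖ ^ 2) := by
  let XY := EuclideanSpace ℝ (Fin (k + 1)) × EuclideanSpace ℝ (Fin (l + 1))
  let V : XY → E := fun p => H.e.symm (p.1, p.2, 1)
  let W : XY → E := fun p => H.e.symm (p.1, p.2, 0)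
  have hV : Continuous V := H.e.symm.continuous.comp (by fun_prop)
  have hW : Continuous W := H.e.symm.continuous.comp (by fun_prop)
  have hV0 : ∀ p, V p ≠ 0 := fun p h => by
    have := congrArg (fun v => (H.e v).2.2) h
    simp [V] at this
  -- By homogeneity it is enough to bound `g` on unit vectors over a compact ball. Positivity there
  -- holds because a nonzero vector with `z = 0` is never proportional to a point with `z = 1`.
  set S : Set XY := {p | ‖p.1‖ ^ 2 + ‖p.2‖ ^ 2 = 1}
  have hS : IsCompact S := by
    refine Metric.isCompact_of_isClosed_isBounded
      (isClosed_eq (by fun_prop) continuous_const) ?_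
    refine (Metric.isBounded_closedBall (x := (0 : XY)) (r := 1)).subset fun p hp => ?_
    have hp' : ‖p.1‖ ^ 2 + ‖p.2‖ ^ 2 = 1 := hp
    rw [mem_closedBall_zero_iff, Prod.norm_def]
    refine max_le ?_ ?_
    · nlinarith [norm_nonneg p.1, sq_nonneg ‖p.2‖]
    · nlinarith [norm_nonneg p.2, sq_nonneg ‖p.1‖]
  set K : Set (XY × XY) := (Metric.closedBall 0 r) ×ˢ S
  have hK : IsCompact K := (isCompact_closedBall _ _).prod hS
  let F : XY × XY → ℝ := fun p => g.toFun (V p.1) (W p.2) (W p.2)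
  have hF : Continuous F := by
    have h1 : Continuous fun p : XY × XY => g.toFun (V p.1) := by
      rw [← continuousOn_univ]
      exact g.smooth.continuousOn.comp (hV.comp continuous_fst).continuousOn fun p _ => hV0 _
    exact (h1.clm_apply (hW.comp continuous_snd)).clm_apply (hW.comp continuous_snd)
  have hpos : ∀ p ∈ K, 0 < F p := by
    rintro ⟨p, q⟩ ⟨-, hq⟩
    refine g.pos _ _ (hV0 p) fun hmem => ?_
    obtain ⟨c, hc⟩ := Submodule.mem_span_singleton.1 hmem
    have h1 := congrArg (fun v => (H.e v).2.2) hc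
    simp only [V, W, map_smul, ContinuousLinearEquiv.apply_symm_apply, Prod.smul_snd,
      smul_eq_mul, mul_one] at h1
    rw [h1, zero_smul] at hc
    have h2 := congrArg H.e hc
    simp only [W, ContinuousLinearEquiv.apply_symm_apply, map_zero] at h2
    have h3 : q.1 = 0 := (congrArg (fun w => w.1) h2).symm
    have h4 : q.2 = 0 := (congrArg (fun w => w.2.1) h2).symm
    have h5 : ‖q.1‖ ^ 2 + ‖q.2‖ ^ 2 = 1 := hq
    rw [h3, h4] at h5
    simp at h5
  obtain ⟨c, hc0, hc⟩ := hK.exists_forall_le' hF.continuousOn hpos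
  obtain ⟨C, hC⟩ := hK.exists_bound_of_continuousOn hF.continuousOn
  refine ⟨c, max C 1, hc0, lt_of_lt_of_le one_pos (le_max_right _ _), fun v w hv1 hvx hvy hw => ?_⟩
  have hVv : V ((H.e v).1, (H.e v).2.1) = v := by
    apply H.e.injective
    simp only [V, ContinuousLinearEquiv.apply_symm_apply]
    exact Prod.ext rfl (Prod.ext rfl hv1.symm)
  have hWw : W ((H.e w).1, (H.e w).2.1) = w := by
    apply H.e.injective
    simp only [W, ContinuousLinearEquiv.apply_symm_apply]
    exact Prod.ext rfl (Prod.ext rfl hw.symm)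
  set N := ‖(H.e w).1‖ ^ 2 + ‖(H.e w).2.1‖ ^ 2
  rcases (show 0 ≤ N by positivity).eq_or_lt with hN | hN
  · have h1 : (H.e w).1 = 0 := by
      rw [← norm_eq_zero, ← sq_eq_zero_iff]
      nlinarith [sq_nonneg ‖(H.e w).1‖, sq_nonneg ‖(H.e w).2.1‖]
    have h2 : (H.e w).2.1 = 0 := by
      rw [← norm_eq_zero, ← sq_eq_zero_iff]
      nlinarith [sq_nonneg ‖(H.e w).1‖, sq_nonneg ‖(H.e w).2.1‖]
    have h3 : w = 0 := by
      apply H.e.injective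
      rw [map_zero]
      exact Prod.ext h1 (Prod.ext h2 hw)
    rw [← hN, h3]
    simp
  · set q : XY := ((√N)⁻¹ • (H.e w).1, (√N)⁻¹ • (H.e w).2.1)
    have hsq : √N ≠ 0 := (Real.sqrt_pos.2 hN).ne'
    have hs2 : √N ^ 2 = N := Real.sq_sqrt hN.le
    have hq : q ∈ S := by
      change ‖(√N)⁻¹ • (H.e w).1‖ ^ 2 + ‖(√N)⁻¹ • (H.e w).2.1‖ ^ 2 = 1
      rw [norm_smul, norm_smul, mul_pow, mul_pow, ← mul_add, norm_inv,
        Real.norm_of_nonneg (Real.sqrt_nonneg _), inv_pow, hs2]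
      exact inv_mul_cancel₀ hN.ne'
    have hw' : w = √N • W q := by
      rw [← map_smul]
      apply H.e.injective
      simp only [ContinuousLinearEquiv.apply_symm_apply, q]
      refine Prod.ext ?_ (Prod.ext ?_ ?_)
      · simp [smul_inv_smul₀ hsq]
      · simp [smul_inv_smul₀ hsq]
      · simp [hw]
    have hmem : (((H.e v).1, (H.e v).2.1), q) ∈ K := by
      refine ⟨?_, hq⟩
      rw [mem_closedBall_zero_iff, Prod.norm_def]
      exact max_le hvx hvy
    have hval : g.toFun v w w = N * F (((H.e v).1, (H.e v).2.1), q) := by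
      simp only [F, hVv]
      nth_rewrite 1 [hw']
      nth_rewrite 1 [hw']
      simp only [map_smul, smul_apply, smul_eq_mul]
      rw [← mul_assoc, ← sq, hs2]
    have b1 := hc _ hmem
    have b2 := (le_abs_self _).trans ((hC _ hmem).trans (le_max_left C 1))
    rw [hval]
    constructor <;> nlinarith

/-- In coordinates, the metric near the tip is comparable to the Euclidean metric transformed by
`H.frame`. -/
theorem exists_gram_bounds (g : ProjMetric E) (r T : ℝ) : ∃ c C : ℝ, 0 < c ∧ 0 < C ∧
    ∀ u ∈ chartSource k l, ‖(splitEquiv (k + 1) l u).1‖ ≤ r → ‖(splitEquiv (k + 1) l u).2‖ ≤ T →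
      ∀ a : EuclideanSpace ℝ (Fin (k + 1 + l)),
        c * ‖H.frame (splitEquiv (k + 1) l u).1 a‖ ^ 2 ≤ a.ofLp ⬝ᵥ (H.chart.gram g u *ᵥ a) ∧
        a.ofLp ⬝ᵥ (H.chart.gram g u *ᵥ a) ≤ C * ‖H.frame (splitEquiv (k + 1) l u).1 a‖ ^ 2 := by
  obtain ⟨c1, C1, hc1, hC1, h1⟩ := exists_sph_bounds l T
  obtain ⟨c2, C2, hc2, hC2, h2⟩ := H.exists_metric_bounds g (max r (r ^ H.δ))
  -- The factor `1/2` compensates the constant `2` in `stretch_bounds`; `c1` and `C1` control the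
  -- sphere directions, `c2` and `C2` the ambient metric.
  refine ⟨c2 * (min 1 c1 / 2), C2 * max 1 C1, by positivity, by positivity, fun u hu hx ht a => ?_⟩
  have hr : 0 ≤ r := (norm_nonneg _).trans hx
  have hb := h2 (H.lift u) (fderiv ℝ H.lift u a) (by rw [e_lift])
    (by rw [e_lift]; exact hx.trans (le_max_left _ _))
    (by
      rw [e_lift]
      simp only [norm_smul, norm_sph, mul_one]
      rw [Real.norm_of_nonneg (Real.rpow_nonneg (norm_nonneg _) _)]
      exact (Real.rpow_le_rpow (norm_nonneg _) hx H.δ_pos.le).trans (le_max_right _ _))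
    (H.fderiv_lift_z hu a)
  rw [H.norm_tangent_sq hu] at hb
  have hg := H.chart.gram_quad g u a a
  rw [chart_toFun] at hg
  rw [hg, norm_frame_sq]
  obtain ⟨s1, s2⟩ := stretch_bounds (H.beta_nonneg (splitEquiv (k + 1) l u).1)
    (splitEquiv (k + 1) l u).1 (splitEquiv (k + 1) l a).1
  obtain ⟨t1, t2⟩ := h1 (splitEquiv (k + 1) l u).2 (splitEquiv (k + 1) l a).2 ht
  set P := (‖(splitEquiv (k + 1) l u).1‖ ^ H.δ) ^ 2
  have hP : 0 ≤ P := sq_nonneg _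
  set S := ‖stretch (H.beta (splitEquiv (k + 1) l u).1) (splitEquiv (k + 1) l u).1
    (splitEquiv (k + 1) l a).1‖ ^ 2
  set A := ‖(splitEquiv (k + 1) l a).1‖ ^ 2 + H.beta (splitEquiv (k + 1) l u).1 ^ 2 *
        ‖(splitEquiv (k + 1) l u).1‖ ^ 2 *
        inner ℝ (splitEquiv (k + 1) l u).1 (splitEquiv (k + 1) l a).1 ^ 2
  have hA : 0 ≤ A := by positivity
  set D := ‖fderiv ℝ sph (splitEquiv (k + 1) l u).2 (splitEquiv (k + 1) l a).2‖ ^ 2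
  set B := ‖(splitEquiv (k + 1) l a).2‖ ^ 2
  have hB : 0 ≤ B := sq_nonneg _
  have p1 := mul_le_mul_of_nonneg_left t1 hP
  have p2 := mul_le_mul_of_nonneg_left t2 hP
  have hPB : 0 ≤ P * B := mul_nonneg hP hB
  constructor
  · refine le_trans ?_ hb.1
    rw [mul_assoc]
    refine mul_le_mul_of_nonneg_left ?_ hc2.le
    have m1 : min 1 c1 ≤ 1 := min_le_left _ _
    have m2 : min 1 c1 ≤ c1 := min_le_right _ _
    have m0 : 0 < min 1 c1 := lt_min one_pos hc1
    have q1 : min 1 c1 / 2 * S ≤ A := by nlinarith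
    have q2 : min 1 c1 / 2 * (P * B) ≤ P * D := by nlinarith
    linarith
  · refine hb.2.trans ?_
    rw [mul_assoc]
    refine mul_le_mul_of_nonneg_left ?_ hC2.le
    have m1 : 1 ≤ max 1 C1 := le_max_left _ _
    have m2 : C1 ≤ max 1 C1 := le_max_right _ _
    have q1 : A ≤ max 1 C1 * S := by nlinarith
    have q2 : P * D ≤ max 1 C1 * (P * B) := by nlinarith
    linarith

theorem rad_mul_pow_pos {x : EuclideanSpace ℝ (Fin (k + 1))} (hx : x ≠ 0) :
    0 < H.rad x * ‖x‖ ^ k :=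
  mul_pos (lt_of_lt_of_le one_pos (H.one_le_rad x)) (pow_pos (norm_pos_iff.2 hx) _)

/-- Two-sided bounds for the volume density near the tip. -/
theorem exists_density_bounds (g : ProjMetric E) (r T : ℝ) : ∃ c C : ℝ, 0 < c ∧ 0 < C ∧
    ∀ u ∈ chartSource k l, ‖(splitEquiv (k + 1) l u).1‖ ≤ r → ‖(splitEquiv (k + 1) l u).2‖ ≤ T →
      c * (H.rad (splitEquiv (k + 1) l u).1 * ‖(splitEquiv (k + 1) l u).1‖ ^ k) ≤
        H.chart.density g u ∧
      H.chart.density g u ≤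
        C * (H.rad (splitEquiv (k + 1) l u).1 * ‖(splitEquiv (k + 1) l u).1‖ ^ k) := by
  obtain ⟨c, C, hc, hC, h⟩ := H.exists_gram_bounds g r T
  refine ⟨√(c ^ (k + 1 + l)), √(C ^ (k + 1 + l)), by positivity, by positivity, fun u hu hx ht => ?_⟩
  have hpos := H.rad_mul_pow_pos hu
  have hdet := H.det_frame (l := l) hu
  have hb := det_bounds (H.chart.gram_posDef g hu).1 hc.le (H.frame (splitEquiv (k + 1) l u).1)
    (by rw [hdet]; exact hpos.ne') (fun a => (h u hu hx ht a).1) (fun a => (h u hu hx ht a).2)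
  rw [hdet] at hb
  have hsq : ∀ b : ℝ, 0 ≤ b → √(b ^ (k + 1 + l)) *
      (H.rad (splitEquiv (k + 1) l u).1 * ‖(splitEquiv (k + 1) l u).1‖ ^ k) =
      √(b ^ (k + 1 + l) *
        (H.rad (splitEquiv (k + 1) l u).1 * ‖(splitEquiv (k + 1) l u).1‖ ^ k) ^ 2) := by
    intro b hb0
    rw [Real.sqrt_mul (pow_nonneg hb0 _), Real.sqrt_sq hpos.le]
  rw [hsq c hc.le, hsq C hC.le]
  exact ⟨Real.sqrt_le_sqrt hb.1, Real.sqrt_le_sqrt hb.2⟩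

/-- A bound for the Gram determinant of the `x`-directions near the tip. -/
theorem exists_gram_x_bound (g : ProjMetric E) (r T : ℝ) : ∃ C : ℝ, 0 < C ∧
    ∀ u ∈ chartSource k l, ‖(splitEquiv (k + 1) l u).1‖ ≤ r → ‖(splitEquiv (k + 1) l u).2‖ ≤ T →
      ((H.chart.gram g u).submatrix (Fin.castAdd l) (Fin.castAdd l)).det ≤
        C * H.rad (splitEquiv (k + 1) l u).1 ^ 2 := by
  obtain ⟨c, C, hc, hC, h⟩ := H.exists_gram_bounds g r T
  refine ⟨C ^ (k + 1), by positivity, fun u hu hx ht => ?_⟩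
  set x := (splitEquiv (k + 1) l u).1
  set G := H.chart.gram g u
  have hq : ∀ w : EuclideanSpace ℝ (Fin (k + 1)),
      w.ofLp ⬝ᵥ (G.submatrix (Fin.castAdd l) (Fin.castAdd l) *ᵥ w) =
      ((splitEquiv (k + 1) l).symm (w, 0)).ofLp ⬝ᵥ (G *ᵥ (splitEquiv (k + 1) l).symm (w, 0)) := by
    intro w
    obtain ⟨a, ha⟩ := (splitEquiv (k + 1) l).surjective (w, 0)
    have h1 : ∀ i, a (Fin.castAdd l i) = w i := fun i => by
      rw [← splitEquiv_fst, ha]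
    have h2 : ∀ i, a (Fin.natAdd (k + 1) i) = 0 := fun i => by
      rw [← splitEquiv_snd, ha]
      rfl
    rw [← ha, ContinuousLinearEquiv.symm_apply_apply]
    simp [dotProduct, Matrix.mulVec, Fin.sum_univ_add, h1, h2]
  have hf : ∀ w : EuclideanSpace ℝ (Fin (k + 1)),
      ‖H.frame x ((splitEquiv (k + 1) l).symm (w, 0))‖ ^ 2 = ‖stretch (H.beta x) x w‖ ^ 2 := by
    intro w
    rw [norm_frame_sq, ContinuousLinearEquiv.apply_symm_apply]
    simp
  have hdet : (stretch (H.beta x) x).det = H.rad x := by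
    rw [← H.rad_eq hu]
    exact det_stretch _ _
  have hb := det_bounds ((H.chart.gram_posDef g hu).1.submatrix (Fin.castAdd l)) hc.le
    (stretch (H.beta x) x)
    (by rw [hdet]; exact (lt_of_lt_of_le one_pos (H.one_le_rad x)).ne')
    (fun w => by rw [hq, ← hf]; exact (h u hu hx ht _).1)
    (fun w => by rw [hq, ← hf]; exact (h u hu hx ht _).2)
  rw [hdet] at hb
  exact hb.2

/-- The region of the parameter domain used for estimates. -/
def region (k l : ℕ) (r T : ℝ) : Set (EuclideanSpace ℝ (Fin (k + 1 + l))) :=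
  {u | (splitEquiv (k + 1) l u).1 ≠ 0 ∧ ‖(splitEquiv (k + 1) l u).1‖ < r ∧
    ‖(splitEquiv (k + 1) l u).2‖ ≤ T}

theorem measurableSet_region (r T : ℝ) : MeasurableSet (region k l r T) := by
  refine (isOpen_chartSource.measurableSet).inter (MeasurableSet.inter ?_ ?_)
  · have h : Continuous fun u => ‖(splitEquiv (k + 1) l u).1‖ := by fun_prop
    exact (isOpen_lt h continuous_const).measurableSet
  · have h : Continuous fun u => ‖(splitEquiv (k + 1) l u).2‖ := by fun_prop
    exact (isClosed_le h continuous_const).measurableSet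

/-- In polar coordinates of `ℝ^(k+1)` the Jacobian `y^k` cancels `|x|^(-k)`. What remains is `1 + δ
y^(δ-1)`, integrable at `0` because `δ > 0`, whether `δ` is larger or smaller than `1`. -/
theorem integrableOn_rad (r : ℝ) : IntegrableOn
    (fun x : EuclideanSpace ℝ (Fin (k + 1)) => H.rad x * (‖x‖ ^ k)⁻¹) (Metric.ball 0 r) := by
  have h := integrableOn_fun_norm_addHaar (volume : Measure (EuclideanSpace ℝ (Fin (k + 1))))
    (f := fun y : ℝ => (1 + H.δ * y ^ (H.δ - 1)) * (y ^ k)⁻¹) (r := r)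
  refine h.2 ?_
  rcases le_or_gt r 0 with hr | hr
  · rw [Set.Ioo_eq_empty (not_lt.2 hr)]
    exact integrableOn_empty
  have h1 : IntegrableOn (fun y : ℝ => 1 + H.δ * y ^ (H.δ - 1)) (Set.Ioo 0 r) := by
    refine Integrable.add ?_ (Integrable.const_mul ?_ _)
    · exact integrable_const _
    · exact (intervalIntegral.integrableOn_Ioo_rpow_iff hr).2 (by linarith [H.δ_pos])
  refine h1.congr_fun (fun y hy => ?_) measurableSet_Ioo
  have hy0 : y ^ k ≠ 0 := (pow_pos hy.1 k).ne'
  simp only [finrank_euclideanSpace, Fintype.card_fin, Nat.add_sub_cancel, smul_eq_mul]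
  field_simp

theorem setLIntegral_region_lt_top (r T : ℝ) :
    ∫⁻ u in region k l r T, ENNReal.ofReal (H.rad (splitEquiv (k + 1) l u).1 *
      (‖(splitEquiv (k + 1) l u).1‖ ^ k)⁻¹) < ⊤ := by
  set F : EuclideanSpace ℝ (Fin (k + 1)) × EuclideanSpace ℝ (Fin l) → ENNReal :=
    fun p => ENNReal.ofReal (H.rad p.1 * (‖p.1‖ ^ k)⁻¹)
  set S : Set (EuclideanSpace ℝ (Fin (k + 1)) × EuclideanSpace ℝ (Fin l)) :=
    Metric.ball 0 r ×ˢ Metric.closedBall 0 T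
  have hsub : region k l r T ⊆ splitEquiv (k + 1) l ⁻¹' S := fun u hu =>
    ⟨by simpa using hu.2.1, by simpa using hu.2.2⟩
  refine lt_of_le_of_lt (lintegral_mono_set hsub) ?_
  have he : MeasurableEmbedding (splitEquiv (k + 1) l) :=
    (splitEquiv (k + 1) l).toHomeomorph.measurableEmbedding
  have h1 : ∫⁻ u in splitEquiv (k + 1) l ⁻¹' S, F (splitEquiv (k + 1) l u) =
      ∫⁻ p in S, F p ∂(Measure.map (splitEquiv (k + 1) l) volume) := by
    rw [he.restrict_map, he.lintegral_map]
  change ∫⁻ u in splitEquiv (k + 1) l ⁻¹' S, F (splitEquiv (k + 1) l u) < ⊤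
  rw [h1]
  have : (Measure.map (splitEquiv (k + 1) l) volume).IsAddHaarMeasure :=
    ContinuousLinearEquiv.isAddHaarMeasure_map _ _
  have : ProperSpace (EuclideanSpace ℝ (Fin (k + 1)) × EuclideanSpace ℝ (Fin l)) :=
    FiniteDimensional.proper ℝ _
  have : LocallyCompactSpace (EuclideanSpace ℝ (Fin (k + 1)) × EuclideanSpace ℝ (Fin l)) :=
    locallyCompact_of_proper
  -- Both measures on the product are Haar measures, so they agree up to a finite factor, which is
  -- irrelevant for finiteness.
  rw [Measure.isAddLeftInvariant_eq_smul (Measure.map (splitEquiv (k + 1) l) volume)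
    (volume.prod volume), Measure.restrict_smul, lintegral_smul_measure]
  refine ENNReal.mul_lt_top (by simp) ?_
  rw [← Measure.prod_restrict]
  have hint := H.integrableOn_rad r
  have hnn : 0 ≤ᵐ[volume.restrict (Metric.ball 0 r)]
      fun x : EuclideanSpace ℝ (Fin (k + 1)) => H.rad x * (‖x‖ ^ k)⁻¹ :=
    Filter.Eventually.of_forall fun x => mul_nonneg (zero_le_one.trans (H.one_le_rad x)) (by positivity)
  have hfin := (hasFiniteIntegral_iff_ofReal hnn).1 hint.2
  have hm : AEMeasurable (fun x : EuclideanSpace ℝ (Fin (k + 1)) =>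
      ENNReal.ofReal (H.rad x * (‖x‖ ^ k)⁻¹)) (volume.restrict (Metric.ball 0 r)) :=
    hint.1.aemeasurable.ennreal_ofReal
  have h2 := lintegral_prod_mul (ν := volume.restrict (Metric.closedBall (0 : EuclideanSpace ℝ (Fin l)) T))
    hm (g := fun _ => 1) aemeasurable_const
  simp only [mul_one, lintegral_const, one_mul, Measure.restrict_apply_univ] at h2
  rw [show ∫⁻ p, F p ∂((volume.restrict (Metric.ball 0 r)).prod
    (volume.restrict (Metric.closedBall 0 T))) = _ from h2]
  exact ENNReal.mul_lt_top hfin measure_closedBall_lt_top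

end Horn

/-! ### Square integrability of pulled back forms -/

namespace LocalParam

variable {E : Type*} [NormedAddCommGroup E] [NormedSpace ℝ E] {M : Set (ℙ ℝ E)} {d k : ℕ}

theorem setLIntegral_image [FiniteDimensional ℝ E] (ψ : LocalParam M d) (g : ProjMetric E)
    (θ : ProjForm E k) {A : Set (EuclideanSpace ℝ (Fin d))} (hA : MeasurableSet A)
    (hsub : A ⊆ ψ.source) :
    ∫⁻ P in ψ.toM '' (Subtype.val ⁻¹' A), ENNReal.ofReal (pointInner d g θ θ P) ∂(volM M d g) =
      ∫⁻ u in A, ENNReal.ofReal (ψ.density g u *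
        formInner (ψ.gram g u) (ψ.pull θ u) (ψ.pull θ u)) := by
  set S : Set M := ψ.toM '' (Subtype.val ⁻¹' A)
  have hS : MeasurableSet S :=
    ψ.toM_measurableEmbedding.measurableSet_image.2 (measurable_subtype_coe hA)
  have hr : (volM M d g).restrict S = (ψ.vol g).restrict S := by
    rw [← ψ.volM_restrict g, Measure.restrict_restrict hS,
      Set.inter_eq_self_of_subset_left (Set.image_subset_range _ _)]
  rw [hr, ← lintegral_indicator hS, ψ.lintegral_vol g _
    (A.indicator fun u => ENNReal.ofReal (formInner (ψ.gram g u) (ψ.pull θ u) (ψ.pull θ u)))]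
  · have : (fun u => ENNReal.ofReal (ψ.density g u) * A.indicator
        (fun u => ENNReal.ofReal (formInner (ψ.gram g u) (ψ.pull θ u) (ψ.pull θ u))) u) =
        A.indicator fun u => ENNReal.ofReal (ψ.density g u *
          formInner (ψ.gram g u) (ψ.pull θ u) (ψ.pull θ u)) := by
      funext u
      by_cases hu : u ∈ A
      · simp only [Set.indicator_of_mem hu, ENNReal.ofReal_mul (Real.sqrt_nonneg _),
          LocalParam.density]
      · simp only [Set.indicator_of_notMem hu, mul_zero]
    rw [this, lintegral_indicator hA, Measure.restrict_restrict hA,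
      Set.inter_eq_self_of_subset_left hsub]
  · intro u
    by_cases hu : (u : EuclideanSpace ℝ (Fin d)) ∈ A
    · rw [Set.indicator_of_mem (s := S) ⟨u, hu, rfl⟩, Set.indicator_of_mem hu, pointInner_toM]
    · rw [Set.indicator_of_notMem hu, Set.indicator_of_notMem]
      rintro ⟨u', hu', h⟩
      rw [ψ.toM_injective h] at hu'
      exact hu hu'

end LocalParam

namespace Horn

variable {E : Type*} [NormedAddCommGroup E] [NormedSpace ℝ E] {k l : ℕ} (H : Horn E k l)

/-- The projection `(x, t) ↦ x`. -/
def fstCLM (k l : ℕ) : EuclideanSpace ℝ (Fin (k + 1 + l)) →L[ℝ] EuclideanSpace ℝ (Fin (k + 1)) :=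
  (ContinuousLinearMap.fst ℝ _ _) ∘L (splitEquiv (k + 1) l).toContinuousLinearMap

theorem fstCLM_apply (u : EuclideanSpace ℝ (Fin (k + 1 + l))) :
    fstCLM k l u = (splitEquiv (k + 1) l u).1 := rfl

theorem mem_X_dom {v : E} (hv : v ≠ 0) (hM : Projectivization.mk ℝ v hv ∈ H.M) : v ∈ H.X.dom :=
  ((H.mem_iff v hv).1 hM).1

theorem X_ne_zero {v : E} (hv : v ≠ 0) (hM : Projectivization.mk ℝ v hv ∈ H.M) :
    H.X.toFun v ≠ 0 :=
  smul_ne_zero (inv_ne_zero ((H.mem_iff v hv).1 hM).1) ((H.mem_iff v hv).1 hM).2.1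

theorem pull_X_form {j : ℕ} (α : EuclideanSpace ℝ (Fin (k + 1)) →
      EuclideanSpace ℝ (Fin (k + 1)) [⋀^Fin j]→L[ℝ] ℝ)
    {u : EuclideanSpace ℝ (Fin (k + 1 + l))} (hu : u ∈ chartSource k l) :
    H.chart.pull (H.X.form α) u = (α (fstCLM k l u)).compContinuousLinearMap (fstCLM k l) := by
  have h := H.X.pull_form α H.chart (u := u) hu (H.lift_mem_chartDom hu).1
  have h2 : (fun u => H.X.toFun (H.chart.toFun u)) = fstCLM k l := funext H.X_lift
  rw [h2, (fstCLM k l).fderiv] at h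
  rw [h]
  congr 2
  exact congrFun h2 u

theorem pull_X_form_eq_zero {j d : ℕ} {α : EuclideanSpace ℝ (Fin (k + 1)) →
      EuclideanSpace ℝ (Fin (k + 1)) [⋀^Fin j]→L[ℝ] ℝ} (ψ : LocalParam H.M d)
    {u : EuclideanSpace ℝ (Fin d)} (hu : u ∈ ψ.source) (h : α (H.X.toFun (ψ.toFun u)) = 0) :
    ψ.pull (H.X.form α) u = 0 := by
  rw [H.X.pull_form α ψ hu (H.mem_X_dom (ψ.ne_zero u hu) (ψ.mem u hu)), h]
  rfl

/-- The pointwise norm of a form pulled back by `x / z`. -/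
theorem exists_form_bound (g : ProjMetric E) (r T : ℝ) (j : ℕ) : ∃ C : ℝ, 0 ≤ C ∧
    ∀ u ∈ chartSource k l, ‖(splitEquiv (k + 1) l u).1‖ ≤ r → ‖(splitEquiv (k + 1) l u).2‖ ≤ T →
      ∀ β : EuclideanSpace ℝ (Fin (k + 1)) [⋀^Fin j]→L[ℝ] ℝ,
        H.chart.density g u * formInner (H.chart.gram g u)
          (β.compContinuousLinearMap (fstCLM k l)) (β.compContinuousLinearMap (fstCLM k l)) ≤
        C * (H.rad (splitEquiv (k + 1) l u).1 * ‖(splitEquiv (k + 1) l u).1‖ ^ k * ‖β‖ ^ 2) := by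
  obtain ⟨c, _, hc, _, h⟩ := H.exists_gram_bounds g r T
  obtain ⟨_, C, _, hC, h'⟩ := H.exists_density_bounds g r T
  refine ⟨C * ((k + 1 + l : ℕ) ^ j * ((√c)⁻¹ ^ j) ^ 2), by positivity, fun u hu hx ht β => ?_⟩
  have h1 := (formInner_self_bounds _ (H.chart.gram_posDef g (u := u) hu)
    (β.compContinuousLinearMap (fstCLM k l))).2 (‖β‖ * (√c)⁻¹ ^ j) (by
      intro w hw
      rw [ContinuousAlternatingMap.compContinuousLinearMap_apply]
      refine (β.le_opNorm _).trans ?_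
      refine mul_le_mul_of_nonneg_left ?_ (norm_nonneg _)
      calc ∏ a, ‖(fstCLM k l ∘ w) a‖ ≤ ∏ _a : Fin j, (√c)⁻¹ := by
            -- A unit vector for the metric has `x`-component of Euclidean length at most
            -- `c^(-1/2)`, since `frame` does not shorten `x`-components.
            refine Finset.prod_le_prod (fun _ _ => norm_nonneg _) fun a _ => ?_
            have h2 := (h u hu hx ht (w a)).1
            rw [hw a] at h2
            have h3 := H.norm_le_norm_frame (splitEquiv (k + 1) l u).1 (w a)
            rw [Function.comp_apply, fstCLM_apply]
            refine (sq_le_sq₀ (norm_nonneg _) (by positivity)).1 ?_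
            rw [inv_pow, Real.sq_sqrt hc.le, ← one_div, le_div_iff₀ hc]
            nlinarith
        _ = _ := by simp)
  have h2 := (h' u hu hx ht).2
  have h0 := (formInner_self_bounds _ (H.chart.gram_posDef g (u := u) hu)
    (β.compContinuousLinearMap (fstCLM k l))).1
  refine (mul_le_mul h2 h1 h0 (mul_nonneg hC.le (H.rad_mul_pow_pos hu).le)).trans (le_of_eq ?_)
  ring

/-- Isometries act transitively on the unit sphere, so the caps `|unsph| < 1` moved by isometries
cover it; compactness leaves finitely many. -/
theorem exists_sphere_cover (l : ℕ) : ∃ s : Finset (EuclideanSpace ℝ (Fin (l + 1)) ≃ₗᵢ[ℝ]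
    EuclideanSpace ℝ (Fin (l + 1))), ∀ y : EuclideanSpace ℝ (Fin (l + 1)), y ≠ 0 →
      ∃ O ∈ s, 0 < O y 0 ∧ ‖unsph (O y)‖ ≤ 1 := by
  let V : (EuclideanSpace ℝ (Fin (l + 1)) ≃ₗᵢ[ℝ] EuclideanSpace ℝ (Fin (l + 1))) →
      Set (EuclideanSpace ℝ (Fin (l + 1))) := fun O =>
    O ⁻¹' ({y | 0 < y 0} ∩ unsph ⁻¹' Metric.ball 0 1)
  have hV : ∀ O, IsOpen (V O) := fun O => by
    refine IsOpen.preimage O.continuous ?_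
    have h0 : IsOpen {y : EuclideanSpace ℝ (Fin (l + 1)) | 0 < y 0} :=
      isOpen_lt continuous_const (by fun_prop)
    exact (contDiffOn_unsph.continuousOn.mono fun y (hy : 0 < y 0) => hy.ne').isOpen_inter_preimage
      h0 Metric.isOpen_ball
  have hcov : Metric.sphere (0 : EuclideanSpace ℝ (Fin (l + 1))) 1 ⊆ ⋃ O, V O := by
    intro y hy
    have hn : ‖y‖ = ‖EuclideanSpace.single (0 : Fin (l + 1)) (1 : ℝ)‖ := by simpa using hy
    -- The reflection in the hyperplane orthogonal to `y - e₀` exchanges the unit vectors `y` and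
    -- `e₀`.
    refine Set.mem_iUnion.2 ⟨(ℝ ∙ (y - EuclideanSpace.single 0 1))ᗮ.reflection, ?_⟩
    simp only [V, Set.mem_preimage, Submodule.reflection_sub hn]
    refine ⟨by simp, ?_⟩
    have : unsph (EuclideanSpace.single (0 : Fin (l + 1)) (1 : ℝ)) = 0 := by
      ext i
      simp [unsph]
    simp [this]
  obtain ⟨s, hs⟩ := (isCompact_sphere _ _).elim_finite_subcover V hV hcov
  refine ⟨s, fun y hy => ?_⟩
  have hy' : ‖y‖⁻¹ • y ∈ Metric.sphere (0 : EuclideanSpace ℝ (Fin (l + 1))) 1 := by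
    simp [norm_smul, hy]
  obtain ⟨O, hO, h1, h2⟩ := Set.mem_iUnion₂.1 (hs hy')
  have hp : 0 < ‖y‖ := norm_pos_iff.2 hy
  refine ⟨O, hO, ?_, ?_⟩
  · simp only [map_smul, Set.mem_ofPred_eq, PiLp.smul_apply, smul_eq_mul] at h1
    exact (mul_pos_iff_of_pos_left (inv_pos.2 hp)).1 h1
  · rw [Set.mem_preimage, map_smul, unsph_smul _ (inv_ne_zero hp.ne'), mem_ball_zero_iff] at h2
    exact h2.le

theorem rotate_X (O : EuclideanSpace ℝ (Fin (l + 1)) ≃ₗᵢ[ℝ] EuclideanSpace ℝ (Fin (l + 1))) :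
    (H.rotate O).X = H.X := rfl

/-- Forms pulled back by `x / z` live on whole link spheres. Finitely many rotated charts with `|t|
≤ 1` cover the horn, with the same finite set for every radius `r`. -/
theorem exists_chart_cover : ∃ s : Finset (EuclideanSpace ℝ (Fin (l + 1)) ≃ₗᵢ[ℝ]
    EuclideanSpace ℝ (Fin (l + 1))), ∀ (r : ℝ) (P : H.M) (v : E) (hv : v ≠ 0),
      Projectivization.mk ℝ v hv = P → ‖H.X.toFun v‖ < r →
      ∃ O ∈ s, P ∈ (H.rotate O).chart.toM '' (Subtype.val ⁻¹' region k l r 1) := by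
  obtain ⟨s, hs⟩ := exists_sphere_cover l
  refine ⟨s, fun r P v hv hP hr => ?_⟩
  have hM : Projectivization.mk ℝ v hv ∈ H.M := by rw [hP]; exact P.2
  obtain ⟨h1, h2, h3⟩ := (H.mem_iff v hv).1 hM
  have hy : (H.e v).2.2⁻¹ • (H.e v).2.1 ≠ 0 := by
    rw [← norm_pos_iff, h3]
    exact Real.rpow_pos_of_pos (norm_pos_iff.2 (smul_ne_zero (inv_ne_zero h1) h2)) _
  obtain ⟨O, hO, h4, h5⟩ := hs _ hy
  rw [map_smul] at h4 h5
  rw [unsph_smul _ (inv_ne_zero h1)] at h5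
  have hd : v ∈ (H.rotate O).chartDom := ⟨h1, h2, h4⟩
  obtain ⟨u, hu, hu'⟩ := (H.rotate O).exists_chart_eq hd hv hM
  refine ⟨O, hO, u, ?_, hu.trans (Subtype.ext hP)⟩
  have hR : (H.rotate O).R.toFun v =
    (splitEquiv (k + 1) l).symm (H.X.toFun v, unsph (O (H.e v).2.1)) := rfl
  rw [Set.mem_preimage, hu', hR, region, Set.mem_ofPred_eq, ContinuousLinearEquiv.apply_symm_apply]
  exact ⟨H.X_ne_zero hv hM, hr, h5⟩

variable [FiniteDimensional ℝ E]

/-- In each of the finitely many charts, the square norm times the density is at most a constant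
times `rad |x|^k (|x|^(-k))² = rad |x|^(-k)`, which is integrable. -/
theorem isL2_X_form (g : ProjMetric E) {j : ℕ} {α : EuclideanSpace ℝ (Fin (k + 1)) →
      EuclideanSpace ℝ (Fin (k + 1)) [⋀^Fin j]→L[ℝ] ℝ} {r K : ℝ}
    (hc : ContinuousOn α {0}ᶜ) (hb : ∀ x, x ≠ 0 → ‖α x‖ ≤ K * (‖x‖ ^ k)⁻¹)
    (hs : ∀ x, r ≤ ‖x‖ → α x = 0) : IsL2 H.M (k + 1 + l) g (H.X.form α) := by
  refine ⟨H.X.aestronglyMeasurable_form hc fun v hv hM _ => H.X_ne_zero hv hM, ?_⟩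
  obtain ⟨s, hcov⟩ := H.exists_chart_cover
  set F : H.M → ENNReal := fun P =>
    ENNReal.ofReal (pointInner (k + 1 + l) g (H.X.form α) (H.X.form α) P)
  set S : (EuclideanSpace ℝ (Fin (l + 1)) ≃ₗᵢ[ℝ] EuclideanSpace ℝ (Fin (l + 1))) → Set H.M :=
    fun O => (H.rotate O).chart.toM '' (Subtype.val ⁻¹' region k l r 1)
  have hzero : ∀ P ∉ ⋃ O ∈ s, S O, F P = 0 := by
    intro P hP
    refine ENNReal.ofReal_eq_zero.2 (le_of_eq (pointInner_eq_zero g _ _ fun ψ u hu => Or.inl ?_))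
    refine H.pull_X_form_eq_zero ψ u.2 (hs _ ?_)
    by_contra! hlt
    obtain ⟨O, hO, hmem⟩ := hcov r P _ (ψ.ne_zero u u.2) (congrArg Subtype.val hu) hlt
    exact hP (Set.mem_biUnion hO hmem)
  have hone : ∀ O, ∫⁻ P in S O, F P ∂(volM H.M (k + 1 + l) g) < ⊤ := by
    intro O
    refine lt_of_eq_of_lt ((H.rotate O).chart.setLIntegral_image g (H.X.form α)
      (measurableSet_region r 1) fun u hu => hu.1) ?_
    obtain ⟨C, hC, hbd⟩ := (H.rotate O).exists_form_bound g r 1 j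
    refine lt_of_le_of_lt (setLIntegral_mono' (measurableSet_region r 1) (g := fun u =>
      ENNReal.ofReal (C * K ^ 2) * ENNReal.ofReal (H.rad (splitEquiv (k + 1) l u).1 *
      (‖(splitEquiv (k + 1) l u).1‖ ^ k)⁻¹)) fun u hu => ?_) ?_
    · rw [← ENNReal.ofReal_mul (by positivity)]
      refine ENNReal.ofReal_le_ofReal ?_
      have h1 := (H.rotate O).pull_X_form α (u := u) hu.1
      rw [rotate_X] at h1
      rw [h1]
      refine (hbd u hu.1 hu.2.1.le hu.2.2 _).trans ?_
      rw [mul_assoc C (K ^ 2)]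
      refine mul_le_mul_of_nonneg_left ?_ hC
      have hx : 0 < ‖(splitEquiv (k + 1) l u).1‖ ^ k := pow_pos (norm_pos_iff.2 hu.1) _
      have h2 := pow_le_pow_left₀ (norm_nonneg _) (hb _ hu.1) 2
      have h3 : 0 ≤ H.rad (splitEquiv (k + 1) l u).1 * ‖(splitEquiv (k + 1) l u).1‖ ^ k :=
        (H.rad_mul_pow_pos hu.1).le
      refine (mul_le_mul_of_nonneg_left h2 h3).trans (le_of_eq ?_)
      field_simp
    · rw [lintegral_const_mul' _ _ ENNReal.ofReal_ne_top]
      exact ENNReal.mul_lt_top ENNReal.ofReal_lt_top (H.setLIntegral_region_lt_top r 1)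
  rw [← setLIntegral_eq_of_support_subset (s := ⋃ O ∈ s, S O) fun P hP => by
    by_contra h
    exact hP (hzero P h)]
  rw [show ⋃ O ∈ s, S O = ⋃ O : s, S O from Set.biUnion_eq_iUnion _ fun O _ => S O]
  refine lt_of_le_of_lt (lintegral_iUnion_le _ _) ?_
  rw [tsum_fintype]
  exact ENNReal.sum_lt_top.2 fun O _ => hone O

end Horn

/-! ### Test forms and the maximal extension -/

namespace Horn

variable {E : Type*} [NormedAddCommGroup E] [NormedSpace ℝ E] {k l : ℕ} (H : Horn E k l)

theorem affPt_ne_zero (p : EuclideanSpace ℝ (Fin (k + 1)) × EuclideanSpace ℝ (Fin (l + 1))) :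
    H.e.symm (p.1, p.2, 1) ≠ 0 := fun h => by
  have := congrArg (fun v => (H.e v).2.2) h
  simp at this

/-- The point with affine coordinates `(x, y)`. -/
def affPt (p : EuclideanSpace ℝ (Fin (k + 1)) × EuclideanSpace ℝ (Fin (l + 1))) : ℙ ℝ E :=
  Projectivization.mk ℝ (H.e.symm (p.1, p.2, 1)) (H.affPt_ne_zero p)

theorem continuous_affPt : Continuous H.affPt := by
  have h : Continuous fun p : EuclideanSpace ℝ (Fin (k + 1)) × EuclideanSpace ℝ (Fin (l + 1)) =>
      H.e.symm (p.1, p.2, 1) := H.e.symm.continuous.comp (by fun_prop)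
  exact (continuous_mk (E := E)).comp (h.subtype_mk H.affPt_ne_zero)

theorem mk_eq_affPt {v : E} (hv : v ≠ 0) (hz : (H.e v).2.2 ≠ 0) :
    Projectivization.mk ℝ v hv = H.affPt (H.X.toFun v, (H.e v).2.2⁻¹ • (H.e v).2.1) := by
  rw [affPt, Projectivization.mk_eq_mk_iff']
  refine ⟨(H.e v).2.2, H.e.injective ?_⟩
  rw [map_smul, ContinuousLinearEquiv.apply_symm_apply]
  refine Prod.ext ?_ (Prod.ext ?_ ?_)
  · exact smul_inv_smul₀ hz _
  · exact smul_inv_smul₀ hz _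
  · simp

theorem affPt_mem_iff (p : EuclideanSpace ℝ (Fin (k + 1)) × EuclideanSpace ℝ (Fin (l + 1))) :
    H.affPt p ∈ H.M ↔ p.1 ≠ 0 ∧ ‖p.2‖ = ‖p.1‖ ^ H.δ := by
  rw [affPt, H.mem_iff, ContinuousLinearEquiv.apply_symm_apply]
  simp

/-- The tip of the horn. -/
def tip : ℙ ℝ E := H.affPt 0

/-- A neighbourhood of the tip contains all points of `M` with small `x / z`. -/
theorem exists_radius {U : Set (ℙ ℝ E)} (hU : U ∈ 𝓝 H.tip) : ∃ r : ℝ, 0 < r ∧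
    ∀ v (hv : v ≠ 0), Projectivization.mk ℝ v hv ∈ H.M → ‖H.X.toFun v‖ < r →
      Projectivization.mk ℝ v hv ∈ U := by
  obtain ⟨ε, hε, h⟩ := Metric.mem_nhds_iff.1 (H.continuous_affPt.continuousAt.preimage_mem_nhds hU)
  -- The second entry makes `|y/z| = |x/z|^δ` smaller than `ε`.
  refine ⟨min ε (ε ^ H.δ⁻¹), by positivity, fun v hv hM hr => ?_⟩
  obtain ⟨h1, -, h3⟩ := (H.mem_iff v hv).1 hM
  rw [H.mk_eq_affPt hv h1]
  refine h ?_
  rw [mem_ball_zero_iff, Prod.norm_def]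
  refine max_lt (hr.trans_le (min_le_left _ _)) ?_
  rw [h3]
  have h4 := Real.rpow_lt_rpow (norm_nonneg _) (hr.trans_le (min_le_right _ _)) H.δ_pos
  rwa [← Real.rpow_mul hε.le, inv_mul_cancel₀ H.δ_pos.ne', Real.rpow_one] at h4

/-- Compact subsets of `M` stay away from the tip. -/
theorem exists_norm_lower_bound {K : Set (ℙ ℝ E)} (hK : IsCompact K) (hKM : K ⊆ H.M) :
    ∃ c : ℝ, 0 < c ∧ ∀ v (hv : v ≠ 0), Projectivization.mk ℝ v hv ∈ K → c < ‖H.X.toFun v‖ := by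
  let V : ℕ → Set (ℙ ℝ E) := fun j =>
    {P | ∃ (v : E) (hv : v ≠ 0), Projectivization.mk ℝ v hv = P ∧ v ∈ H.X.dom ∧
      ((j : ℝ) + 1)⁻¹ < ‖H.X.toFun v‖}
  have hmk : ∀ j v (hv : v ≠ 0), Projectivization.mk ℝ v hv ∈ V j ↔
      v ∈ H.X.dom ∧ ((j : ℝ) + 1)⁻¹ < ‖H.X.toFun v‖ := by
    intro j v hv
    refine ⟨?_, fun h => ⟨v, hv, rfl, h⟩⟩
    rintro ⟨w, hw, h, h1, h2⟩
    rw [Projectivization.mk_eq_mk_iff'] at h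
    obtain ⟨c, rfl⟩ := h
    have hc : c ≠ 0 := fun h0 => hw (by rw [h0, zero_smul])
    have hv' : v ∈ H.X.dom := (H.X.smul_mem_iff hc).1 h1
    exact ⟨hv', by rwa [H.X.map_smul c v hc hv'] at h2⟩
  have hV : ∀ j, IsOpen (V j) := fun j => by
    rw [isOpen_iff_mk]
    have h1 : IsOpen (H.X.dom ∩ (fun v => ‖H.X.toFun v‖) ⁻¹' Set.Ioi ((j : ℝ) + 1)⁻¹) :=
      H.X.smooth.continuousOn.norm.isOpen_inter_preimage H.X.isOpen_dom isOpen_Ioi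
    convert h1.preimage (continuous_subtype_val (p := fun v : E => v ≠ 0)) using 1
    ext v
    exact hmk j v.1 v.2
  have hcov : K ⊆ ⋃ j, V j := by
    intro P hP
    induction P using Projectivization.ind with
    | h v hv =>
      have hpos : 0 < ‖H.X.toFun v‖ := norm_pos_iff.2 (H.X_ne_zero hv (hKM hP))
      obtain ⟨j, hj⟩ := exists_nat_one_div_lt hpos
      rw [one_div] at hj
      exact Set.mem_iUnion.2 ⟨j, (hmk j v hv).2 ⟨H.mem_X_dom hv (hKM hP), hj⟩⟩
  have hmono : Monotone V := by
    rintro i j hij P ⟨v, hv, h1, h2, h3⟩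
    refine ⟨v, hv, h1, h2, lt_of_le_of_lt ?_ h3⟩
    have : (i : ℝ) ≤ j := by exact_mod_cast hij
    exact inv_anti₀ (by positivity) (by linarith)
  obtain ⟨j, hj⟩ := hK.elim_directed_cover V hV hcov hmono.directed_le
  exact ⟨((j : ℝ) + 1)⁻¹, by positivity, fun v hv hP => ((hmk j v hv).1 (hj hP)).2⟩

/-- Bounds on `|x|` from both sides bound `|y| = |x|^δ` as well, so the part of the horn over such a
shell is compact and contained in `M`. -/
theorem isTestForm_X_form {j d : ℕ} {α : EuclideanSpace ℝ (Fin (k + 1)) →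
      EuclideanSpace ℝ (Fin (k + 1)) [⋀^Fin j]→L[ℝ] ℝ} {c r : ℝ} (hα : ContDiffOn ℝ ∞ α {0}ᶜ)
    (hc : 0 < c) (h1 : ∀ x, ‖x‖ < c → α x = 0) (h2 : ∀ x, r < ‖x‖ → α x = 0) :
    IsTestForm H.M d (H.X.form α) := by
  refine ⟨H.X.contDiffOn_pull_form hα (fun v hv => H.mem_X_dom hv) fun v hv => H.X_ne_zero hv, ?_⟩
  set S : Set (EuclideanSpace ℝ (Fin (k + 1)) × EuclideanSpace ℝ (Fin (l + 1))) :=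
    {p | c ≤ ‖p.1‖ ∧ ‖p.1‖ ≤ r ∧ ‖p.2‖ = ‖p.1‖ ^ H.δ}
  have hS : IsCompact S := by
    refine Metric.isCompact_of_isClosed_isBounded ?_ ?_
    · refine (isClosed_le continuous_const continuous_fst.norm).inter
        ((isClosed_le continuous_fst.norm continuous_const).inter
          (isClosed_eq continuous_snd.norm ?_))
      exact continuous_fst.norm.rpow_const fun p => Or.inr H.δ_pos.le
    · refine (Metric.isBounded_closedBall (x := 0) (r := max r (r ^ H.δ))).subset ?_
      rintro p ⟨-, p2, p3⟩
      rw [mem_closedBall_zero_iff, Prod.norm_def]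
      refine max_le_max p2 ?_
      rw [p3]
      exact Real.rpow_le_rpow (norm_nonneg _) p2 H.δ_pos.le
  refine ⟨H.affPt '' S, hS.image H.continuous_affPt, ?_, ?_⟩
  · rintro _ ⟨p, ⟨p1, -, p3⟩, rfl⟩
    rw [affPt_mem_iff]
    exact ⟨norm_pos_iff.1 (hc.trans_le p1), p3⟩
  · intro ψ u hu
    refine H.pull_X_form_eq_zero ψ u.2 ?_
    by_contra hne
    refine hu ?_
    have hv := ψ.ne_zero u u.2
    have hM := ψ.mem u u.2
    obtain ⟨m1, -, m3⟩ := (H.mem_iff _ hv).1 hM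
    refine ⟨(H.X.toFun (ψ.toFun u), (H.e (ψ.toFun u)).2.2⁻¹ • (H.e (ψ.toFun u)).2.1), ⟨?_, ?_, m3⟩,
      (H.mk_eq_affPt hv m1).symm⟩
    · by_contra! h
      exact hne (h1 _ h)
    · by_contra! h
      exact hne (h2 _ h)

theorem isExtDeriv_X_form {j d : ℕ} {α : EuclideanSpace ℝ (Fin (k + 1)) →
      EuclideanSpace ℝ (Fin (k + 1)) [⋀^Fin j]→L[ℝ] ℝ} (hα : ContDiffOn ℝ ∞ α {0}ᶜ) :
    IsExtDeriv H.M d (H.X.form α) (H.X.form (extDeriv α)) :=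
  H.X.isExtDeriv_form (S := {0}ᶜ)
    (fun _ hx => (hα.contDiffAt (isOpen_compl_singleton.mem_nhds hx)).differentiableAt (by simp))
    (fun _ hv => H.mem_X_dom hv) fun _ hv => H.X_ne_zero hv

/-- A smooth square integrable form which is pulled back by `x / z` and vanishes for large `x / z`
is in the domain of `d_max`. -/
theorem isDMax_X_form (g : ProjMetric E) {j d : ℕ} {α : EuclideanSpace ℝ (Fin (k + 1)) →
      EuclideanSpace ℝ (Fin (k + 1)) [⋀^Fin j]→L[ℝ] ℝ} {r : ℝ} (hα : ContDiffOn ℝ ∞ α {0}ᶜ)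
    (hr : ∀ x, r < ‖x‖ → α x = 0) (h1 : IsL2 H.M d g (H.X.form α))
    (h2 : IsL2 H.M d g (H.X.form (extDeriv α))) :
    IsDMax H.M d g (H.X.form α) (H.X.form (extDeriv α)) := by
  refine ⟨h1, h2, ?_⟩
  rintro η ζ ⟨⟨-, K, hK, hKM, hη⟩, ⟨-, K', hK', hKM', hζ⟩, had⟩
  obtain ⟨c, hc, hcK⟩ := H.exists_norm_lower_bound (hK.union hK') (Set.union_subset hKM hKM')
  -- The forms `η` and `ζ` vanish for `|x/z| ≤ c`. Multiplying `α` by `1 - f` changes it only there,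
  -- so the pairings are unaffected while `α'` becomes a test form; the adjoint identity for test
  -- forms then applies.
  let f : ContDiffBump (0 : EuclideanSpace ℝ (Fin (k + 1))) := ⟨c / 2, c, by linarith, by linarith⟩
  set α' := fun x => (1 - f x) • α x
  have hα' : ContDiffOn ℝ ∞ α' {0}ᶜ := (contDiff_const.sub f.contDiff).contDiffOn.smul hα
  have hloc : ∀ x, c < ‖x‖ → α' =ᶠ[𝓝 x] α := by
    intro x hx
    filter_upwards [(isOpen_lt continuous_const continuous_norm).mem_nhds hx] with y hy
    have : f y = 0 := f.zero_of_le_dist (by simpa using (le_of_lt hy))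
    simp [α', this]
  have ht : IsTestForm H.M d (H.X.form α') := by
    refine H.isTestForm_X_form (c := c / 2) (r := r) hα' (by linarith) (fun x hx => ?_) fun x hx => ?_
    · have : f x = 1 := f.one_of_mem_closedBall (by simpa using hx.le)
      simp [α', this]
    · simp [α', hr x hx]
  have h := had _ _ ht (H.isExtDeriv_X_form hα')
  have key : ∀ (ψ : LocalParam H.M d) (u : ψ.source), (ψ.toM u : ℙ ℝ E) ∈ K ∪ K' →
      α' =ᶠ[𝓝 (H.X.toFun (ψ.toFun u))] α := fun ψ u hu => hloc _ (hcK _ (ψ.ne_zero u u.2) hu)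
  have e1 : l2Inner H.M d g (H.X.form (extDeriv α)) η =
      l2Inner H.M d g (H.X.form (extDeriv α')) η := by
    refine integral_congr_ae (Filter.Eventually.of_forall fun P => pointInner_congr g ?_)
    rintro ψ u rfl
    by_cases hu : (ψ.toM u : ℙ ℝ E) ∈ K
    · left
      have hd := H.mem_X_dom (ψ.ne_zero u u.2) (ψ.mem u u.2)
      rw [H.X.pull_form _ ψ u.2 hd, H.X.pull_form _ ψ u.2 hd, (key ψ u (Or.inl hu)).extDeriv_eq]
    · exact Or.inr (hη ψ u hu)
  have e2 : l2Inner H.M d g (H.X.form α) ζ = l2Inner H.M d g (H.X.form α') ζ := by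
    refine integral_congr_ae (Filter.Eventually.of_forall fun P => pointInner_congr g ?_)
    rintro ψ u rfl
    by_cases hu : (ψ.toM u : ℙ ℝ E) ∈ K'
    · left
      have hd := H.mem_X_dom (ψ.ne_zero u u.2) (ψ.mem u u.2)
      rw [H.X.pull_form _ ψ u.2 hd, H.X.pull_form _ ψ u.2 hd, (key ψ u (Or.inr hu)).eq_of_nhds]
    · exact Or.inr (hζ ψ u hu)
  rw [e1, e2, h]

theorem supportedIn_X_form {j d : ℕ} {α : EuclideanSpace ℝ (Fin (k + 1)) →
      EuclideanSpace ℝ (Fin (k + 1)) [⋀^Fin j]→L[ℝ] ℝ} {r : ℝ} {U : Set (ℙ ℝ E)}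
    (hU : ∀ v (hv : v ≠ 0), Projectivization.mk ℝ v hv ∈ H.M → ‖H.X.toFun v‖ < r →
      Projectivization.mk ℝ v hv ∈ U) (hr : ∀ x, r ≤ ‖x‖ → α x = 0) :
    SupportedIn H.M d U (H.X.form α) := by
  intro ψ u hu
  refine H.pull_X_form_eq_zero ψ u.2 (hr _ ?_)
  by_contra! h
  exact hu (hU _ (ψ.ne_zero u u.2) (ψ.mem u u.2) h)

end Horn

/-! ### The radial form -/

/-- A radial cutoff function. -/
def cutoff {n : ℕ} (a : ℝ) (x : EuclideanSpace ℝ (Fin n)) : ℝ :=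
  Real.smoothTransition (2 - a * ‖x‖ ^ 2)

/-! ### Radial cutoffs. -/

section Cutoff

variable {n : ℕ} {a : ℝ}

theorem contDiff_cutoff : ContDiff ℝ ∞ (cutoff (n := n) a) :=
  Real.smoothTransition.contDiff.comp (contDiff_const.sub (contDiff_const.mul (contDiff_norm_sq ℝ)))

theorem cutoff_eq_one {x : EuclideanSpace ℝ (Fin n)} (h : a * ‖x‖ ^ 2 ≤ 1) : cutoff a x = 1 :=
  Real.smoothTransition.one_of_one_le (by linarith)

theorem cutoff_eq_zero {x : EuclideanSpace ℝ (Fin n)} (h : 2 ≤ a * ‖x‖ ^ 2) : cutoff a x = 0 :=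
  Real.smoothTransition.zero_of_nonpos (by linarith)

/-- The radial derivative is the only derivative of the cutoff that enters the boundary term; its
sign is explicit here, `smoothTransition` being increasing. -/
theorem fderiv_cutoff_self (x : EuclideanSpace ℝ (Fin n)) :
    fderiv ℝ (cutoff a) x x =
      -(2 * a * ‖x‖ ^ 2 * deriv Real.smoothTransition (2 - a * ‖x‖ ^ 2)) := by
  have h1 : HasFDerivAt (fun x : EuclideanSpace ℝ (Fin n) => 2 - a * ‖x‖ ^ 2) _ x :=
    (((hasFDerivAt_id x).norm_sq).const_mul a).const_sub 2
  have h2 : HasDerivAt Real.smoothTransition _ (2 - a * ‖x‖ ^ 2) :=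
    (Real.smoothTransition.contDiff.differentiable (n := 1) one_ne_zero _).hasDerivAt
  have h3 : fderiv ℝ (cutoff a) x = _ := (h2.comp_hasFDerivAt x h1).fderiv
  rw [h3]
  simp only [smul_apply, neg_apply, ContinuousLinearMap.comp_apply,
    smul_eq_mul, id, nsmul_eq_mul, ContinuousLinearMap.id_apply, innerSL_apply_apply,
    real_inner_self_eq_norm_sq]
  push_cast
  ring

end Cutoff


section Radial

variable {k : ℕ}

/-- Laplace expansion along the row `x`: only the minor omitting column `i` is nonzero, and it is
the identity. -/
theorem detForm_curryLeft_removeNth (x : EuclideanSpace ℝ (Fin (k + 1))) (i : Fin (k + 1)) :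
    (detForm (k + 1)).curryLeft x
      (i.removeNth fun j => (EuclideanSpace.single j 1 : EuclideanSpace ℝ (Fin (k + 1)))) =
      (-1) ^ (i : ℕ) * x i := by
  rw [ContinuousAlternatingMap.curryLeft_apply_apply, detForm_apply, Matrix.det_succ_row_zero,
    Finset.sum_eq_single i]
  · have : (Matrix.of fun a j => (Matrix.vecCons x (i.removeNth fun j =>
        (EuclideanSpace.single j 1 : EuclideanSpace ℝ (Fin (k + 1)))) a) j).submatrix
        Fin.succ i.succAbove = 1 := by
      ext a b
      simp [Fin.removeNth, Matrix.one_apply, eq_comm]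
    rw [this, Matrix.det_one]
    simp
  · intro j _ hj
    obtain ⟨a, ha⟩ := Fin.exists_succAbove_eq hj
    rw [Matrix.det_eq_zero_of_row_eq_zero a, mul_zero]
    intro b
    simp [Fin.removeNth, ha]
  · simp

/-- The `k`-form `h ι_x (dx₀ ∧ ⋯ ∧ dx_k)`. -/
def radialForm (h : EuclideanSpace ℝ (Fin (k + 1)) → ℝ) (x : EuclideanSpace ℝ (Fin (k + 1))) :
    EuclideanSpace ℝ (Fin (k + 1)) [⋀^Fin k]→L[ℝ] ℝ :=
  h x • (detForm (k + 1)).curryLeft x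

theorem contDiffOn_radialForm {h : EuclideanSpace ℝ (Fin (k + 1)) → ℝ}
    {s : Set (EuclideanSpace ℝ (Fin (k + 1)))} (hh : ContDiffOn ℝ ∞ h s) :
    ContDiffOn ℝ ∞ (radialForm h) s :=
  hh.smul (detForm (k + 1)).curryLeft.contDiff.contDiffOn

theorem radialForm_removeNth (h : EuclideanSpace ℝ (Fin (k + 1)) → ℝ)
    (x : EuclideanSpace ℝ (Fin (k + 1))) (i : Fin (k + 1)) :
    radialForm h x (i.removeNth fun j => (EuclideanSpace.single j 1 : EuclideanSpace ℝ (Fin (k + 1))))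
      = (-1) ^ (i : ℕ) * (h x * x i) := by
  rw [radialForm, ContinuousAlternatingMap.smul_apply, detForm_curryLeft_removeNth, smul_eq_mul]
  ring

theorem fderiv_self_eq_sum {n : ℕ} {F : Type*} [NormedAddCommGroup F] [NormedSpace ℝ F]
    (L : EuclideanSpace ℝ (Fin n) →L[ℝ] F) (x : EuclideanSpace ℝ (Fin n)) :
    L x = ∑ i, x i • L (EuclideanSpace.single i 1) := by
  conv_lhs => rw [eq_sum_single x]
  simp

/-- `d(h ι_x vol)` is the divergence of the vector field `h x` times the volume form. -/
theorem extDeriv_radialForm {h : EuclideanSpace ℝ (Fin (k + 1)) → ℝ}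
    {x : EuclideanSpace ℝ (Fin (k + 1))} (hh : DifferentiableAt ℝ h x) :
    extDeriv (radialForm h) x (fun j => EuclideanSpace.single j 1) =
      (k + 1) * h x + fderiv ℝ h x x := by
  have hd : DifferentiableAt ℝ (radialForm h) x :=
    hh.smul (detForm (k + 1)).curryLeft.differentiableAt
  rw [extDeriv_apply hd]
  have hi : ∀ i : Fin (k + 1), fderiv ℝ (fun x => radialForm h x (i.removeNth fun j =>
      (EuclideanSpace.single j 1 : EuclideanSpace ℝ (Fin (k + 1))))) x (EuclideanSpace.single i 1) =
      (-1) ^ (i : ℕ) * (h x + x i * fderiv ℝ h x (EuclideanSpace.single i 1)) := by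
    intro i
    simp only [radialForm_removeNth]
    have h1 : HasFDerivAt (fun x : EuclideanSpace ℝ (Fin (k + 1)) => x i)
      (EuclideanSpace.proj i : EuclideanSpace ℝ (Fin (k + 1)) →L[ℝ] ℝ) x :=
      (EuclideanSpace.proj i : EuclideanSpace ℝ (Fin (k + 1)) →L[ℝ] ℝ).hasFDerivAt
    have h2 : HasFDerivAt (fun x => (-1) ^ (i : ℕ) * (h x * x i)) _ x :=
      (hh.hasFDerivAt.mul h1).const_mul _
    rw [h2.fderiv]
    simp [mul_add]
  simp only [hi, zsmul_eq_mul]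
  rw [fderiv_self_eq_sum (fderiv ℝ h x) x]
  push_cast
  simp only [← mul_assoc, ← mul_pow]
  simp [Finset.sum_add_distrib]

theorem eq_zero_of_apply_basis {α : EuclideanSpace ℝ (Fin k) [⋀^Fin k]→L[ℝ] ℝ}
    (h : α (fun j => EuclideanSpace.single j 1) = 0) : α = 0 := by
  have h1 := α.toAlternatingMap.eq_smul_basis_det (EuclideanSpace.basisFun (Fin k) ℝ).toBasis
  have h2 : α.toAlternatingMap (EuclideanSpace.basisFun (Fin k) ℝ).toBasis = 0 := by
    rw [← h]
    change α _ = _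
    congr 1
    funext j
    simp
  rw [h2, zero_smul] at h1
  ext w
  exact congrArg (fun β : EuclideanSpace ℝ (Fin k) [⋀^Fin k]→ₗ[ℝ] ℝ => β w) h1

/-- The coefficient of the closed form on the horn, cut off away from the tip. -/
def coneCoeff (k : ℕ) (a : ℝ) (x : EuclideanSpace ℝ (Fin (k + 1))) : ℝ :=
  cutoff a x * (‖x‖ ^ (k + 1))⁻¹

variable {a : ℝ}

theorem contDiffOn_norm_pow_inv :
    ContDiffOn ℝ ∞ (fun x : EuclideanSpace ℝ (Fin (k + 1)) => (‖x‖ ^ (k + 1))⁻¹) {0}ᶜ :=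
  ((contDiffOn_id.norm ℝ fun _ hx => hx).pow _).inv fun _ hx => (pow_pos (norm_pos_iff.2 hx) _).ne'

theorem contDiffOn_coneCoeff : ContDiffOn ℝ ∞ (coneCoeff k a) {0}ᶜ :=
  contDiff_cutoff.contDiffOn.mul contDiffOn_norm_pow_inv

theorem differentiableAt_coneCoeff {x : EuclideanSpace ℝ (Fin (k + 1))} (hx : x ≠ 0) :
    DifferentiableAt ℝ (coneCoeff k a) x :=
  (contDiffOn_coneCoeff.contDiffAt (isOpen_compl_singleton.mem_nhds hx)).differentiableAt (by simp)

/-- The factor `x` in the contraction cancels one power of `|x|`, leaving exactly the growth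
`|x|^(-k)` allowed by `isL2_X_form`. -/
theorem norm_radialForm_coneCoeff_le {x : EuclideanSpace ℝ (Fin (k + 1))} (hx : x ≠ 0) :
    ‖radialForm (coneCoeff k a) x‖ ≤ ‖detForm (k + 1)‖ * (‖x‖ ^ k)⁻¹ := by
  have hp : 0 < ‖x‖ := norm_pos_iff.2 hx
  rw [radialForm, norm_smul, coneCoeff, norm_mul, norm_inv, norm_pow, norm_norm]
  have h1 : ‖cutoff a x‖ ≤ 1 := by
    rw [cutoff, Real.norm_of_nonneg (Real.smoothTransition.nonneg _)]
    exact Real.smoothTransition.le_one _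
  have h2 : ‖(detForm (k + 1)).curryLeft x‖ ≤ ‖detForm (k + 1)‖ * ‖x‖ := by
    rw [← ContinuousAlternatingMap.norm_curryLeft]
    exact ContinuousLinearMap.le_opNorm _ _
  calc _ ≤ 1 * (‖x‖ ^ (k + 1))⁻¹ * (‖detForm (k + 1)‖ * ‖x‖) := by gcongr
    _ = _ := by
      rw [pow_succ]
      field_simp

theorem radialForm_coneCoeff_eq_zero {x : EuclideanSpace ℝ (Fin (k + 1))} (h : 2 ≤ a * ‖x‖ ^ 2) :
    radialForm (coneCoeff k a) x = 0 := by
  rw [radialForm, coneCoeff, cutoff_eq_zero h, zero_mul, zero_smul]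

/-- The form is closed near the tip. -/
theorem extDeriv_coneForm_eq_zero {x : EuclideanSpace ℝ (Fin (k + 1))} (hx : x ≠ 0)
    (h : a * ‖x‖ ^ 2 < 1) : extDeriv (radialForm (coneCoeff k a)) x = 0 := by
  apply eq_zero_of_apply_basis
  rw [extDeriv_radialForm (differentiableAt_coneCoeff hx)]
  have hp : 0 < ‖x‖ := norm_pos_iff.2 hx
  have hl : HasDerivAt (fun t : ℝ => t • x) x 1 := by
    simpa using (hasDerivAt_id (1 : ℝ)).smul_const x
  have h1 : HasDerivAt (fun t : ℝ => coneCoeff k a (t • x)) (fderiv ℝ (coneCoeff k a) x x) 1 := by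
    have h0 : HasFDerivAt (coneCoeff k a) (fderiv ℝ (coneCoeff k a) x) ((1 : ℝ) • x) := by
      rw [one_smul]
      exact (differentiableAt_coneCoeff hx).hasFDerivAt
    exact h0.comp_hasDerivAt 1 hl
  -- Near the tip the cutoff is `1`, so the coefficient is positively homogeneous of degree
  -- `-(k+1)`. Differentiating along the ray gives Euler's relation, which cancels the divergence
  -- term `(k+1) h`.
  have h2 : (fun t : ℝ => coneCoeff k a (t • x)) =ᶠ[𝓝 1]
      fun t => (t ^ (k + 1))⁻¹ * (‖x‖ ^ (k + 1))⁻¹ := by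
    have hc : Continuous fun t : ℝ => a * ‖t • x‖ ^ 2 := by fun_prop
    filter_upwards [(isOpen_lt hc continuous_const).mem_nhds
      (show a * ‖(1 : ℝ) • x‖ ^ 2 < 1 by rwa [one_smul]),
      isOpen_Ioi.mem_nhds (show (0 : ℝ) < 1 from one_pos)] with t ht ht0
    rw [coneCoeff, cutoff_eq_one (le_of_lt ht), norm_smul, Real.norm_of_nonneg (le_of_lt ht0),
      mul_pow, mul_inv, one_mul]
  have h3 := (((hasDerivAt_pow (k + 1) (1 : ℝ)).inv (by simp)).mul_const
    (‖x‖ ^ (k + 1))⁻¹).congr_of_eventuallyEq h2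
  rw [h1.unique h3, coneCoeff, cutoff_eq_one h.le]
  simp only [one_pow, mul_one, div_one, one_mul]
  push_cast
  ring

theorem extDeriv_coneForm_eq_zero_of_lt {x : EuclideanSpace ℝ (Fin (k + 1))} (h : 2 < a * ‖x‖ ^ 2) :
    extDeriv (radialForm (coneCoeff k a)) x = 0 := by
  have h1 : radialForm (coneCoeff k a) =ᶠ[𝓝 x] fun _ => 0 := by
    have hc : Continuous fun x : EuclideanSpace ℝ (Fin (k + 1)) => a * ‖x‖ ^ 2 := by fun_prop
    filter_upwards [(isOpen_lt continuous_const hc).mem_nhds h] with y hy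
    exact radialForm_coneCoeff_eq_zero (le_of_lt hy)
  rw [h1.extDeriv_eq]
  simp only [extDeriv, fderiv_fun_const, Pi.zero_apply]
  exact (ContinuousAlternatingMap.alternatizeUncurryFinCLM ℝ _ _).map_zero

theorem contDiffOn_extDeriv_coneForm :
    ContDiffOn ℝ ∞ (extDeriv (radialForm (coneCoeff k a))) {0}ᶜ := by
  have h := (contDiffOn_radialForm (contDiffOn_coneCoeff (k := k) (a := a))).fderiv_of_isOpen
    isOpen_compl_singleton (m := ∞) (by simp)
  exact (ContinuousAlternatingMap.alternatizeUncurryFinCLM ℝ _ _).contDiff.comp_contDiffOn h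

/-- The derivative vanishes near the tip and far away; in between lies a compact shell avoiding the
origin, where continuity gives the bound. -/
theorem exists_norm_extDeriv_coneForm_le (ha : 0 < a) : ∃ K : ℝ,
    ∀ x : EuclideanSpace ℝ (Fin (k + 1)), x ≠ 0 →
      ‖extDeriv (radialForm (coneCoeff k a)) x‖ ≤ K * (‖x‖ ^ k)⁻¹ := by
  set S : Set (EuclideanSpace ℝ (Fin (k + 1))) := {x | 1 ≤ a * ‖x‖ ^ 2 ∧ a * ‖x‖ ^ 2 ≤ 2}
  have hc : Continuous fun x : EuclideanSpace ℝ (Fin (k + 1)) => a * ‖x‖ ^ 2 := by fun_prop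
  have hS : IsCompact S := by
    refine Metric.isCompact_of_isClosed_isBounded
      ((isClosed_le continuous_const hc).inter (isClosed_le hc continuous_const)) ?_
    refine (Metric.isBounded_closedBall (x := 0) (r := √(2 / a))).subset fun x hx => ?_
    rw [mem_closedBall_zero_iff]
    refine Real.le_sqrt_of_sq_le ?_
    rw [le_div_iff₀ ha, mul_comm]
    exact hx.2
  have hcont : ContinuousOn (fun x => ‖x‖ ^ k • extDeriv (radialForm (coneCoeff k a)) x) S := by
    refine ContinuousOn.smul (continuous_norm.pow k).continuousOn (contDiffOn_extDeriv_coneForm.continuousOn.mono ?_)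
    rintro x hx rfl
    have := hx.1
    norm_num at this
  obtain ⟨K, hK⟩ := hS.exists_bound_of_continuousOn hcont
  refine ⟨max K 0, fun x hx => ?_⟩
  have hp : 0 < ‖x‖ ^ k := pow_pos (norm_pos_iff.2 hx) _
  rcases lt_or_ge (a * ‖x‖ ^ 2) 1 with h1 | h1
  · rw [extDeriv_coneForm_eq_zero hx h1, norm_zero]
    positivity
  rcases lt_or_ge 2 (a * ‖x‖ ^ 2) with h2 | h2
  · rw [extDeriv_coneForm_eq_zero_of_lt h2, norm_zero]
    positivity
  · have h3 := (hK x ⟨h1, h2⟩).trans (le_max_left K 0)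
    rw [norm_smul, norm_pow, norm_norm] at h3
    rw [← div_eq_mul_inv, le_div_iff₀ hp, mul_comm]
    exact h3

end Radial

/-! ### Forms dual to multivectors -/

theorem continuous_lowerForm {d j : ℕ} (v : Fin j → EuclideanSpace ℝ (Fin d)) :
    Continuous fun G : Matrix (Fin d) (Fin d) ℝ => lowerForm G v := by
  rw [← continuousOn_univ]
  refine continuousOn_compContinuousLinearMap continuousOn_const (Continuous.continuousOn ?_)
  refine continuous_finsetSum _ fun i _ => continuous_finsetSum _ fun a _ => ?_
  refine Continuous.smul (f := fun G : Matrix (Fin d) (Fin d) ℝ => (G *ᵥ v a) i) ?_ continuous_const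
  have : Continuous fun G : Matrix (Fin d) (Fin d) ℝ => G *ᵥ v a :=
    Continuous.matrix_mulVec continuous_id continuous_const
  exact (continuous_apply i).comp this

namespace Horn

variable {E : Type*} [NormedAddCommGroup E] [NormedSpace ℝ E] {k l : ℕ} (H : Horn E k l)

theorem pull_R_form {j : ℕ} (α : EuclideanSpace ℝ (Fin (k + 1 + l)) →
      EuclideanSpace ℝ (Fin (k + 1 + l)) [⋀^Fin j]→L[ℝ] ℝ)
    {u : EuclideanSpace ℝ (Fin (k + 1 + l))} (hu : u ∈ chartSource k l) :
    H.chart.pull (H.R.form α) u = α u := by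
  have h := H.R.pull_form α H.chart (u := u) hu (H.lift_mem_chartDom hu)
  have h2 : (fun u => H.R.toFun (H.chart.toFun u)) =ᶠ[𝓝 u] id := by
    filter_upwards [isOpen_chartSource.mem_nhds hu] with w hw
    exact H.R_lift hw
  rw [h2.fderiv_eq, fderiv_id] at h
  rw [h, show H.R.toFun (H.chart.toFun u) = u from H.R_lift hu]
  rfl

theorem pull_R_form_of_notMem_range {j : ℕ} (α : EuclideanSpace ℝ (Fin (k + 1 + l)) →
      EuclideanSpace ℝ (Fin (k + 1 + l)) [⋀^Fin j]→L[ℝ] ℝ) (ψ : LocalParam H.M (k + 1 + l))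
    (u : ψ.source) (h : ψ.toM u ∉ Set.range H.chart.toM) : ψ.pull (H.R.form α) u = 0 := by
  refine H.R.pull_form_of_notMem α ψ fun hd => h ?_
  obtain ⟨w, hw, -⟩ := H.exists_chart_eq hd (ψ.ne_zero u u.2) (ψ.mem u u.2)
  exact ⟨w, hw⟩

theorem supportedIn_R_form {j : ℕ} {α : EuclideanSpace ℝ (Fin (k + 1 + l)) →
      EuclideanSpace ℝ (Fin (k + 1 + l)) [⋀^Fin j]→L[ℝ] ℝ} {r : ℝ} {U : Set (ℙ ℝ E)}
    (hU : ∀ v (hv : v ≠ 0), Projectivization.mk ℝ v hv ∈ H.M → ‖H.X.toFun v‖ < r →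
      Projectivization.mk ℝ v hv ∈ U) (hr : ∀ u, r ≤ ‖fstCLM k l u‖ → α u = 0) :
    SupportedIn H.M (k + 1 + l) U (H.R.form α) := by
  intro ψ u hu
  by_cases hd : ψ.toFun u ∈ H.R.dom
  · rw [H.R.pull_form α ψ u.2 hd, hr]
    · rfl
    · have : fstCLM k l (H.R.toFun (ψ.toFun u)) = H.X.toFun (ψ.toFun u) := by
        rw [fstCLM_apply]
        exact congrArg Prod.fst ((splitEquiv (k + 1) l).apply_symm_apply _)
      rw [this]
      by_contra! h
      exact hu (hU _ (ψ.ne_zero u u.2) (ψ.mem u u.2) h)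
  · exact H.R.pull_form_of_notMem α ψ hd

/-- The form whose inner product with `β` has integral `∫ w β(v)`, in the chart. -/
def dualForm (g : ProjMetric E) {j : ℕ} (w : EuclideanSpace ℝ (Fin (k + 1 + l)) → ℝ)
    (v : Fin j → EuclideanSpace ℝ (Fin (k + 1 + l))) (u : EuclideanSpace ℝ (Fin (k + 1 + l))) :
    EuclideanSpace ℝ (Fin (k + 1 + l)) [⋀^Fin j]→L[ℝ] ℝ :=
  (w u / H.chart.density g u) • lowerForm (H.chart.gram g u) v

/-- Division by the density cancels the volume, and lowering indices cancels the inner product: the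
integrand no longer depends on `g`. -/
theorem density_mul_formInner_dualForm (g : ProjMetric E) {j : ℕ}
    (w : EuclideanSpace ℝ (Fin (k + 1 + l)) → ℝ)
    (v : Fin j → EuclideanSpace ℝ (Fin (k + 1 + l))) {u : EuclideanSpace ℝ (Fin (k + 1 + l))}
    (hu : u ∈ chartSource k l) (β : EuclideanSpace ℝ (Fin (k + 1 + l)) [⋀^Fin j]→L[ℝ] ℝ) :
    H.chart.density g u * formInner (H.chart.gram g u) β (H.dualForm g w v u) = w u * β v := by
  have hd := H.chart.density_pos g (u := u) hu
  rw [dualForm, formInner_smul_right,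
    formInner_lowerForm _ (H.chart.gram_det_pos g (u := u) hu).ne']
  field_simp

theorem continuousOn_dualForm [FiniteDimensional ℝ E] (g : ProjMetric E) {j : ℕ}
    {w : EuclideanSpace ℝ (Fin (k + 1 + l)) → ℝ} (hw : Continuous w)
    (v : Fin j → EuclideanSpace ℝ (Fin (k + 1 + l))) :
    ContinuousOn (H.dualForm g w v) (chartSource k l) :=
  (hw.continuousOn.div (H.chart.continuousOn_density g) fun _ hu =>
    (H.chart.density_pos g hu).ne').smul
    ((continuous_lowerForm v).comp_continuousOn (H.chart.continuousOn_gram g))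

/-! ### The weight -/

/-- The projection `(x, t) ↦ t`. -/
def sndCLM (k l : ℕ) : EuclideanSpace ℝ (Fin (k + 1 + l)) →L[ℝ] EuclideanSpace ℝ (Fin l) :=
  (ContinuousLinearMap.snd ℝ _ _) ∘L (splitEquiv (k + 1) l).toContinuousLinearMap

/-- The standard basis vectors in the `x`-directions. -/
def xBasis (k l : ℕ) (i : Fin (k + 1)) : EuclideanSpace ℝ (Fin (k + 1 + l)) :=
  EuclideanSpace.single (Fin.castAdd l i) 1

theorem fstCLM_xBasis (i : Fin (k + 1)) : fstCLM k l (xBasis k l i) = EuclideanSpace.single i 1 :=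
  congrArg Prod.fst (splitEquiv_single_castAdd i)

theorem sndCLM_xBasis (i : Fin (k + 1)) : sndCLM k l (xBasis k l i) = 0 :=
  congrArg Prod.snd (splitEquiv_single_castAdd i)

/-- A bump function of `t`. -/
def tBump (l : ℕ) : ContDiffBump (0 : EuclideanSpace ℝ (Fin l)) := ⟨1 / 2, 1, by norm_num, by norm_num⟩

/-- A smooth compactly supported weight on the parameter space. -/
def weight (k l : ℕ) (a : ℝ) (u : EuclideanSpace ℝ (Fin (k + 1 + l))) : ℝ :=
  cutoff a (fstCLM k l u) * tBump l (sndCLM k l u)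

/-- The derivatives of the weight in the `x`-directions. -/
def dWeight (k l : ℕ) (a : ℝ) (i : Fin (k + 1)) (u : EuclideanSpace ℝ (Fin (k + 1 + l))) : ℝ :=
  fderiv ℝ (weight k l a) u (xBasis k l i)

variable {a : ℝ}

theorem contDiff_weight : ContDiff ℝ ∞ (weight k l a) :=
  (contDiff_cutoff.comp (fstCLM k l).contDiff).mul ((tBump l).contDiff.comp (sndCLM k l).contDiff)

theorem continuous_dWeight (i : Fin (k + 1)) : Continuous (dWeight k l a i) :=
  ((contDiff_weight.continuous_fderiv (by simp)).clm_apply continuous_const)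

theorem dWeight_eq (i : Fin (k + 1)) (u : EuclideanSpace ℝ (Fin (k + 1 + l))) :
    dWeight k l a i u = tBump l (sndCLM k l u) *
      fderiv ℝ (cutoff a) (fstCLM k l u) (EuclideanSpace.single i 1) := by
  have h1 : HasFDerivAt (fun u => cutoff a (fstCLM k l u))
      (fderiv ℝ (cutoff a) (fstCLM k l u) ∘L fstCLM k l) u :=
    HasFDerivAt.comp u ((contDiff_cutoff.differentiable (by simp) _).hasFDerivAt)
      (fstCLM k l).hasFDerivAt
  have h2 : HasFDerivAt (fun u => tBump l (sndCLM k l u))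
      (fderiv ℝ (tBump l) (sndCLM k l u) ∘L sndCLM k l) u :=
    HasFDerivAt.comp (g := tBump l) u
      (((tBump l).contDiff (n := 1)).differentiable one_ne_zero _).hasFDerivAt
      (sndCLM k l).hasFDerivAt
  have h3 : fderiv ℝ (weight k l a) u = _ := (h1.mul h2).fderiv
  rw [dWeight, h3]
  simp [fstCLM_xBasis, sndCLM_xBasis]

theorem weight_eq_zero_of_cutoff {u : EuclideanSpace ℝ (Fin (k + 1 + l))}
    (h : 2 ≤ a * ‖fstCLM k l u‖ ^ 2) : weight k l a u = 0 := by
  rw [weight, cutoff_eq_zero h, zero_mul]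

theorem tBump_eq_zero {t : EuclideanSpace ℝ (Fin l)} (h : 1 ≤ ‖t‖) : tBump l t = 0 :=
  (tBump l).zero_of_le_dist (by simpa [tBump] using h)

theorem fderiv_cutoff_eq_zero {n : ℕ} {x : EuclideanSpace ℝ (Fin n)}
    (h : a * ‖x‖ ^ 2 < 1 ∨ 2 < a * ‖x‖ ^ 2) : fderiv ℝ (cutoff a) x = 0 := by
  have hc : Continuous fun x : EuclideanSpace ℝ (Fin n) => a * ‖x‖ ^ 2 := by fun_prop
  rcases h with h | h
  · have : cutoff a =ᶠ[𝓝 x] fun _ => 1 := by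
      filter_upwards [(isOpen_lt hc continuous_const).mem_nhds h] with y hy
      exact cutoff_eq_one (le_of_lt hy)
    rw [this.fderiv_eq, fderiv_fun_const, Pi.zero_apply]
  · have : cutoff a =ᶠ[𝓝 x] fun _ => 0 := by
      filter_upwards [(isOpen_lt continuous_const hc).mem_nhds h] with y hy
      exact cutoff_eq_zero (le_of_lt hy)
    rw [this.fderiv_eq, fderiv_fun_const, Pi.zero_apply]

/-- A compact set which contains the supports of the derivatives of the weight. -/
def shell (k l : ℕ) (a : ℝ) : Set (EuclideanSpace ℝ (Fin (k + 1 + l))) :=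
  {u | 1 ≤ a * ‖fstCLM k l u‖ ^ 2 ∧ a * ‖fstCLM k l u‖ ^ 2 ≤ 2 ∧ ‖sndCLM k l u‖ ≤ 1}

theorem isCompact_of_bounds (ha : 0 < a) {S : Set (EuclideanSpace ℝ (Fin (k + 1 + l)))}
    (hS : IsClosed S) (h : ∀ u ∈ S, a * ‖fstCLM k l u‖ ^ 2 ≤ 2 ∧ ‖sndCLM k l u‖ ≤ 1) :
    IsCompact S := by
  refine Metric.isCompact_of_isClosed_isBounded hS ?_
  refine (Metric.isBounded_closedBall (x := 0) (r := √(2 / a + 1))).subset fun u hu => ?_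
  obtain ⟨h1, h2⟩ := h u hu
  rw [mem_closedBall_zero_iff]
  refine Real.le_sqrt_of_sq_le ?_
  have h3 := norm_splitEquiv_symm (fstCLM k l u) (sndCLM k l u)
  have h4 : (splitEquiv (k + 1) l).symm (fstCLM k l u, sndCLM k l u) = u :=
    (splitEquiv (k + 1) l).symm_apply_apply u
  rw [h4] at h3
  rw [h3]
  refine add_le_add ?_ (pow_le_one₀ (norm_nonneg _) h2)
  rw [le_div_iff₀ ha, mul_comm]
  exact h1

theorem continuous_scale : Continuous fun u => a * ‖fstCLM k l u‖ ^ 2 := by fun_prop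

theorem isClosed_shell : IsClosed (shell k l a) :=
  (isClosed_le continuous_const continuous_scale).inter
    ((isClosed_le continuous_scale continuous_const).inter
      (isClosed_le (sndCLM k l).continuous.norm continuous_const))

theorem isCompact_shell (ha : 0 < a) : IsCompact (shell k l a) :=
  isCompact_of_bounds ha isClosed_shell fun _ hu => hu.2

theorem shell_subset : shell k l a ⊆ chartSource k l := by
  intro u hu h
  have h1 := hu.1
  rw [fstCLM_apply, h] at h1
  norm_num at h1

theorem dWeight_eq_zero {u : EuclideanSpace ℝ (Fin (k + 1 + l))} (hu : u ∉ shell k l a)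
    (i : Fin (k + 1)) : dWeight k l a i u = 0 := by
  rw [dWeight_eq]
  by_cases h : ‖sndCLM k l u‖ ≤ 1
  · rw [fderiv_cutoff_eq_zero]
    · simp
    · by_contra! h'
      exact hu ⟨h'.1, h'.2, h⟩
  · rw [tBump_eq_zero (not_le.1 h).le, zero_mul]

/-- The support is compact in the full parameter space but may meet `x = 0`, which corresponds to
the tip. For this reason the dual form is not itself a test form. -/
theorem hasCompactSupport_weight (ha : 0 < a) : HasCompactSupport (weight k l a) := by
  refine HasCompactSupport.intro (isCompact_of_bounds ha
    (S := {u | a * ‖fstCLM k l u‖ ^ 2 ≤ 2 ∧ ‖sndCLM k l u‖ ≤ 1}) ?_ fun u hu => hu) ?_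
  · exact (isClosed_le continuous_scale continuous_const).inter
      (isClosed_le (sndCLM k l).continuous.norm continuous_const)
  · intro u hu
    by_cases h : ‖sndCLM k l u‖ ≤ 1
    · refine weight_eq_zero_of_cutoff (le_of_lt ?_)
      by_contra! h'
      exact hu ⟨h', h⟩
    · rw [weight, tBump_eq_zero (not_le.1 h).le, mul_zero]

theorem weight_sq_le_one (u : EuclideanSpace ℝ (Fin (k + 1 + l))) : weight k l a u ^ 2 ≤ 1 := by
  refine pow_le_one₀ (mul_nonneg (Real.smoothTransition.nonneg _) (tBump l).nonneg) ?_
  exact mul_le_one₀ (Real.smoothTransition.le_one _) (tBump l).nonneg (tBump l).le_one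

/-! ### The coclosed form and its codifferential -/

/-- The form dual to the weighted multivector `∂/∂x₀ ∧ ⋯ ∧ ∂/∂x_k`. -/
def coForm (g : ProjMetric E) (a : ℝ) (u : EuclideanSpace ℝ (Fin (k + 1 + l))) :
    EuclideanSpace ℝ (Fin (k + 1 + l)) [⋀^Fin (k + 1)]→L[ℝ] ℝ :=
  H.dualForm g (weight k l a) (xBasis k l) u

/-- The codifferential of `coForm`. -/
def coFormCodiff (g : ProjMetric E) (a : ℝ) (u : EuclideanSpace ℝ (Fin (k + 1 + l))) :
    EuclideanSpace ℝ (Fin (k + 1 + l)) [⋀^Fin k]→L[ℝ] ℝ :=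
  ∑ i : Fin (k + 1), (-(-1) ^ (i : ℕ) : ℝ) •
    H.dualForm g (dWeight k l a i) (i.removeNth (xBasis k l)) u

/-- The signs are those of the exterior derivative, with one more minus from moving the derivative
onto the weight. -/
theorem density_mul_formInner_coFormCodiff (g : ProjMetric E)
    {u : EuclideanSpace ℝ (Fin (k + 1 + l))} (hu : u ∈ chartSource k l)
    (β : EuclideanSpace ℝ (Fin (k + 1 + l)) [⋀^Fin k]→L[ℝ] ℝ) :
    H.chart.density g u * formInner (H.chart.gram g u) β (H.coFormCodiff g a u) =
      ∑ i : Fin (k + 1), (-(-1) ^ (i : ℕ) : ℝ) *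
        (dWeight k l a i u * β (i.removeNth (xBasis k l))) := by
  rw [coFormCodiff, formInner_sum_right, Finset.mul_sum]
  refine Finset.sum_congr rfl fun i _ => ?_
  rw [formInner_smul_right, mul_left_comm, H.density_mul_formInner_dualForm g _ _ hu]

variable [FiniteDimensional ℝ E]

theorem l2Inner_R_form (g : ProjMetric E) {j : ℕ} (θ : ProjForm E j)
    (α : EuclideanSpace ℝ (Fin (k + 1 + l)) →
      EuclideanSpace ℝ (Fin (k + 1 + l)) [⋀^Fin j]→L[ℝ] ℝ) :
    l2Inner H.M (k + 1 + l) g θ (H.R.form α) = ∫ u in chartSource k l,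
      H.chart.density g u * formInner (H.chart.gram g u) (H.chart.pull θ u) (α u) := by
  rw [l2Inner_eq_integral H.chart]
  · refine setIntegral_congr_fun isOpen_chartSource.measurableSet fun u hu => ?_
    rw [H.pull_R_form α hu]
  · intro P hP
    refine pointInner_eq_zero g _ _ fun ψ u hu => Or.inr (H.pull_R_form_of_notMem_range α ψ u ?_)
    rwa [hu]

theorem isL2_R_form (g : ProjMetric E) {j : ℕ} {α : EuclideanSpace ℝ (Fin (k + 1 + l)) →
      EuclideanSpace ℝ (Fin (k + 1 + l)) [⋀^Fin j]→L[ℝ] ℝ}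
    (hα : ContinuousOn α (chartSource k l))
    (hfin : ∫⁻ u in chartSource k l, ENNReal.ofReal (H.chart.density g u *
      formInner (H.chart.gram g u) (α u) (α u)) < ⊤) :
    IsL2 H.M (k + 1 + l) g (H.R.form α) := by
  refine ⟨H.R.aestronglyMeasurable_form hα fun v _ _ hd => H.R_mem_chartSource hd, ?_⟩
  rw [← setLIntegral_eq_of_support_subset (s := Set.range H.chart.toM), setLIntegral_range]
  · refine lt_of_eq_of_lt ?_ hfin
    refine setLIntegral_congr_fun isOpen_chartSource.measurableSet fun u hu => ?_
    rw [H.pull_R_form α hu]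
  · intro P hP
    by_contra h
    refine hP (ENNReal.ofReal_eq_zero.2 (le_of_eq (pointInner_eq_zero g _ _ fun ψ u hu =>
      Or.inl (H.pull_R_form_of_notMem_range α ψ u ?_))))
    rwa [hu]

theorem continuousOn_coForm (g : ProjMetric E) : ContinuousOn (H.coForm g a) (chartSource k l) :=
  H.continuousOn_dualForm g contDiff_weight.continuous _

theorem continuousOn_coFormCodiff (g : ProjMetric E) :
    ContinuousOn (H.coFormCodiff g a) (chartSource k l) :=
  continuousOn_finsetSum _ fun i _ =>
    ContinuousOn.fun_const_smul
      (H.continuousOn_dualForm g (continuous_dWeight i) (i.removeNth (xBasis k l))) _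

/-- By duality the square norm times the density is the codifferential evaluated on `x`-directions,
weighted by derivatives of the weight. These vanish off a compact shell away from `x = 0`, on which
everything is continuous. -/
theorem isL2_coFormCodiff (g : ProjMetric E) (ha : 0 < a) :
    IsL2 H.M (k + 1 + l) g (H.R.form (H.coFormCodiff g a)) := by
  refine H.isL2_R_form g (H.continuousOn_coFormCodiff g) ?_
  set F : EuclideanSpace ℝ (Fin (k + 1 + l)) → ℝ := fun u => ∑ i : Fin (k + 1),
    (-(-1) ^ (i : ℕ) : ℝ) * (dWeight k l a i u * H.coFormCodiff g a u (i.removeNth (xBasis k l)))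
  have hF : ContinuousOn F (chartSource k l) := by
    refine continuousOn_finsetSum _ fun i _ => continuousOn_const.mul
      ((continuous_dWeight i).continuousOn.mul ?_)
    exact (ContinuousAlternatingMap.apply ℝ _ ℝ _).continuous.comp_continuousOn
      (H.continuousOn_coFormCodiff g)
  obtain ⟨C, hC⟩ := (isCompact_shell (k := k) (l := l) ha).exists_bound_of_continuousOn
    (hF.mono shell_subset)
  have h0 : ∀ u ∉ shell k l a, F u = 0 := fun u hu => by simp [F, dWeight_eq_zero hu]
  calc _ ≤ ∫⁻ u in chartSource k l, (shell k l a).indicator (fun _ => ENNReal.ofReal C) u := by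
        refine setLIntegral_mono' isOpen_chartSource.measurableSet fun u hu => ?_
        rw [H.density_mul_formInner_coFormCodiff g hu]
        change ENNReal.ofReal (F u) ≤ _
        by_cases hs : u ∈ shell k l a
        · rw [Set.indicator_of_mem hs]
          exact ENNReal.ofReal_le_ofReal ((le_abs_self _).trans (hC u hs))
        · rw [h0 u hs, ENNReal.ofReal_zero]
          exact zero_le
    _ ≤ ∫⁻ u, (shell k l a).indicator (fun _ => ENNReal.ofReal C) u :=
        setLIntegral_le_lintegral _ _
    _ < ⊤ := by
        rw [lintegral_indicator_const isClosed_shell.measurableSet]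
        exact ENNReal.mul_lt_top ENNReal.ofReal_lt_top (isCompact_shell ha).measure_lt_top

/-- The Gram determinant of the `x`-directions is `O(rad²)` and the density is at least a multiple
of `rad |x|^k`, so the square norm times the density is `O(rad |x|^(-k))`. -/
theorem isL2_coForm (g : ProjMetric E) (ha : 0 < a) :
    IsL2 H.M (k + 1 + l) g (H.R.form (H.coForm g a)) := by
  refine H.isL2_R_form g (H.continuousOn_coForm g) ?_
  -- The weight vanishes once `|x|² ≥ 2 / a`; the added `1` gives the strict inequality in `region`.
  set r := √(2 / a) + 1
  obtain ⟨c, _, hc, _, hdens⟩ := H.exists_density_bounds g r 1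
  obtain ⟨C, hC, hdet⟩ := H.exists_gram_x_bound g r 1
  -- Pairing the dual form with itself evaluates it on the `x`-basis, which yields the Gram
  -- determinant of those vectors divided by the density.
  have hval : ∀ u ∈ chartSource k l, H.chart.density g u *
      formInner (H.chart.gram g u) (H.coForm g a u) (H.coForm g a u) =
      weight k l a u ^ 2 * ((H.chart.density g u)⁻¹ *
        ((H.chart.gram g u).submatrix (Fin.castAdd l) (Fin.castAdd l)).det) := by
    intro u hu
    rw [coForm, H.density_mul_formInner_dualForm g _ _ hu, dualForm,
      ContinuousAlternatingMap.smul_apply, lowerForm_apply]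
    have : (Matrix.of fun i j => (xBasis k l i).ofLp ⬝ᵥ (H.chart.gram g u *ᵥ (xBasis k l j).ofLp)) =
        (H.chart.gram g u).submatrix (Fin.castAdd l) (Fin.castAdd l) := by
      ext i j
      simp [xBasis]
    rw [this, smul_eq_mul]
    ring
  calc _ ≤ ∫⁻ u in chartSource k l, (region k l r 1).indicator (fun u => ENNReal.ofReal (C / c) *
          ENNReal.ofReal (H.rad (splitEquiv (k + 1) l u).1 *
            (‖(splitEquiv (k + 1) l u).1‖ ^ k)⁻¹)) u := by
        refine setLIntegral_mono' isOpen_chartSource.measurableSet fun u hu => ?_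
        rw [hval u hu]
        by_cases hs : u ∈ region k l r 1
        · rw [Set.indicator_of_mem hs, ← ENNReal.ofReal_mul (by positivity)]
          refine ENNReal.ofReal_le_ofReal ?_
          have h1 := (hdens u hu hs.2.1.le hs.2.2).1
          have h2 := hdet u hu hs.2.1.le hs.2.2
          have hp := H.rad_mul_pow_pos hu
          have hd := H.chart.density_pos g (u := u) hu
          have hrad := lt_of_lt_of_le one_pos (H.one_le_rad (splitEquiv (k + 1) l u).1)
          have hx : 0 < ‖(splitEquiv (k + 1) l u).1‖ ^ k := pow_pos (norm_pos_iff.2 hu) _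
          have hdet0 : 0 ≤ ((H.chart.gram g u).submatrix (Fin.castAdd l) (Fin.castAdd l)).det :=
            ((H.chart.gram_posDef g (u := u) hu).posSemidef.submatrix _).det_nonneg
          calc _ ≤ 1 * ((H.chart.density g u)⁻¹ * _) :=
                mul_le_mul_of_nonneg_right (weight_sq_le_one u)
                  (mul_nonneg (inv_nonneg.2 hd.le) hdet0)
            _ ≤ 1 * ((c * (H.rad (splitEquiv (k + 1) l u).1 *
                  ‖(splitEquiv (k + 1) l u).1‖ ^ k))⁻¹ *
                  (C * H.rad (splitEquiv (k + 1) l u).1 ^ 2)) := by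
                rw [one_mul, one_mul]
                exact mul_le_mul (inv_anti₀ (mul_pos hc hp) h1) h2 hdet0 (by positivity)
            _ = _ := by field_simp
        · have : weight k l a u = 0 := by
            by_cases ht : ‖sndCLM k l u‖ ≤ 1
            · refine weight_eq_zero_of_cutoff ?_
              by_contra! h
              refine hs ⟨hu, ?_, ht⟩
              refine lt_of_le_of_lt (Real.le_sqrt_of_sq_le ?_) (lt_add_one _)
              rw [le_div_iff₀ ha, mul_comm]
              exact h.le
            · rw [weight, tBump_eq_zero (not_le.1 ht).le, mul_zero]
          rw [this]
          simp
    _ ≤ ∫⁻ u, (region k l r 1).indicator (fun u => ENNReal.ofReal (C / c) *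
          ENNReal.ofReal (H.rad (splitEquiv (k + 1) l u).1 *
            (‖(splitEquiv (k + 1) l u).1‖ ^ k)⁻¹)) u := setLIntegral_le_lintegral _ _
    _ < ⊤ := by
        rw [lintegral_indicator (measurableSet_region r 1),
          lintegral_const_mul' _ _ ENNReal.ofReal_ne_top]
        exact ENNReal.mul_lt_top ENNReal.ofReal_lt_top (H.setLIntegral_region_lt_top r 1)

end Horn

/-! ### Failure of the Stokes identity -/

namespace Horn

variable {E : Type*} [NormedAddCommGroup E] [NormedSpace ℝ E] [FiniteDimensional ℝ E]
  {k l : ℕ} (H : Horn E k l) {a : ℝ}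

/-- Integration by parts against a function which vanishes near `x = 0`. -/
theorem setIntegral_weight_mul_fderiv (ha : 0 < a) {f : EuclideanSpace ℝ (Fin (k + 1 + l)) → ℝ}
    {c : ℝ} (hc : 0 < c) (hf : ContDiffOn ℝ ∞ f (chartSource k l))
    (h0 : ∀ u ∈ chartSource k l, ‖fstCLM k l u‖ < c → f u = 0) (i : Fin (k + 1)) :
    IntegrableOn (fun u => weight k l a u * fderiv ℝ f u (xBasis k l i)) (chartSource k l) ∧
    IntegrableOn (fun u => dWeight k l a i u * f u) (chartSource k l) ∧
    ∫ u in chartSource k l, weight k l a u * fderiv ℝ f u (xBasis k l i) =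
      -∫ u in chartSource k l, dWeight k l a i u * f u := by
  -- Because `f` vanishes for small `|x|`, its extension by zero across `x = 0` is smooth on the
  -- full parameter space. There the weight has compact support, and ordinary integration by parts
  -- leaves no boundary term.
  set f' : EuclideanSpace ℝ (Fin (k + 1 + l)) → ℝ := (chartSource k l).indicator f
  have heq : ∀ u ∈ chartSource k l, f' =ᶠ[𝓝 u] f := fun u hu => by
    filter_upwards [isOpen_chartSource.mem_nhds hu] with w hw
    exact Set.indicator_of_mem hw _
  have hzero : ∀ u ∉ chartSource k l, f' =ᶠ[𝓝 u] fun _ => 0 := fun u hu => by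
    have hu' : ‖fstCLM k l u‖ < c := by
      have : fstCLM k l u = 0 := not_not.1 hu
      rwa [this, norm_zero]
    filter_upwards [(isOpen_lt (fstCLM k l).continuous.norm continuous_const).mem_nhds hu'] with w hw
    by_cases hs : w ∈ chartSource k l
    · simp only [f', Set.indicator_of_mem hs]
      exact h0 w hs hw
    · exact Set.indicator_of_notMem hs _
  have hsm : ContDiff ℝ ∞ f' := contDiff_iff_contDiffAt.2 fun u => by
    by_cases hu : u ∈ chartSource k l
    · exact (hf.contDiffAt (isOpen_chartSource.mem_nhds hu)).congr_of_eventuallyEq (heq u hu)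
    · exact contDiffAt_const.congr_of_eventuallyEq (hzero u hu)
  have hcs := hasCompactSupport_weight (k := k) (l := l) ha
  have hcd : HasCompactSupport (dWeight k l a i) := hcs.fderiv_apply ℝ _
  have hwc := (contDiff_weight (k := k) (l := l) (a := a)).continuous
  have hfd : Continuous fun u => fderiv ℝ f' u (xBasis k l i) :=
    (hsm.continuous_fderiv (by simp)).clm_apply continuous_const
  have i1 : Integrable fun u => dWeight k l a i u * f' u :=
    ((continuous_dWeight i).mul hsm.continuous).integrable_of_hasCompactSupport hcd.mul_right
  have i2 : Integrable fun u => weight k l a u * fderiv ℝ f' u (xBasis k l i) :=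
    (hwc.mul hfd).integrable_of_hasCompactSupport hcs.mul_right
  have i3 : Integrable fun u => weight k l a u * f' u :=
    (hwc.mul hsm.continuous).integrable_of_hasCompactSupport hcs.mul_right
  have key := integral_mul_fderiv_eq_neg_fderiv_mul_of_integrable (μ := volume)
    (f := weight k l a) (g := f') (v := xBasis k l i) i1 i2 i3
    (fun u _ => contDiff_weight.differentiable (by simp) u)
    (fun u _ => hsm.differentiable (by simp) u)
  have e1 : Set.EqOn (fun u => weight k l a u * fderiv ℝ f u (xBasis k l i))
      (fun u => weight k l a u * fderiv ℝ f' u (xBasis k l i)) (chartSource k l) := fun u hu => by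
    simp only
    rw [(heq u hu).fderiv_eq]
  have e2 : Set.EqOn (fun u => dWeight k l a i u * f u) (fun u => dWeight k l a i u * f' u)
      (chartSource k l) := fun u hu => by
    simp only
    rw [(heq u hu).eq_of_nhds]
  have hm := (isOpen_chartSource (k := k) (l := l)).measurableSet
  refine ⟨i2.integrableOn.congr_fun e1.symm hm, i1.integrableOn.congr_fun e2.symm hm, ?_⟩
  rw [setIntegral_congr_fun hm e1, setIntegral_congr_fun hm e2,
    setIntegral_eq_integral_of_forall_compl_eq_zero, setIntegral_eq_integral_of_forall_compl_eq_zero]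
  · exact key
  · intro u hu
    rw [(hzero u hu).eq_of_nhds, mul_zero]
  · intro u hu
    rw [(hzero u hu).fderiv_eq]
    simp

/-- In the chart the pairing with `dφ` is an integral of the weight times `x`-derivatives of
components of `φ`. These components vanish near the tip, so each derivative can be moved onto the
weight. -/
theorem adjointEq_coForm (g : ProjMetric E) (ha : 0 < a) :
    AdjointEq H.M (k + 1 + l) g (H.R.form (H.coForm g a)) (H.R.form (H.coFormCodiff g a)) := by
  rintro φ dφ ⟨hφ, K, hK, hKM, hsupp⟩ hd
  obtain ⟨c, hc, hcK⟩ := H.exists_norm_lower_bound hK hKM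
  have hm := (isOpen_chartSource (k := k) (l := l)).measurableSet
  rw [l2Inner_R_form, l2Inner_R_form]
  let f : Fin (k + 1) → EuclideanSpace ℝ (Fin (k + 1 + l)) → ℝ := fun i u =>
    H.chart.pull φ u (i.removeNth (xBasis k l))
  have hf : ∀ i, ContDiffOn ℝ ∞ (f i) (chartSource k l) := fun i =>
    (ContinuousAlternatingMap.apply ℝ _ ℝ (i.removeNth (xBasis k l))).contDiff.comp_contDiffOn
      (hφ H.chart)
  have h0 : ∀ i, ∀ u ∈ chartSource k l, ‖fstCLM k l u‖ < c → f i u = 0 := by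
    intro i u hu hlt
    have : H.chart.pull φ u = 0 := by
      refine hsupp H.chart ⟨u, hu⟩ fun hmem => ?_
      have h1 := hcK _ (H.lift_ne_zero u) hmem
      rw [H.X_lift] at h1
      exact lt_asymm h1 hlt
    simp only [f, this]
    rfl
  have hp := fun i => setIntegral_weight_mul_fderiv ha hc (hf i) (h0 i) i
  have e1 : Set.EqOn (fun u => H.chart.density g u * formInner (H.chart.gram g u)
      (H.chart.pull dφ u) (H.coForm g a u)) (fun u => ∑ i : Fin (k + 1), (-1) ^ (i : ℕ) *
        (weight k l a u * fderiv ℝ (f i) u (xBasis k l i))) (chartSource k l) := by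
    intro u hu
    simp only
    rw [coForm, H.density_mul_formInner_dualForm g _ _ hu, hd H.chart u hu,
      extDeriv_apply (((hφ H.chart).contDiffAt (isOpen_chartSource.mem_nhds hu)).differentiableAt
        (by simp)), Finset.mul_sum]
    refine Finset.sum_congr rfl fun i _ => ?_
    rw [zsmul_eq_mul]
    push_cast
    ring
  have e2 : Set.EqOn (fun u => H.chart.density g u * formInner (H.chart.gram g u)
      (H.chart.pull φ u) (H.coFormCodiff g a u)) (fun u => ∑ i : Fin (k + 1), -(-1) ^ (i : ℕ) *
        (dWeight k l a i u * f i u)) (chartSource k l) := fun u hu =>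
    H.density_mul_formInner_coFormCodiff g hu _
  rw [setIntegral_congr_fun hm e1, setIntegral_congr_fun hm e2,
    integral_finsetSum _ fun i _ => (hp i).1.const_mul _,
    integral_finsetSum _ fun i _ => (hp i).2.1.const_mul _]
  refine Finset.sum_congr rfl fun i _ => ?_
  rw [integral_const_mul, integral_const_mul, (hp i).2.2]
  ring

theorem isDtMax_coForm (g : ProjMetric E) (ha : 0 < a) :
    IsDtMax H.M (k + 1 + l) g (H.R.form (H.coForm g a)) (H.R.form (H.coFormCodiff g a)) :=
  ⟨H.isL2_coForm g ha, H.isL2_coFormCodiff g ha, H.adjointEq_coForm g ha⟩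

theorem isDMax_coneForm (g : ProjMetric E) (ha : 0 < a) :
    IsDMax H.M (k + 1 + l) g (H.X.form (radialForm (coneCoeff k a)))
      (H.X.form (extDeriv (radialForm (coneCoeff k a)))) := by
  -- Beyond this radius the cutoff is zero in a neighbourhood, so its derivatives vanish too.
  have hr : ∀ x : EuclideanSpace ℝ (Fin (k + 1)), √(2 / a) + 1 ≤ ‖x‖ → 2 < a * ‖x‖ ^ 2 := by
    intro x hx
    have h1 : √(2 / a) < ‖x‖ := lt_of_lt_of_le (lt_add_one _) hx
    rw [Real.sqrt_lt' (lt_of_le_of_lt (Real.sqrt_nonneg _) h1), div_lt_iff₀ ha] at h1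
    linarith
  have hs := contDiffOn_radialForm (contDiffOn_coneCoeff (k := k) (a := a))
  obtain ⟨K, hK⟩ := exists_norm_extDeriv_coneForm_le (k := k) ha
  refine H.isDMax_X_form g (r := √(2 / a) + 1) hs
    (fun x hx => radialForm_coneCoeff_eq_zero (hr x hx.le).le) ?_ ?_
  · exact H.isL2_X_form g hs.continuousOn (fun x hx => norm_radialForm_coneCoeff_le hx)
      fun x hx => radialForm_coneCoeff_eq_zero (hr x hx).le
  · exact H.isL2_X_form g contDiffOn_extDeriv_coneForm.continuousOn hK
      fun x hx => extDeriv_coneForm_eq_zero_of_lt (hr x hx)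

/-- The cutoffs are nested: where the weight with parameter `a` is nonzero, `a |x|² < 2`, and there
the form with parameter `a / 2` is closed. -/
theorem l2Inner_extDeriv_coneForm (g : ProjMetric E) :
    l2Inner H.M (k + 1 + l) g (H.X.form (extDeriv (radialForm (coneCoeff k (a / 2)))))
      (H.R.form (H.coForm g a)) = 0 := by
  rw [l2Inner_R_form]
  refine setIntegral_eq_zero_of_forall_eq_zero fun u hu => ?_
  rw [coForm, H.density_mul_formInner_dualForm g _ _ hu]
  rcases le_or_gt 2 (a * ‖fstCLM k l u‖ ^ 2) with h | h
  · rw [weight_eq_zero_of_cutoff h, zero_mul]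
  · rw [H.pull_X_form _ hu, extDeriv_coneForm_eq_zero (x := fstCLM k l u) hu (by linarith)]
    simp

/-- The density of the boundary term. -/
def boundaryTerm (k l : ℕ) (a : ℝ) (u : EuclideanSpace ℝ (Fin (k + 1 + l))) : ℝ :=
  tBump l (sndCLM k l u) * ((‖fstCLM k l u‖ ^ (k + 1))⁻¹ * (2 * a * ‖fstCLM k l u‖ ^ 2 *
    deriv Real.smoothTransition (2 - a * ‖fstCLM k l u‖ ^ 2)))

/-- The components of the two forms combine into the radial derivative of the cutoff, the signs
`(-1)^i` cancelling in pairs. Where that derivative is nonzero the wider cutoff with parameter `a /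
2` equals `1`, so only one cutoff remains. -/
theorem l2Inner_coneForm (g : ProjMetric E) :
    l2Inner H.M (k + 1 + l) g (H.X.form (radialForm (coneCoeff k (a / 2))))
      (H.R.form (H.coFormCodiff g a)) = ∫ u, boundaryTerm k l a u := by
  have hzero : ∀ u ∉ chartSource k l, boundaryTerm k l a u = 0 := by
    intro u hu
    have : fstCLM k l u = 0 := not_not.1 hu
    simp [boundaryTerm, this]
  rw [l2Inner_R_form, ← setIntegral_eq_integral_of_forall_compl_eq_zero hzero]
  refine setIntegral_congr_fun isOpen_chartSource.measurableSet fun u hu => ?_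
  rw [H.density_mul_formInner_coFormCodiff g hu, H.pull_X_form _ hu]
  have h1 : ∀ i : Fin (k + 1), ((radialForm (coneCoeff k (a / 2)) (fstCLM k l u)).compContinuousLinearMap
      (fstCLM k l)) (i.removeNth (xBasis k l)) =
      (-1) ^ (i : ℕ) * (coneCoeff k (a / 2) (fstCLM k l u) * fstCLM k l u i) := by
    intro i
    rw [← radialForm_removeNth, ContinuousAlternatingMap.compContinuousLinearMap_apply]
    congr 1
    funext j
    exact fstCLM_xBasis _
  have h2 : ∀ i : Fin (k + 1), (-(-1) ^ (i : ℕ) : ℝ) * (dWeight k l a i u * ((-1) ^ (i : ℕ) *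
      (coneCoeff k (a / 2) (fstCLM k l u) * fstCLM k l u i))) =
      -(tBump l (sndCLM k l u) * coneCoeff k (a / 2) (fstCLM k l u)) *
        (fstCLM k l u i • fderiv ℝ (cutoff a) (fstCLM k l u) (EuclideanSpace.single i 1)) := by
    intro i
    have h3 : ((-1 : ℝ) ^ (i : ℕ)) * (-1) ^ (i : ℕ) = 1 := by
      rw [← mul_pow]
      simp
    rw [dWeight_eq, smul_eq_mul]
    linear_combination (-(tBump l (sndCLM k l u) *
      fderiv ℝ (cutoff a) (fstCLM k l u) (EuclideanSpace.single i 1) *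
      coneCoeff k (a / 2) (fstCLM k l u) * fstCLM k l u i)) * h3
  simp only [h1, h2]
  rw [← Finset.mul_sum, ← fderiv_self_eq_sum, boundaryTerm]
  rcases le_or_gt (a * ‖fstCLM k l u‖ ^ 2) 2 with h | h
  · rw [coneCoeff, cutoff_eq_one (a := a / 2) (by linarith), fderiv_cutoff_self]
    ring
  · have h3 := fderiv_cutoff_self (a := a) (fstCLM k l u)
    rw [fderiv_cutoff_eq_zero (Or.inr h)] at h3
    rw [fderiv_cutoff_eq_zero (Or.inr h)]
    have h4 : 2 * a * ‖fstCLM k l u‖ ^ 2 *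
        deriv Real.smoothTransition (2 - a * ‖fstCLM k l u‖ ^ 2) = 0 := by
      simpa using h3.symm
    rw [h4]
    simp

theorem integral_boundaryTerm_pos (ha : 0 < a) : 0 < ∫ u, boundaryTerm k l a u := by
  have hd : Continuous (deriv Real.smoothTransition) :=
    Real.smoothTransition.contDiff.continuous_deriv (n := 1) le_rfl
  have hout : ∀ u ∉ shell k l a, boundaryTerm k l a u = 0 := by
    intro u hu
    have h3 := fderiv_cutoff_self (a := a) (fstCLM k l u)
    by_cases ht : ‖sndCLM k l u‖ ≤ 1
    · rw [fderiv_cutoff_eq_zero] at h3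
      · rw [boundaryTerm, show 2 * a * ‖fstCLM k l u‖ ^ 2 *
          deriv Real.smoothTransition (2 - a * ‖fstCLM k l u‖ ^ 2) = 0 by simpa using h3.symm]
        simp
      · by_contra! h'
        exact hu ⟨h'.1, h'.2, ht⟩
    · rw [boundaryTerm, tBump_eq_zero (not_le.1 ht).le, zero_mul]
  have hcont : Continuous (boundaryTerm k l a) := by
    refine continuous_iff_continuousAt.2 fun u => ?_
    by_cases hu : fstCLM k l u = 0
    -- The negative power of `|x|` is harmless at `x = 0`, because the derivative of the cutoff
    -- vanishes in a neighbourhood.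
    · have : boundaryTerm k l a =ᶠ[𝓝 u] fun _ => 0 := by
        filter_upwards [(isOpen_lt continuous_scale continuous_const).mem_nhds
          (show a * ‖fstCLM k l u‖ ^ 2 < 1 by simp [hu])] with w hw
        exact hout w fun h => absurd h.1 (not_le.2 hw)
      exact continuousAt_const.congr this.symm
    · have h1 : ContinuousAt (fun u => (‖fstCLM k l u‖ ^ (k + 1))⁻¹) u :=
        ContinuousAt.inv₀ ((fstCLM k l).continuous.norm.pow _).continuousAt
          (pow_ne_zero _ (norm_ne_zero_iff.2 hu))
      have h2 : Continuous fun u => 2 * a * ‖fstCLM k l u‖ ^ 2 *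
          deriv Real.smoothTransition (2 - a * ‖fstCLM k l u‖ ^ 2) := by fun_prop
      exact ((tBump l).continuous.comp (sndCLM k l).continuous).continuousAt.mul
        (h1.mul h2.continuousAt)
  -- By the mean value theorem `smoothTransition` has slope `1` at some `τ` in `(0, 1)`. The point
  -- `u` below has `t = 0` and `a |x|² = 2 - τ`, so the integrand is nonzero there.
  obtain ⟨τ, hτ, hτ'⟩ := exists_deriv_eq_slope Real.smoothTransition one_pos
    Real.smoothTransition.continuous.continuousOn
    ((Real.smoothTransition.contDiff.differentiable (n := 1) one_ne_zero).differentiableOn)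
  rw [Real.smoothTransition.one, Real.smoothTransition.zero] at hτ'
  have hpos : 0 < (2 - τ) / a := div_pos (by linarith [hτ.2]) ha
  set u : EuclideanSpace ℝ (Fin (k + 1 + l)) := √((2 - τ) / a) • xBasis k l 0
  have hu1 : ‖fstCLM k l u‖ ^ 2 = (2 - τ) / a := by
    rw [map_smul, fstCLM_xBasis, norm_smul, Real.norm_of_nonneg (Real.sqrt_nonneg _)]
    simp [Real.sq_sqrt hpos.le]
  have hu2 : sndCLM k l u = 0 := by rw [map_smul, sndCLM_xBasis, smul_zero]
  refine hcont.integral_pos_of_hasCompactSupport_nonneg_nonzero (x := u)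
    (HasCompactSupport.intro (isCompact_shell ha) hout) (fun w => ?_) ?_
  · have := Real.smoothTransition.monotone.deriv_nonneg (x := 2 - a * ‖fstCLM k l w‖ ^ 2)
    have hb := (tBump l).nonneg (x := sndCLM k l w)
    simp only [boundaryTerm, Pi.zero_apply]
    positivity
  · have h0 : ‖fstCLM k l u‖ ≠ 0 := by
      intro h
      rw [h] at hu1
      norm_num at hu1
      exact hpos.ne hu1
    have hb : tBump l (0 : EuclideanSpace ℝ (Fin l)) = 1 :=
      (tBump l).one_of_mem_closedBall (by simp [tBump])
    rw [boundaryTerm, hu2, hb, hu1, mul_div_cancel₀ _ ha.ne', sub_sub_cancel, hτ']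
    have := pow_ne_zero (k + 1) h0
    have h2 : 2 * a * ((2 - τ) / a) ≠ 0 := by positivity
    simp only [one_mul]
    refine mul_ne_zero (inv_ne_zero this) (mul_ne_zero h2 (by norm_num))

/-- The `L²`-Stokes theorem fails near the tip of a horn. -/
theorem not_l2StokesHoldsIn (g : ProjMetric E) {U : Set (ℙ ℝ E)} (hU : U ∈ 𝓝 H.tip) :
    ¬ L2StokesHoldsIn H.M (k + 1 + l) U g k := by
  obtain ⟨r, hr, hrU⟩ := H.exists_radius hU
  -- The wider cutoff has parameter `a / 2` and ends where `(a / 2) |x|² = 2`, that is, exactly at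
  -- `|x| = r`.
  set a : ℝ := 4 / r ^ 2
  have ha : 0 < a := by positivity
  have hfar : ∀ x : EuclideanSpace ℝ (Fin (k + 1)), r ≤ ‖x‖ → 2 ≤ a / 2 * ‖x‖ ^ 2 := by
    intro x hx
    have h1 := pow_le_pow_left₀ hr.le hx 2
    have h2 : a / 2 * r ^ 2 = 2 := by
      simp only [a]
      field_simp
      norm_num
    have h3 := mul_le_mul_of_nonneg_left h1 (show 0 ≤ a / 2 by positivity)
    linarith
  intro h
  have h1 := h _ _ _ _
    (H.supportedIn_X_form (d := k + 1 + l) hrU fun x hx =>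
      radialForm_coneCoeff_eq_zero (k := k) (hfar x hx))
    (H.supportedIn_R_form (α := H.coForm g a) hrU fun u hu => by
      rw [coForm, dualForm, weight_eq_zero_of_cutoff, zero_div, zero_smul]
      have := hfar _ hu
      have h4 : 0 ≤ a * ‖fstCLM k l u‖ ^ 2 := by positivity
      linarith)
    (H.isDMax_coneForm g (half_pos ha)) (H.isDtMax_coForm g ha)
  rw [H.l2Inner_extDeriv_coneForm, H.l2Inner_coneForm] at h1
  exact (integral_boundaryTerm_pos ha).ne h1

end Horn

/-! ### The hypersurface -/

section DefPoly

variable {n m p q : ℕ}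

theorem defPoly_smul (hpq : q < p) (t : ℝ) (v : HomCoord n m) :
    defPoly n m p q (t • v) = t ^ (2 * p) * defPoly n m p q v := by
  have h : ∀ j, |t| ^ (2 * j) = t ^ (2 * j) := fun j => by rw [pow_mul, sq_abs, ← pow_mul]
  have h2 : t ^ (2 * p) = t ^ (2 * q) * t ^ (2 * (p - q)) := by
    rw [← pow_add]
    congr 1
    omega
  simp only [defPoly, Prod.smul_fst, Prod.smul_snd, norm_smul, Real.norm_eq_abs, mul_pow, h,
    smul_eq_mul]
  rw [h2]
  ring

theorem hasFDerivAt_defPoly (v : HomCoord n m) :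
    ∃ L : HomCoord n m →L[ℝ] ℝ, HasFDerivAt (defPoly n m p q) L v ∧ ∀ w, L w =
      p * (‖v.1‖ ^ 2) ^ (p - 1) * (2 * inner ℝ v.1 w.1) -
      ((‖v.2.1‖ ^ 2) ^ q * (((2 * (p - q) : ℕ) : ℝ) * v.2.2 ^ (2 * (p - q) - 1) * w.2.2) +
        v.2.2 ^ (2 * (p - q)) * (q * (‖v.2.1‖ ^ 2) ^ (q - 1) * (2 * inner ℝ v.2.1 w.2.1))) := by
  have hx : HasFDerivAt (fun v : HomCoord n m => v.1) (ContinuousLinearMap.fst ℝ _ _) v :=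
    hasFDerivAt_fst
  have hyz : HasFDerivAt (fun v : HomCoord n m => v.2) (ContinuousLinearMap.snd ℝ _ _) v :=
    hasFDerivAt_snd
  have hy : HasFDerivAt (fun v : HomCoord n m => v.2.1) _ v := hyz.fst
  have hz : HasFDerivAt (fun v : HomCoord n m => v.2.2) _ v := hyz.snd
  have h := (hx.norm_sq.pow p).sub ((hy.norm_sq.pow q).mul (hz.pow (2 * (p - q))))
  refine ⟨_, h.congr_of_eventuallyEq (Filter.Eventually.of_forall fun v => ?_), fun w => ?_⟩
  · simp [defPoly, pow_mul]
  · simp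

/-- Evaluated on `(x, 0, 0)` the derivative is `2p |x|^(2p)`, so its vanishing forces `x = 0`.
Conversely, `x = 0` on the cone gives `y = 0` or `z = 0`, and both exponents `2q` and `2(p - q)` are
at least `2`. -/
theorem fderiv_defPoly_eq_zero_iff (hq : 0 < q) (hpq : q < p) {v : HomCoord n m}
    (hv : defPoly n m p q v = 0) : fderiv ℝ (defPoly n m p q) v = 0 ↔ v.1 = 0 := by
  obtain ⟨L, hL, hLw⟩ := hasFDerivAt_defPoly (p := p) (q := q) v
  rw [hL.fderiv]
  constructor
  · intro h0
    have h1 := hLw (v.1, 0, 0)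
    rw [h0] at h1
    by_contra hx
    have h2 : 0 < ‖v.1‖ := norm_pos_iff.2 hx
    have h3 : 0 < (p : ℝ) := by exact_mod_cast hq.trans hpq
    simp only [zero_apply, real_inner_self_eq_norm_sq, inner_zero_right, mul_zero,
      add_zero, sub_zero] at h1
    have : 0 < (p : ℝ) * (‖v.1‖ ^ 2) ^ (p - 1) * (2 * ‖v.1‖ ^ 2) := by positivity
    exact this.ne h1
  · intro hx
    have hp : 2 * p ≠ 0 := by omega
    have hq' : 2 * q ≠ 0 := by omega
    refine ContinuousLinearMap.ext fun w => ?_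
    rw [hLw, hx]
    rw [defPoly, hx, norm_zero, zero_pow hp, zero_sub, neg_eq_zero, mul_eq_zero,
      pow_eq_zero_iff hq', norm_eq_zero, pow_eq_zero_iff (by omega)] at hv
    rcases hv with hy | hz
    · simp [hy, hq.ne']
    · have h1 : 2 * (p - q) - 1 ≠ 0 := by omega
      have h2 : 2 * (p - q) ≠ 0 := by omega
      simp only [hz, zero_pow h1, zero_pow h2, inner_zero_left]
      simp

theorem mk_mem_zeroLocus_iff (hpq : q < p) {v : HomCoord n m} (hv : v ≠ 0) :
    Projectivization.mk ℝ v hv ∈ zeroLocus (defPoly n m p q) ↔ defPoly n m p q v = 0 := by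
  refine ⟨fun h => h v hv rfl, fun h w hw hwv => ?_⟩
  obtain ⟨t, rfl⟩ := (Projectivization.mk_eq_mk_iff' ℝ _ _ hw hv).1 hwv
  rw [defPoly_smul hpq, h, mul_zero]

theorem mk_mem_singLocus_iff (hq : 0 < q) (hpq : q < p) {v : HomCoord n m} (hv : v ≠ 0) :
    Projectivization.mk ℝ v hv ∈ singLocus (defPoly n m p q) ↔
      defPoly n m p q v = 0 ∧ v.1 = 0 := by
  constructor
  · rintro ⟨h1, h2⟩
    have h3 := (mk_mem_zeroLocus_iff hpq hv).1 h1
    exact ⟨h3, (fderiv_defPoly_eq_zero_iff hq hpq h3).1 (h2 v hv rfl)⟩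
  · rintro ⟨h1, h2⟩
    refine ⟨(mk_mem_zeroLocus_iff hpq hv).2 h1, fun w hw hwv => ?_⟩
    obtain ⟨t, rfl⟩ := (Projectivization.mk_eq_mk_iff' ℝ _ _ hw hv).1 hwv
    refine (fderiv_defPoly_eq_zero_iff hq hpq (by rw [defPoly_smul hpq, h1, mul_zero])).2 ?_
    rw [Prod.smul_fst, h2, smul_zero]

theorem defPoly_eq_zero_iff (hpq : q < p) {v : HomCoord n m} (hz : v.2.2 ≠ 0) :
    defPoly n m p q v = 0 ↔ ‖v.2.2⁻¹ • v.1‖ ^ p = ‖v.2.2⁻¹ • v.2.1‖ ^ q := by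
  have h := defPoly_smul (q := q) hpq v.2.2⁻¹ v
  have h1 : defPoly n m p q v = 0 ↔ defPoly n m p q (v.2.2⁻¹ • v) = 0 := by
    rw [h, mul_eq_zero, pow_eq_zero_iff (by omega)]
    simp [hz]
  rw [h1, defPoly]
  simp only [Prod.smul_fst, Prod.smul_snd, smul_eq_mul, inv_mul_cancel₀ hz, one_pow, mul_one]
  rw [sub_eq_zero, mul_comm 2 p, mul_comm 2 q, pow_mul, pow_mul]
  exact pow_left_inj₀ (by positivity) (by positivity) two_ne_zero

/-- At `z = 0` the equation reduces to `x = 0`, which is singular; hence no regular point lies at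
infinity and the whole regular part is given by the affine equation. -/
theorem mk_mem_regularPart_iff (hq : 0 < q) (hpq : q < p) {v : HomCoord n m} (hv : v ≠ 0) :
    Projectivization.mk ℝ v hv ∈ regularPart (defPoly n m p q) ↔
      v.2.2 ≠ 0 ∧ v.1 ≠ 0 ∧ ‖v.2.2⁻¹ • v.1‖ ^ p = ‖v.2.2⁻¹ • v.2.1‖ ^ q := by
  rw [regularPart, Set.mem_sdiff, mk_mem_zeroLocus_iff hpq, mk_mem_singLocus_iff hq hpq]
  constructor
  · rintro ⟨h1, h2⟩
    have hx : v.1 ≠ 0 := fun h => h2 ⟨h1, h⟩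
    have hz : v.2.2 ≠ 0 := by
      intro hz
      rw [defPoly, hz, zero_pow (by omega), mul_zero, sub_zero] at h1
      exact hx (norm_eq_zero.1 (eq_zero_of_pow_eq_zero h1))
    exact ⟨hz, hx, (defPoly_eq_zero_iff hpq hz).1 h1⟩
  · rintro ⟨hz, hx, h⟩
    exact ⟨(defPoly_eq_zero_iff hpq hz).2 h, fun h' => hx h'.2⟩

end DefPoly

/-! ### The regular part as a horn in two ways, and the conclusion. -/

theorem pow_eq_pow_iff_eq_rpow {A B : ℝ} (hA : 0 ≤ A) (hB : 0 ≤ B) {p q : ℕ} (hq : 0 < q) :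
    A ^ p = B ^ q ↔ B = A ^ ((p : ℝ) / q) := by
  have hq' : (q : ℝ) ≠ 0 := by exact_mod_cast hq.ne'
  constructor
  · intro h
    rw [div_eq_mul_inv, Real.rpow_mul hA, Real.rpow_natCast, h, Real.pow_rpow_inv_natCast hB hq.ne']
  · rintro rfl
    rw [← Real.rpow_natCast _ q, ← Real.rpow_mul hA, div_mul_cancel₀ _ hq', Real.rpow_natCast]

/-- The regular part as a horn over the `x`-coordinates. -/
def hornX {k l p q : ℕ} (hq : 0 < q) (hpq : q < p) (hdim : p * l = q * k) :
    Horn (HomCoord (k + 1) (l + 1)) k l where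
  M := regularPart (defPoly (k + 1) (l + 1) p q)
  e := ContinuousLinearEquiv.refl ℝ _
  δ := (p : ℝ) / q
  δ_pos := div_pos (by exact_mod_cast hq.trans hpq) (by exact_mod_cast hq)
  δ_mul := by
    have hq' : (q : ℝ) ≠ 0 := by exact_mod_cast hq.ne'
    have : (p : ℝ) * l = q * k := by exact_mod_cast hdim
    rw [div_mul_eq_mul_div, this, mul_div_cancel_left₀ _ hq']
  mem_iff v hv := by
    rw [mk_mem_regularPart_iff hq hpq, pow_eq_pow_iff_eq_rpow (norm_nonneg _) (norm_nonneg _) hq]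
    rfl

/-- The regular part as a horn over the `y`-coordinates. -/
def hornY {k l p q : ℕ} (hq : 0 < q) (hpq : q < p) (hdim : p * l = q * k) :
    Horn (HomCoord (k + 1) (l + 1)) l k where
  M := regularPart (defPoly (k + 1) (l + 1) p q)
  e := ((ContinuousLinearEquiv.prodAssoc ℝ _ _ _).symm.trans
    ((ContinuousLinearEquiv.prodComm ℝ _ _).prodCongr (ContinuousLinearEquiv.refl ℝ ℝ))).trans
    (ContinuousLinearEquiv.prodAssoc ℝ _ _ _)
  δ := (q : ℝ) / p
  δ_pos := div_pos (by exact_mod_cast hq) (by exact_mod_cast hq.trans hpq)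
  δ_mul := by
    have hp' : (p : ℝ) ≠ 0 := by exact_mod_cast (hq.trans hpq).ne'
    have : (p : ℝ) * l = q * k := by exact_mod_cast hdim
    rw [div_mul_eq_mul_div, ← this, mul_div_cancel_left₀ _ hp']
  mem_iff v hv := by
    have hp : 0 < p := hq.trans hpq
    rw [mk_mem_regularPart_iff hq hpq]
    change _ ↔ v.2.2 ≠ 0 ∧ v.2.1 ≠ 0 ∧ ‖v.2.2⁻¹ • v.1‖ = ‖v.2.2⁻¹ • v.2.1‖ ^ ((q : ℝ) / p)
    rw [← pow_eq_pow_iff_eq_rpow (norm_nonneg _) (norm_nonneg _) hp]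
    refine and_congr_right fun hz => ?_
    rw [eq_comm (a := ‖v.2.2⁻¹ • v.2.1‖ ^ q)]
    -- On the regular part `x = 0` and `y = 0` are equivalent by the equation, so either one may
    -- serve as the base coordinate.
    refine and_congr_left fun h => not_congr ?_
    rw [norm_smul, norm_smul, mul_pow, mul_pow] at h
    have hz' : ‖v.2.2⁻¹‖ ≠ 0 := norm_ne_zero_iff.2 (inv_ne_zero hz)
    constructor
    · intro h0
      rw [h0, norm_zero, zero_pow hp.ne', mul_zero, eq_comm, mul_eq_zero] at h
      exact norm_eq_zero.1 (eq_zero_of_pow_eq_zero (h.resolve_left (pow_ne_zero _ hz')))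
    · intro h0
      rw [h0, norm_zero, zero_pow hq.ne', mul_zero, mul_eq_zero] at h
      exact norm_eq_zero.1 (eq_zero_of_pow_eq_zero (h.resolve_left (pow_ne_zero _ hz')))

theorem basePoint_mem_singLocus {n m p q : ℕ} (hq : 0 < q) (hpq : q < p) :
    basePoint n m ∈ singLocus (defPoly n m p q) := by
  rw [basePoint, mk_mem_singLocus_iff hq hpq]
  have h1 : 2 * p ≠ 0 := by omega
  have h2 : 2 * q ≠ 0 := by omega
  simp [defPoly, h1, h2]

/-- In the affine chart `z ≠ 0` a singular point has `x = 0`, and then the equation forces `y = 0`.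
-/
theorem exists_isolating_nhds {n m p q : ℕ} (hq : 0 < q) (hpq : q < p) :
    ∃ U ∈ 𝓝 (basePoint n m), singLocus (defPoly n m p q) ∩ U = {basePoint n m} := by
  set U : Set (ℙ ℝ (HomCoord n m)) :=
    {P | ∃ (v : HomCoord n m) (hv : v ≠ 0), Projectivization.mk ℝ v hv = P ∧ v.2.2 ≠ 0}
  have hmk : ∀ (v : HomCoord n m) (hv : v ≠ 0), Projectivization.mk ℝ v hv ∈ U ↔ v.2.2 ≠ 0 := by
    intro v hv
    refine ⟨?_, fun h => ⟨v, hv, rfl, h⟩⟩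
    rintro ⟨w, hw, h, h1⟩ h0
    obtain ⟨t, rfl⟩ := (Projectivization.mk_eq_mk_iff' ℝ _ _ hw hv).1 h
    exact h1 (by rw [Prod.smul_snd, Prod.smul_snd, h0, smul_zero])
  have hopen : IsOpen U := by
    rw [isOpen_iff_mk]
    have h1 : IsOpen {v : {v : HomCoord n m // v ≠ 0} | v.1.2.2 ≠ 0} :=
      isOpen_ne_fun (by fun_prop) continuous_const
    convert h1 using 1
    ext v
    exact hmk v.1 v.2
  have hbase : basePoint n m ∈ U := ⟨_, _, rfl, one_ne_zero⟩
  refine ⟨U, hopen.mem_nhds hbase, Set.Subset.antisymm ?_ ?_⟩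
  · rintro P ⟨hP, hU⟩
    induction P using Projectivization.ind with
    | h v hv =>
      have hz := (hmk v hv).1 hU
      obtain ⟨h1, hx⟩ := (mk_mem_singLocus_iff hq hpq hv).1 hP
      have hy : v.2.1 = 0 := by
        rw [defPoly, hx, norm_zero, zero_pow (by omega), zero_sub, neg_eq_zero, mul_eq_zero] at h1
        exact norm_eq_zero.1 (eq_zero_of_pow_eq_zero (h1.resolve_right (pow_ne_zero _ hz)))
      rw [Set.mem_singleton_iff, basePoint, Projectivization.mk_eq_mk_iff']
      refine ⟨v.2.2, Prod.ext ?_ (Prod.ext ?_ ?_)⟩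
      · simp [hx]
      · simp [hy]
      · simp
  · rintro P rfl
    exact ⟨basePoint_mem_singLocus hq hpq, hbase⟩

theorem not_l2StokesHolds_of_not_in {E : Type*} [NormedAddCommGroup E] [NormedSpace ℝ E]
    {M : Set (ℙ ℝ E)} {d k : ℕ} {U : Set (ℙ ℝ E)} {g : ProjMetric E}
    (h : ¬ L2StokesHoldsIn M d U g k) : ¬ L2StokesHolds M d g k :=
  fun h' => h fun θ σ η ζ _ _ => h' θ σ η ζ

theorem not_l2StokesHoldsIn_regularPart {n m p q : ℕ} (hn : 0 < n) (hm : 0 < m) (hq : 0 < q)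
    (hpq : q < p) (hdim : p * (m - 1) = q * (n - 1)) (g : ProjMetric (HomCoord n m)) {k : ℕ}
    (hk : k = n - 1 ∨ k = m - 1) {U : Set (ℙ ℝ (HomCoord n m))} (hU : U ∈ 𝓝 (basePoint n m)) :
    ¬ L2StokesHoldsIn (regularPart (defPoly n m p q)) (n + m - 1) U g k := by
  obtain ⟨i, rfl⟩ : ∃ i, n = i + 1 := ⟨n - 1, by omega⟩
  obtain ⟨j, rfl⟩ : ∃ j, m = j + 1 := ⟨m - 1, by omega⟩
  rw [Nat.add_sub_cancel, Nat.add_sub_cancel] at hdim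
  rcases hk with hk | hk
  · have h := (hornX hq hpq hdim).not_l2StokesHoldsIn g (U := U) hU
    rwa [hk, show i + 1 + (j + 1) - 1 = i + 1 + j by omega, Nat.add_sub_cancel]
  · have h := (hornY hq hpq hdim).not_l2StokesHoldsIn g (U := U) hU
    rwa [hk, show i + 1 + (j + 1) - 1 = j + 1 + i by omega, Nat.add_sub_cancel]

end L2Stokes

end

theorem proposition2p8 (n m p q : ℕ) (hn : 0 < n) (hm : 0 < m) (hq : 0 < q) (hpq : q < p)
    (hdim : p * (m - 1) = q * (n - 1))
    (g : L2Stokes.ProjMetric (L2Stokes.HomCoord n m)) :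
    (L2Stokes.basePoint n m ∈ L2Stokes.singLocus (L2Stokes.defPoly n m p q) ∧
      ∃ U ∈ 𝓝 (L2Stokes.basePoint n m),
        L2Stokes.singLocus (L2Stokes.defPoly n m p q) ∩ U = {L2Stokes.basePoint n m}) ∧
    ∀ k : ℕ, k = n - 1 ∨ k = m - 1 →
      ¬ L2Stokes.L2StokesHolds (L2Stokes.regularPart (L2Stokes.defPoly n m p q)) (n + m - 1) g k ∧
      ∀ U ∈ 𝓝 (L2Stokes.basePoint n m),
        ¬ L2Stokes.L2StokesHoldsIn (L2Stokes.regularPart (L2Stokes.defPoly n m p q)) (n + m - 1)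
          U g k :=
  ⟨⟨L2Stokes.basePoint_mem_singLocus hq hpq, L2Stokes.exists_isolating_nhds hq hpq⟩, fun _ hk =>
    ⟨L2Stokes.not_l2StokesHolds_of_not_in
      (L2Stokes.not_l2StokesHoldsIn_regularPart hn hm hq hpq hdim g hk Filter.univ_mem),
    fun _ hU => L2Stokes.not_l2StokesHoldsIn_regularPart hn hm hq hpq hdim g hk hU⟩⟩
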